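/- Let $M,k>0$, $\Lambda=-3k^2$, $\Delta=r^2+k^2r^4-2Mr$, let $r_+$ be the largest real zero of $\Delta$, and let $g$ be the Schwarzschild–AdS metric $$g=-\tfrac{\Delta}{r^2}dt^2+\tfrac{r^2}{\Delta}dr^2+r^2(d\vartheta^2+\sin^2\vartheta\,d\varphi^2)\quad\text{on } \mathbb R_t\times(r_+,\infty)_r\times S^2 .$$ Set $w=\Delta/r^4$, $L=\partial_t+\frac{\Delta}{r^2}\partial_r$, $\underline L=\partial_t-\frac{\Delta}{r^2}\partial_r$, $\Omega^2=\Delta/r^2$, $\mathfrak m=\frac1r(\partial_\vartheta+\frac{i}{\sin\vartheta}\partial_\varphi)$, $$\mathcal L_n=\partial_\vartheta+\tfrac{i}{\sin\vartheta}\partial_\varphi+n\cot\vartheta,\qquad \mathcal L_n^\dagger=\partial_\vartheta-\tfrac{i}{\sin\vartheta}\partial_\varphi+n\cot\vartheta,$$ and $du=\frac12\big(dt-\frac{r^2}{\Delta}dr\big)$. Let $D$ be an open subset of this spacetime and let $\widetilde\alpha_G=\widetilde\alpha_G^{[-2]}$ be a smooth spin-weighted function of weight $-2$ on $D$ (that is,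 $\widetilde\alpha_G=A(\mathfrak m^*,\mathfrak m^*)$ off the axis for a smooth real symmetric traceless 2-tensor $A$ on $D$ tangent to the spheres) which solves the $[-2]$-Teukolsky equation $$0=-L\underline L\,\widetilde\alpha_G-2\tfrac{\Delta}{r^2}\,\partial_r\!\big(\log\tfrac{\Delta}{r^4}\big)L\widetilde\alpha_G-\tfrac{\Delta}{r^4}\big(\mathcal L^{[-2]}-2+\tfrac{6M}{r}\big)\widetilde\alpha_G,$$ $$-\mathcal L^{[-2]}=\tfrac1{\sin\vartheta}\partial_\vartheta(\sin\vartheta\,\partial_\vartheta)+\tfrac1{\sin^2\vartheta}\partial_\varphi^2-4i\tfrac{\cos\vartheta}{\sin^2\vartheta}\partial_\varphi-4\cot^2\vartheta-4 .$$ With $\sigma=d\vartheta+i\sin\vartheta\,d\varphi$, the expression $$\mathfrak h=-4\,\Re\Big[2\mathcal L_2(w^{-1}L)(r\widetilde\alpha_G)\,(du\,\sigma+\sigma\,du)+4\mathcal L_1\mathcal L_2(r\widetilde\alpha_G)\,du\,du+r^{-1}(w^{-1}L)\big(r^2(w^{-1}L)\widetilde\alpha_G\big)\,\sigma\sigma\Big]$$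 (juxtaposition of one-forms is the tensor product) defines a real symmetric 2-tensor, smooth on $D$ (also across the axis $\sin\vartheta=0$), with $\mathfrak h(L,\cdot)=0$. It solves the linearised Einstein equations $$\frac{d}{d\varepsilon}\Big|_{\varepsilon=0}\big(\mathrm{Ric}(g+\varepsilon\mathfrak h)-\Lambda(g+\varepsilon\mathfrak h)\big)=0 .$$ Moreover, let the Teukolsky quantities of $\mathfrak h$ be $\widetilde\alpha^{[+2]}[\mathfrak h]=\frac{\Delta}{r}\alpha(\mathfrak m,\mathfrak m)$ and $\widetilde\alpha^{[-2]}[\mathfrak h]=\frac{\Delta}{r}\underline\alpha(\mathfrak m^*,\mathfrak m^*)$, where $\alpha,\underline\alpha$ are the linearisations along $g+\varepsilon\mathfrak h$ at $\varepsilon=0$ of the components $W(\cdot,e_4,\cdot,e_4)$, $W(\cdot,e_3,\cdot,e_3)$ of the Weyl tensor, with $e_4=\Omega^{-1}L$, $e_3=\Omega^{-1}\underline L$ and $g(e_3,e_4)=-2$; these do not depend on how the frame vectors $e_3,e_4,\mathfrak m$ are varied with $\varepsilon$. Then $$\widetilde\alpha^{[+2]}[\mathfrak h]=4\,w^2(w^{-1}L)^4\widetilde\alpha_G^{*},\qquad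 \widetilde\alpha^{[-2]}[\mathfrak h]=4\Big(\mathcal L^\dagger_{-1}\mathcal L^\dagger_0\mathcal L^\dagger_1\mathcal L^\dagger_2\,\widetilde\alpha_G^{*}-12M\,\partial_t\widetilde\alpha_G\Big).$$ -/

import Mathlib

open scoped ContDiff

namespace SAdS

noncomputable section

/-! ### Pseudo-Riemannian geometry in coordinates -/

/-- Coordinate space `ℝ⁴`. -/
abbrev Coord := Fin 4 → ℝ

/-- The components of a real covariant 2-tensor in some coordinate system. -/
abbrev Tensor2 := Coord → Matrix (Fin 4) (Fin 4) ℝ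

/-- The partial derivative `∂_a f`. -/
def pd {E : Type*} [NormedAddCommGroup E] [NormedSpace ℝ E]
    (a : Fin 4) (f : Coord → E) (x : Coord) : E :=
  fderiv ℝ f x (Pi.single a 1)

/-- Christoffel symbols `Γ^a_{bc}` of the metric with components `g`. -/
def christoffel (g : Tensor2) (a b c : Fin 4) (x : Coord) : ℝ :=
  (1 / 2) * ∑ d, (g x)⁻¹ a d *
    (pd b (fun y => g y d c) x + pd c (fun y => g y d b) x - pd d (fun y => g y b c) x)

/-- The curvature tensor `R^a_{bcd} = ∂_c Γ^a_{db} - ∂_d Γ^a_{cb} + Γ^a_{ce} Γ^e_{db}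
- Γ^a_{de} Γ^e_{cb}`. -/
def riemannUp (g : Tensor2) (a b c d : Fin 4) (x : Coord) : ℝ :=
  pd c (christoffel g a d b) x - pd d (christoffel g a c b) x
    + ∑ e, (christoffel g a c e x * christoffel g e d b x
      - christoffel g a d e x * christoffel g e c b x)

/-- The curvature tensor with all indices down, `R_{abcd}`. -/
def riemann (g : Tensor2) (a b c d : Fin 4) (x : Coord) : ℝ :=
  ∑ e, g x a e * riemannUp g e b c d x

/-- The Ricci tensor `R_{bd} = R^a_{bad}`. -/
def ricci (g : Tensor2) (b d : Fin 4) (x : Coord) : ℝ :=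
  ∑ a, riemannUp g a b a d x

/-- The scalar curvature. -/
def scalarCurv (g : Tensor2) (x : Coord) : ℝ :=
  ∑ b, ∑ d, (g x)⁻¹ b d * ricci g b d x

/-- The Weyl tensor `W_{abcd}` of a metric in dimension four. -/
def weyl (g : Tensor2) (a b c d : Fin 4) (x : Coord) : ℝ :=
  riemann g a b c d x
    - (1 / 2) * (g x a c * ricci g b d x + g x b d * ricci g a c x
        - g x a d * ricci g b c x - g x b c * ricci g a d x)
    + (scalarCurv g x / 6) * (g x a c * g x b d - g x a d * g x b c)

/-- The complex multilinear extension of the Weyl tensor at `x`, evaluated on four vectors. -/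
def weylEval (g : Tensor2) (x : Coord) (X Y Z V : Fin 4 → ℂ) : ℂ :=
  ∑ a, ∑ b, ∑ c, ∑ d, (weyl g a b c d x : ℂ) * X a * Y b * Z c * V d

/-- The perturbed metric `g + ε h`. -/
def perturb (g h : Tensor2) (ε : ℝ) : Tensor2 := fun x => g x + ε • h x

/-- `h` satisfies at `x` the linearisation around `g` of the Einstein equations
`Ric = Λ g`: the components of `Ric(g + ε h) - Λ (g + ε h)` have zero `ε`-derivative at `ε = 0`. -/
def LinEinsteinAt (Λ : ℝ) (g h : Tensor2) (x : Coord) : Prop :=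
  ∀ a b, HasDerivAt
    (fun ε : ℝ => ricci (perturb g h ε) a b x - Λ * perturb g h ε x a b) 0 0

/-! ### Schwarzschild–Anti-de Sitter

Spherical coordinates are numbered `x 0 = t`, `x 1 = r`, `x 2 = ϑ`, `x 3 = φ`. -/

/-- `Δ = r² + k² r⁴ - 2 M r`. -/
def Del (M k r : ℝ) : ℝ := r ^ 2 + k ^ 2 * r ^ 4 - 2 * M * r

/-- The horizon radius `r₊`, the largest real zero of `Δ`. -/
def horizonRadius (M k : ℝ) : ℝ := sSup {r : ℝ | Del M k r = 0}

/-- The weight `w = Δ / r⁴`. -/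
def w (M k r : ℝ) : ℝ := Del M k r / r ^ 4

/-- The Schwarzschild–AdS metric in the coordinates `(t, r, ϑ, φ)`;
note `1 + k² r² - 2 M / r = Δ / r²`. -/
def metric (M k : ℝ) : Tensor2 := fun x =>
  Matrix.diagonal ![-(1 + k ^ 2 * x 1 ^ 2 - 2 * M / x 1),
    (1 + k ^ 2 * x 1 ^ 2 - 2 * M / x 1)⁻¹, x 1 ^ 2, x 1 ^ 2 * Real.sin (x 2) ^ 2]

/-- Euclidean length of the space part of `p = (t, X, Y, Z)`. -/
def spaceNorm (p : Coord) : ℝ := Real.sqrt (p 1 ^ 2 + p 2 ^ 2 + p 3 ^ 2)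

/-- The exterior without its horizon, `ℝ_t × (r₊, ∞)_r × S²`, realised as the
open set of all `(t, r ω)`, `ω ∈ S²`, in `ℝ × ℝ³`. -/
def exterior (M k : ℝ) : Set Coord := {p | horizonRadius M k < spaceNorm p}

/-- The spherical coordinate map `(t, r, ϑ, φ) ↦ (t, r ω(ϑ, φ))`. -/
def sph (x : Coord) : Coord :=
  ![x 0, x 1 * Real.sin (x 2) * Real.cos (x 3), x 1 * Real.sin (x 2) * Real.sin (x 3),
    x 1 * Real.cos (x 2)]

/-- The spherical coordinates of the points of `D` off the axis. These points are dense in an open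
`D`, so a tensorial equation for a smooth tensor field on `D` holds on `D` once it holds in
spherical coordinates on this set. -/
def sphDomain (M k : ℝ) (D : Set Coord) : Set Coord :=
  {x | horizonRadius M k < x 1 ∧ 0 < x 2 ∧ x 2 < Real.pi ∧ sph x ∈ D}

/-- Components in spherical coordinates of a 2-tensor given on `ℝ × ℝ³`. -/
def pullbackSph (H : Tensor2) : Tensor2 := fun x => Matrix.of fun a b =>
  ∑ i, ∑ j, pd a (fun y => sph y i) x * pd b (fun y => sph y j) x * H (sph x) i j

/-- The vector `𝔪* = (1/r) (∂_ϑ - (i / sin ϑ) ∂_φ)`, as a complex vector of `ℝ³`. -/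
def mBarSpace (x : Coord) : Fin 3 → ℂ :=
  ![(Real.cos (x 2) * Real.cos (x 3) : ℝ) + Complex.I * (Real.sin (x 3) : ℝ),
    (Real.cos (x 2) * Real.sin (x 3) : ℝ) - Complex.I * (Real.cos (x 3) : ℝ),
    -(Real.sin (x 2) : ℝ)]

/-- `f`, a function of `(t, r, ϑ, φ)`, is a smooth spin-weighted function of weight `-2` on `D`:
it is `A(𝔪*, 𝔪*)` for a smooth (also across the axis) real symmetric traceless 2-tensor `A`
tangent to the spheres. -/
def SmoothSpinMinusTwo (M k : ℝ) (D : Set Coord) (f : Coord → ℂ) : Prop :=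
  ∃ A : Coord → Matrix (Fin 3) (Fin 3) ℝ,
    (∀ i j, ContDiffOn ℝ ∞ (fun p => A p i j) D) ∧
    (∀ p ∈ D, (A p).IsSymm ∧ (A p).trace = 0 ∧ (A p).mulVec ![p 1, p 2, p 3] = 0) ∧
    ∀ x ∈ sphDomain M k D,
      f x = ∑ i, ∑ j, (A (sph x) i j : ℂ) * mBarSpace x i * mBarSpace x j

/-! ### Differential operators, acting on functions of `(t, r, ϑ, φ)` -/

/-- `L = ∂_t + (Δ / r²) ∂_r`. -/
def L (M k : ℝ) (f : Coord → ℂ) : Coord → ℂ := fun x =>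
  pd 0 f x + (Del M k (x 1) / x 1 ^ 2 : ℝ) * pd 1 f x

/-- `L̲ = ∂_t - (Δ / r²) ∂_r`. -/
def Lbar (M k : ℝ) (f : Coord → ℂ) : Coord → ℂ := fun x =>
  pd 0 f x - (Del M k (x 1) / x 1 ^ 2 : ℝ) * pd 1 f x

/-- `w⁻¹ L`. -/
def wL (M k : ℝ) (f : Coord → ℂ) : Coord → ℂ := fun x =>
  ((w M k (x 1))⁻¹ : ℝ) * L M k f x

/-- `𝓛_n = (∂_ϑ + (i / sin ϑ) ∂_φ) + n cot ϑ`. -/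
def angL (n : ℤ) (f : Coord → ℂ) : Coord → ℂ := fun x =>
  (pd 2 f x + Complex.I / (Real.sin (x 2) : ℝ) * pd 3 f x)
    + n * (Real.cos (x 2) / Real.sin (x 2) : ℝ) * f x

/-- `𝓛_n^† = (∂_ϑ - (i / sin ϑ) ∂_φ) + n cot ϑ`. -/
def angLdag (n : ℤ) (f : Coord → ℂ) : Coord → ℂ := fun x =>
  (pd 2 f x - Complex.I / (Real.sin (x 2) : ℝ) * pd 3 f x)
    + n * (Real.cos (x 2) / Real.sin (x 2) : ℝ) * f x

/-- The angular operator `𝓛^{[-2]}`, where `-𝓛^{[-2]} = (1 / sin ϑ) ∂_ϑ (sin ϑ ∂_ϑ)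
+ (1 / sin² ϑ) ∂_φ² - 4 i (cos ϑ / sin² ϑ) ∂_φ - 4 cot² ϑ - 4`. -/
def angMinusTwo (f : Coord → ℂ) : Coord → ℂ := fun x =>
  -((1 / Real.sin (x 2) : ℝ) * pd 2 (fun y => (Real.sin (y 2) : ℝ) * pd 2 f y) x
    + (1 / Real.sin (x 2) ^ 2 : ℝ) * pd 3 (pd 3 f) x
    + 2 * (-2) * Complex.I * (Real.cos (x 2) / Real.sin (x 2) ^ 2 : ℝ) * pd 3 f x
    - 4 * ((Real.cos (x 2) / Real.sin (x 2)) ^ 2 : ℝ) * f x - 4 * f x)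

/-- The `[-2]`-Teukolsky operator `𝔗^{[-2]}`. -/
def teukolskyMinusTwo (M k : ℝ) (f : Coord → ℂ) : Coord → ℂ := fun x =>
  -L M k (Lbar M k f) x
    - 2 * (Del M k (x 1) / x 1 ^ 2 * deriv (fun r => Real.log (Del M k r / r ^ 4)) (x 1) : ℝ)
        * L M k f x
    - (Del M k (x 1) / x 1 ^ 4 : ℝ) * (angMinusTwo f x + (-2 + 6 * M / x 1 : ℝ) * f x)

/-! ### The reconstructed metric perturbation -/

/-- `r ^ n f`. -/
def rMul (n : ℕ) (f : Coord → ℂ) : Coord → ℂ := fun x => (x 1 : ℂ) ^ n * f x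

/-- The components of `du`, where `t = u + v`, `r⋆ = v - u` and `dr⋆ = (r² / Δ) dr`. -/
def du (M k : ℝ) (x : Coord) : Fin 4 → ℂ :=
  ![1 / 2, -((1 / 2) * (x 1 ^ 2 / Del M k (x 1)) : ℝ), 0, 0]

/-- The components of `dϑ + i sin ϑ dφ`. -/
def sig (x : Coord) : Fin 4 → ℂ := ![0, 0, 1, Complex.I * (Real.sin (x 2) : ℝ)]

/-- The real 2-tensor `𝔥[f]` in the coordinates `(t, r, ϑ, φ)`. -/
def hertz (M k : ℝ) (f : Coord → ℂ) : Tensor2 := fun x => Matrix.of fun a b =>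
  -4 * Complex.re
    (2 * angL 2 (wL M k (rMul 1 f)) x * (du M k x a * sig x b + sig x a * du M k x b)
      + 4 * angL 1 (angL 2 (rMul 1 f)) x * (du M k x a * du M k x b)
      + (x 1 : ℂ)⁻¹ * wL M k (rMul 2 (wL M k f)) x * (sig x a * sig x b))

/-! ### Linearised Teukolsky quantities -/

/-- The null vector `e₄ = Ω⁻¹ L`, with `Ω² = Δ / r²`. -/
def e4 (M k : ℝ) (x : Coord) : Fin 4 → ℝ :=
  ![(Real.sqrt (Del M k (x 1) / x 1 ^ 2))⁻¹, Real.sqrt (Del M k (x 1) / x 1 ^ 2), 0, 0]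

/-- The null vector `e₃ = Ω⁻¹ L̲`; thus `g(e₃, e₄) = -2`. -/
def e3 (M k : ℝ) (x : Coord) : Fin 4 → ℝ :=
  ![(Real.sqrt (Del M k (x 1) / x 1 ^ 2))⁻¹, -Real.sqrt (Del M k (x 1) / x 1 ^ 2), 0, 0]

/-- The complex vector `𝔪 = (1/r) (∂_ϑ + (i / sin ϑ) ∂_φ)`. -/
def mVec (x : Coord) : Fin 4 → ℂ :=
  ![0, 0, (x 1 : ℂ)⁻¹, Complex.I / (x 1 * Real.sin (x 2) : ℝ)]

/-- The complex vector `𝔪*`. -/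
def mVecBar (x : Coord) : Fin 4 → ℂ := fun a => starRingEnd ℂ (mVec x a)

/-- `v` is the value at `x` of the linearised quantity `(Δ / r) W(m, e, m, e)`, to first order in
`ε` for the metrics `g + ε h`, at the background frame vectors `e⁰`, `m⁰`, whichever
differentiable variation `e(ε)`, `m(ε)` of the frame vectors accompanies that of the metric. -/
def HasLinWeylScalar (M k : ℝ) (h : Tensor2) (x : Coord)
    (eB : Fin 4 → ℝ) (mB : Fin 4 → ℂ) (v : ℂ) : Prop :=
  ∀ (e : ℝ → Fin 4 → ℝ) (m : ℝ → Fin 4 → ℂ),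
    DifferentiableAt ℝ e 0 → DifferentiableAt ℝ m 0 → e 0 = eB → m 0 = mB →
    HasDerivAt (fun ε : ℝ => (Del M k (x 1) / x 1 : ℝ) *
      weylEval (perturb (metric M k) h ε) x
        (m ε) (fun a => (e ε a : ℂ)) (m ε) (fun a => (e ε a : ℂ))) v 0

/-- The Teukolsky quantity `α̃^{[+2]}[h] = (Δ / r) α(𝔪, 𝔪)` has at `x` the value `v`, where
`α` is the linearisation of the null curvature component `W(·, e₄, ·, e₄)`. -/
def HasTeukolskyPlus (M k : ℝ) (h : Tensor2) (x : Coord) (v : ℂ) : Prop :=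
  HasLinWeylScalar M k h x (e4 M k x) (mVec x) v

/-- The Teukolsky quantity `α̃^{[-2]}[h] = (Δ / r) α̲(𝔪*, 𝔪*)` has at `x` the value `v`, where
`α̲` is the linearisation of the null curvature component `W(·, e₃, ·, e₃)`. -/
def HasTeukolskyMinus (M k : ℝ) (h : Tensor2) (x : Coord) (v : ℂ) : Prop :=
  HasLinWeylScalar M k h x (e3 M k x) (mVecBar x) v

end

end SAdS

open SAdS

/-! The background is adapted to the null frame D = ∂_r + N⁻¹∂_t, L̲, 𝔪, 𝔪*, where N = Δ/r², g(D,
L̲) = -2 and g(𝔪, 𝔪*) = 2. In this frame the connection is polynomial in ρ = 1/r, κ = cot ϑ, N and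
M; the constant k² is eliminated through the radial derivative of N. The perturbation is the real
part of a complex tensor a (du σ + σ du) + b du du + c σσ. As du and σ annihilate D and 𝔪, only its
components on L̲ and 𝔪* survive. Its coefficients are operators of order two in α̃_G. The linearised
Ricci and curvature tensors are linear in the perturbation with real coefficients, so everything may
be computed for the complex tensor and the real part taken at the end.

Linearised Einstein equations. The linearised curvature is ∇_c δΓ - ∇_d δΓ. Of the ten frame
components of δRic - Λh, three vanish for every a, b, c, four are identities once a, b, c are
expressed through ψ = r⁵ α̃_G, and the last three are 𝓛₁𝓛₂, (D - 2ρ)𝓛₂ and D² - 2ρD + 2ρ² applied to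
the Teukolsky equation, up to powers of ρ (`linRic_gaugeTensor`, `gaugeRic_hertz`). These are
polynomial identities in the differential algebra `NullCalculus`. `CoordCalculus` carries them from
the frame to coordinates, `ExteriorChart.calculus` realises that algebra by smooth functions, and
`hasDerivAt_riemannUp` identifies its linearised curvature with an actual ε-derivative.

Teukolsky quantities. The background curvature acts on coordinate planes by sectional curvatures.
Hence in W(m, e, m, e), with e null in the (t, r) plane and m null and tangent to the sphere, every
background contribution is a product of two factors vanishing at ε = 0, however the frame and metric
vary. Only δR in the background frame remains (`hasDerivAt_weylEval`). For a real part, this is half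
the sum of the complex component and the conjugate of the component with 𝔪 and 𝔪* exchanged. For e₄
the first vanishes and the second yields four radial derivatives of the conjugate. For e₃ the
conjugate one yields four angular derivatives, and the other collapses, by the Teukolsky equation,
to the term in M ∂_t (`linRiem_hertzFr_qnqn`).

Regularity at the axis. A weight -2 function is a contraction of a smooth traceless tangential
tensor with 𝔪*. In this description w⁻¹L acts on the tensor, 𝓛₂ is a divergence (`up_two_spin`), and
the real part of 𝓛₁ is again a divergence (`re_up_one_spin`). So 𝔥 is the pullback of a tensor built
from smooth Cartesian fields (`pullbackSph_hertz`). -/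

open scoped ContDiff
open SAdS

/-! ### Null-frame calculus and the linearised connection of the gauge tensor -/

namespace SAdS

/-- The differential algebra generated by the null frame `D = w⁻¹ r⁻² L`, `L̲ = 2 T - N D`,
`𝔪 = ρ δ`, `𝔪* = ρ δ'` of Schwarzschild–Anti-de Sitter, where `ρ = 1 / r`, `N = Δ / r²`,
`κ = cot ϑ`. -/
structure NullCalculus (A : Type*) [CommRing A] [Algebra ℂ A] where
  T : Derivation ℂ A A
  D : Derivation ℂ A A
  δ : Derivation ℂ A A
  δ' : Derivation ℂ A A
  ρ : A
  κ : A
  N : A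
  M : A
  D_T : ∀ u, D (T u) = T (D u)
  D_δ : ∀ u, D (δ u) = δ (D u)
  D_δ' : ∀ u, D (δ' u) = δ' (D u)
  T_δ : ∀ u, T (δ u) = δ (T u)
  T_δ' : ∀ u, T (δ' u) = δ' (T u)
  δ'_δ : ∀ u, δ' (δ u) = δ (δ' u) - κ * (δ u - δ' u)
  T_ρ : T ρ = 0
  D_ρ : D ρ = -ρ ^ 2
  δ_ρ : δ ρ = 0
  δ'_ρ : δ' ρ = 0
  T_κ : T κ = 0
  D_κ : D κ = 0
  δ_κ : δ κ = -(1 + κ ^ 2)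
  δ'_κ : δ' κ = -(1 + κ ^ 2)
  T_N : T N = 0
  D_N : D N = 2 * (N - 1) * ρ + 6 * M * ρ ^ 2
  δ_N : δ N = 0
  δ'_N : δ' N = 0
  T_M : T M = 0
  D_M : D M = 0
  δ_M : δ M = 0
  δ'_M : δ' M = 0

namespace NullCalculus

variable {A : Type*} [CommRing A] [Algebra ℂ A] (S : NullCalculus A)

theorem derivation_ofNat (d : Derivation ℂ A A) (n : ℕ) [n.AtLeastTwo] :
    d (ofNat(n) : A) = 0 := by
  rw [← Nat.cast_ofNat (R := A)]
  exact d.map_natCast _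

-- As rewrite rules the commutators put every word in the derivations into the order δ, δ', T, D
-- from the outside in. Each word then becomes a fixed atom, and identities between differential
-- expressions are decided by commutative ring arithmetic.
attribute [simp] D_T D_δ D_δ' T_δ T_δ' δ'_δ T_ρ D_ρ δ_ρ δ'_ρ T_κ D_κ δ_κ δ'_κ T_N D_N δ_N δ'_N
  T_M D_M δ_M δ'_M derivation_ofNat

/-- Differentiation along the frame vectors `D, L̲, 𝔪, 𝔪*`. -/
def fr : Fin 4 → A → A :=
  ![fun u => S.D u, fun u => 2 * S.T u - S.N * S.D u, fun u => S.ρ * S.δ u, fun u => S.ρ * S.δ' u]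

/-- The connection coefficients of the frame: `∇_{e_a} e_b = ∑ c, S.conn a b c • e_c`. -/
def conn : Fin 4 → Fin 4 → Fin 4 → A :=
  ![![![0, 0, 0, 0], ![0, 0, 0, 0], ![0, 0, 0, 0], ![0, 0, 0, 0]],
    ![![2 * (S.N - 1) * S.ρ + 6 * S.M * S.ρ ^ 2, 0, 0, 0],
      ![0, -(2 * (S.N - 1) * S.ρ + 6 * S.M * S.ρ ^ 2), 0, 0], ![0, 0, 0, 0], ![0, 0, 0, 0]],
    ![![0, 0, S.ρ, 0], ![0, 0, -(S.N * S.ρ), 0], ![0, 0, S.ρ * S.κ, 0],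
      ![-(S.N * S.ρ), S.ρ, 0, -(S.ρ * S.κ)]],
    ![![0, 0, 0, S.ρ], ![0, 0, 0, -(S.N * S.ρ)], ![-(S.N * S.ρ), S.ρ, -(S.ρ * S.κ), 0],
      ![0, 0, 0, S.ρ * S.κ]]]

/-- Frame components of `∇h`. -/
def covTwo (h : Fin 4 → Fin 4 → A) (a b c : Fin 4) : A :=
  S.fr a (h b c) - ∑ f, S.conn a b f * h f c - ∑ f, S.conn a c f * h b f

/-- Frame components of twice the linearised connection, with first index lowered. -/
def linConn (h : Fin 4 → Fin 4 → A) (e a b : Fin 4) : A :=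
  S.covTwo h a b e + S.covTwo h b a e - S.covTwo h e a b

/-- Frame components of the covariant derivative of a covariant 3-tensor. -/
def covThree (C : Fin 4 → Fin 4 → Fin 4 → A) (c e a b : Fin 4) : A :=
  S.fr c (C e a b) - ∑ f, S.conn c e f * C f a b - ∑ f, S.conn c a f * C e f b
    - ∑ f, S.conn c b f * C e a f

/-- Frame components of twice the linearisation of the curvature tensor `R^e_{bcd}`, with the index
`e` lowered by the background metric. -/
def linRiem (h : Fin 4 → Fin 4 → A) (e b c d : Fin 4) : A :=
  S.covThree (S.linConn h) c e d b - S.covThree (S.linConn h) d e c b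

/-- Frame components of four times the linearised Ricci tensor. -/
def linRic (h : Fin 4 → Fin 4 → A) (b d : Fin 4) : A :=
  -S.linRiem h 1 b 0 d - S.linRiem h 0 b 1 d + S.linRiem h 3 b 2 d + S.linRiem h 2 b 3 d

/-- Frame components of `a (du σ + σ du) + b du du + c σ σ`. -/
def gaugeTensor (a b c : A) : Fin 4 → Fin 4 → A :=
  ![![0, 0, 0, 0], ![0, b, 0, 2 * S.ρ * a], ![0, 0, 0, 0], ![0, 2 * S.ρ * a, 0, 4 * S.ρ ^ 2 * c]]

/-- Frame components of twice the linearised connection of the gauge tensor. -/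
def gaugeConn (a b c : A) : Fin 4 → Fin 4 → Fin 4 → A :=
  ![![![0, 0, 0, 0], ![0, -S.D b, 0, -2 * S.ρ * S.D a], ![0, 0, 0, 0],
      ![0, -2 * S.ρ * S.D a, 0, -4 * S.ρ ^ 2 * S.D c]],
    ![![0, S.D b, 0, 2 * S.ρ * S.D a - 4 * S.ρ ^ 2 * a],
      ![S.D b, 2 * S.T b - S.N * S.D b + (4 * S.ρ * (S.N - 1) + 12 * S.ρ ^ 2 * S.M) * b,
        S.ρ * S.δ b, 4 * S.ρ ^ 2 * S.N * a + S.ρ * S.δ' b],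
      ![0, S.ρ * S.δ b, 0, 2 * S.ρ ^ 2 * (S.δ a + S.κ * a) - 2 * S.ρ * b],
      ![2 * S.ρ * S.D a - 4 * S.ρ ^ 2 * a, 4 * S.ρ ^ 2 * S.N * a + S.ρ * S.δ' b,
        2 * S.ρ ^ 2 * (S.δ a + S.κ * a) - 2 * S.ρ * b,
        4 * S.ρ ^ 2 * (S.δ' a - S.κ * a) + 4 * S.ρ ^ 2 * (S.N * S.D c - 2 * S.T c)]],
    ![![0, 0, 0, 0], ![0, -(S.ρ * S.δ b), 0, -2 * S.ρ ^ 2 * (S.δ a + S.κ * a)], ![0, 0, 0, 0],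
      ![0, -2 * S.ρ ^ 2 * (S.δ a + S.κ * a), 0, -4 * S.ρ ^ 3 * (S.δ c + 2 * S.κ * c)]],
    ![![0, 2 * S.ρ * S.D a, 0, 4 * S.ρ ^ 2 * S.D c - 8 * S.ρ ^ 3 * c],
      ![2 * S.ρ * S.D a, (8 * S.ρ ^ 2 * (S.N - 1) + 24 * S.ρ ^ 3 * S.M) * a
          - 4 * S.ρ * S.N * S.D a + 8 * S.ρ * S.T a - S.ρ * S.δ' b,
        2 * S.ρ ^ 2 * (S.δ a + S.κ * a),
        8 * S.ρ ^ 3 * S.N * c - 4 * S.ρ ^ 2 * S.N * S.D c + 8 * S.ρ ^ 2 * S.T c],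
      ![0, 2 * S.ρ ^ 2 * (S.δ a + S.κ * a), 0,
        4 * S.ρ ^ 3 * (S.δ c + 2 * S.κ * c) - 4 * S.ρ ^ 2 * a],
      ![4 * S.ρ ^ 2 * S.D c - 8 * S.ρ ^ 3 * c,
        8 * S.ρ ^ 3 * S.N * c - 4 * S.ρ ^ 2 * S.N * S.D c + 8 * S.ρ ^ 2 * S.T c,
        4 * S.ρ ^ 3 * (S.δ c + 2 * S.κ * c) - 4 * S.ρ ^ 2 * a,
        4 * S.ρ ^ 3 * (S.δ' c - 2 * S.κ * c)]]]

/-- Symmetry of h passes to ∇h, so the linearised connection is torsion free. Only index pairs with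
i ≤ j then need to be computed. -/
theorem linConn_gaugeTensor_swap (a b c : A) (e i j : Fin 4) :
    S.linConn (S.gaugeTensor a b c) e i j = S.linConn (S.gaugeTensor a b c) e j i := by
  have hs : ∀ i j, S.gaugeTensor a b c i j = S.gaugeTensor a b c j i := by
    intro i j
    fin_cases i <;> fin_cases j <;> rfl
  have hc : ∀ e i j, S.covTwo (S.gaugeTensor a b c) e i j =
      S.covTwo (S.gaugeTensor a b c) e j i := by
    intro e i j
    simp only [covTwo, hs i j, fun f => hs f j, fun f => hs i f]
    ring
  simp only [linConn, hc e i j]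
  ring

-- The components are compared one by one. Tabulating δΓ once lets the curvature be obtained by a
-- single further differentiation, without unfolding ∇h again.
set_option maxHeartbeats 2000000 in
theorem linConn_gaugeTensor_of_le (a b c : A) (e i j : Fin 4) (hij : i ≤ j) :
    S.linConn (S.gaugeTensor a b c) e i j = S.gaugeConn a b c e i j := by
  revert i j
  fin_cases e
  all_goals
    intro i j hij
    fin_cases i <;> fin_cases j <;> first | (exact absurd hij (by decide)) | skip
  all_goals
    simp [linConn, covTwo, gaugeConn, gaugeTensor, conn, fr, Fin.sum_univ_four,
      Derivation.leibniz, Derivation.leibniz_pow]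
  all_goals try ring

theorem linConn_gaugeTensor (a b c : A) :
    S.linConn (S.gaugeTensor a b c) = S.gaugeConn a b c := by
  funext e i j
  rcases le_total i j with h | h
  · exact S.linConn_gaugeTensor_of_le a b c e i j h
  · rw [linConn_gaugeTensor_swap, S.linConn_gaugeTensor_of_le a b c e j i h]
    fin_cases e <;> fin_cases i <;> fin_cases j <;> rfl

end NullCalculus

end SAdS

/-! ### Linearised Ricci and curvature components of the Hertz perturbation -/

namespace SAdS

namespace NullCalculus

variable {A : Type*} [CommRing A] [Algebra ℂ A] (S : NullCalculus A)

/-- Raising operator on quantities of spin weight `-n`. -/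
def up (n : ℤ) (u : A) : A := S.δ u + n * S.κ * u

/-- `a` in terms of `ψ = r⁵ α̃_G`. -/
def hertzA (ψ : A) : A := -8 * (S.ρ ^ 2 * S.D (S.up 2 ψ) - 4 * S.ρ ^ 3 * S.up 2 ψ)

/-- `b` in terms of `ψ = r⁵ α̃_G`. -/
def hertzB (ψ : A) : A := -16 * S.ρ ^ 4 * S.up 1 (S.up 2 ψ)

/-- `c` in terms of `ψ = r⁵ α̃_G`. -/
def hertzC (ψ : A) : A := -4 * (S.D (S.D ψ) - 6 * S.ρ * S.D ψ + 10 * S.ρ ^ 2 * ψ)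

/-- The Teukolsky operator in terms of `ψ = r⁵ α̃_G`. -/
def teuk (ψ : A) : A :=
  S.N * S.D (S.D ψ) + (2 * S.ρ - 8 * S.ρ * S.N - 6 * S.ρ ^ 2 * S.M) * S.D ψ - 2 * S.T (S.D ψ)
    + 10 * S.ρ * S.T ψ + S.ρ ^ 2 * (S.δ (S.δ' ψ) + 3 * S.κ * S.δ' ψ - 2 * S.κ * S.δ ψ)
    + (20 * S.ρ ^ 2 * S.N - 12 * S.ρ ^ 2 - 4 * S.ρ ^ 2 * S.κ ^ 2 + 24 * S.ρ ^ 3 * S.M) * ψ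

/-- The constant `k²`. -/
def ksq : A := (S.N - 1) * S.ρ ^ 2 + 2 * S.M * S.ρ ^ 3

/-- Frame components of the perturbation generated by `ψ = r⁵ α̃_G`. -/
def hertzFr (ψ : A) : Fin 4 → Fin 4 → A :=
  S.gaugeTensor (S.hertzA ψ) (S.hertzB ψ) (S.hertzC ψ)

/-- The component `(D, L̲)` of four times `δRic - Λ h` for
`h = a (du σ + σ du) + b du du + c σ σ`. -/
def gaugeRicDn (a b : A) : A :=
  2 * S.ρ ^ 2 * S.D (S.up 1 a) - 2 * S.ρ * S.D b - S.D (S.D b)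

/-- The component `(D, 𝔪*)`. -/
def gaugeRicDq (a c : A) : A :=
  4 * S.ρ ^ 3 * a - 2 * S.ρ * S.D (S.D a) + 4 * S.ρ ^ 3 * S.D (S.up 2 c) - 8 * S.ρ ^ 4 * S.up 2 c

/-- The component `(L̲, L̲)`. -/
def gaugeRicNn (a b : A) : A :=
  (8 * S.ρ ^ 3 * (S.N - 1) + 24 * S.ρ ^ 4 * S.M) * S.up 1 a
    - 4 * S.ρ ^ 2 * S.N * S.D (S.up 1 a) + 8 * S.ρ ^ 2 * S.T (S.up 1 a)
    - 2 * S.ρ ^ 2 * (S.δ (S.δ' b) + S.κ * S.δ' b) - 4 * S.ρ * S.T b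

/-- The component `(L̲, 𝔪)`. -/
def gaugeRicNm (a b : A) : A := 2 * S.ρ ^ 3 * S.up 0 (S.up 1 a) - S.ρ * S.D (S.δ b)

/-- The component `(L̲, 𝔪*)`. -/
def gaugeRicNq (a b c : A) : A :=
  (4 * S.ρ ^ 3 * S.N - 6 * S.ρ ^ 3 + 2 * S.ρ ^ 3 * S.κ ^ 2) * a
    - 4 * S.ρ ^ 3 * S.κ * S.δ' a + 2 * S.ρ ^ 3 * S.κ * S.δ a - 2 * S.ρ ^ 3 * S.δ (S.δ' a)
    - 2 * S.ρ * S.N * S.D (S.D a) - 8 * S.ρ ^ 2 * S.T a + 4 * S.ρ * S.T (S.D a)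
    - S.ρ * S.D (S.δ' b) + 8 * S.ρ ^ 4 * S.N * S.up 2 c - 4 * S.ρ ^ 3 * S.N * S.D (S.up 2 c)
    + 8 * S.ρ ^ 3 * S.T (S.up 2 c)

/-- The component `(𝔪, 𝔪*)`. -/
def gaugeRicMq (a b c : A) : A :=
  -4 * S.ρ ^ 3 * S.up 1 a - 2 * S.ρ ^ 2 * S.D (S.up 1 a) + 2 * S.ρ ^ 2 * b
    + 2 * S.ρ * S.D b + 4 * S.ρ ^ 4 * S.up 1 (S.up 2 c)

/-- The component `(𝔪*, 𝔪*)`. -/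
def gaugeRicQq (a c : A) : A :=
  4 * S.ρ ^ 2 * (S.κ * S.D a - S.D (S.δ' a))
    + (16 * S.ρ ^ 4 * S.N - 32 * S.ρ ^ 4 + 96 * S.ρ ^ 5 * S.M) * c
    + (16 * S.ρ ^ 3 - 48 * S.ρ ^ 4 * S.M) * S.D c - 8 * S.ρ ^ 2 * S.N * S.D (S.D c)
    - 16 * S.ρ ^ 3 * S.T c + 16 * S.ρ ^ 2 * S.T (S.D c)

/-- Frame components of four times `δRic - Λ h` for `h = a (du σ + σ du) + b du du + c σ σ`. -/
def gaugeRic (a b c : A) : Fin 4 → Fin 4 → A :=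
  ![![0, S.gaugeRicDn a b, 0, S.gaugeRicDq a c],
    ![S.gaugeRicDn a b, S.gaugeRicNn a b, S.gaugeRicNm a b, S.gaugeRicNq a b c],
    ![0, S.gaugeRicNm a b, 0, S.gaugeRicMq a b c],
    ![S.gaugeRicDq a c, S.gaugeRicNq a b c, S.gaugeRicMq a b c, S.gaugeRicQq a c]]

-- The components (D, D), (D, 𝔪) and (𝔪, 𝔪) vanish for arbitrary a, b, c because h(D, ·) and h(𝔪, ·)
-- vanish. The factor 12 is 4 · 3, as `linRic` is four times δRic and Λ = -3k².
set_option maxHeartbeats 4000000 in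
theorem linRic_gaugeTensor (a b c : A) (i j : Fin 4) :
    S.linRic (S.gaugeTensor a b c) i j + 12 * S.ksq * S.gaugeTensor a b c i j =
      S.gaugeRic a b c i j := by
  simp only [linRic, linRiem, linConn_gaugeTensor]
  fin_cases i <;> fin_cases j
  all_goals
    simp [covThree, gaugeConn, conn, fr, Fin.sum_univ_four,
      Derivation.leibniz, Derivation.leibniz_pow, gaugeTensor, ksq, gaugeRic, gaugeRicDn,
      gaugeRicDq, gaugeRicNn, gaugeRicNm, gaugeRicNq, gaugeRicMq, gaugeRicQq, up]
  all_goals try ring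

-- Four components cancel by the mere form of a, b, c in terms of ψ. The other three are operators
-- of the same shape as those producing b, a and c, applied to the Teukolsky expression, so they
-- vanish on solutions.
set_option maxHeartbeats 4000000 in
theorem gaugeRic_hertz {ψ : A} (h : S.teuk ψ = 0) :
    S.gaugeRic (S.hertzA ψ) (S.hertzB ψ) (S.hertzC ψ) = 0 := by
  have h1 := congrArg S.δ h
  have h2 := congrArg S.δ h1
  have h3 := congrArg S.D h1
  have h4 := congrArg S.D h
  have h5 := congrArg S.D h4
  simp [teuk, Derivation.leibniz, Derivation.leibniz_pow] at h h1 h2 h3 h4 h5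
  have dn : S.gaugeRicDn (S.hertzA ψ) (S.hertzB ψ) = 0 := by
    simp [gaugeRicDn, up, hertzA, hertzB, Derivation.leibniz, Derivation.leibniz_pow]
    ring
  have dq : S.gaugeRicDq (S.hertzA ψ) (S.hertzC ψ) = 0 := by
    simp [gaugeRicDq, up, hertzA, hertzC, Derivation.leibniz, Derivation.leibniz_pow]
    ring
  have nn : S.gaugeRicNn (S.hertzA ψ) (S.hertzB ψ) = 0 := by
    simp [gaugeRicNn, up, hertzA, hertzB, Derivation.leibniz, Derivation.leibniz_pow]
    -- This combination is 32 ρ⁴ 𝓛₁𝓛₂ of the Teukolsky equation, since 𝓛₁𝓛₂ = δ² + 3κδ - 2.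
    linear_combination 32 * S.ρ ^ 4 * h2 + 96 * S.ρ ^ 4 * S.κ * h1 - 64 * S.ρ ^ 4 * h
  have nm : S.gaugeRicNm (S.hertzA ψ) (S.hertzB ψ) = 0 := by
    simp [gaugeRicNm, up, hertzA, hertzB, Derivation.leibniz, Derivation.leibniz_pow]
    ring
  have nq : S.gaugeRicNq (S.hertzA ψ) (S.hertzB ψ) (S.hertzC ψ) = 0 := by
    simp [gaugeRicNq, up, hertzA, hertzB, hertzC, Derivation.leibniz, Derivation.leibniz_pow]
    -- This is 32 ρ³ (D - 2ρ) 𝓛₂ of the Teukolsky equation.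
    linear_combination 32 * S.ρ ^ 3 * h3 - 64 * S.ρ ^ 4 * h1 + 64 * S.ρ ^ 3 * S.κ * h4 -
      128 * S.ρ ^ 4 * S.κ * h
  have mq : S.gaugeRicMq (S.hertzA ψ) (S.hertzB ψ) (S.hertzC ψ) = 0 := by
    simp [gaugeRicMq, up, hertzA, hertzB, hertzC, Derivation.leibniz, Derivation.leibniz_pow]
    ring
  have qq : S.gaugeRicQq (S.hertzA ψ) (S.hertzC ψ) = 0 := by
    simp [gaugeRicQq, up, hertzA, hertzC, Derivation.leibniz, Derivation.leibniz_pow]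
    -- This is 32 ρ² (D² - 2ρD + 2ρ²) of the Teukolsky equation.
    linear_combination 32 * S.ρ ^ 2 * h5 - 64 * S.ρ ^ 3 * h4 + 64 * S.ρ ^ 4 * h
  rw [gaugeRic, dn, dq, nn, nm, nq, mq, qq]
  funext i j
  fin_cases i <;> fin_cases j <;> rfl

/-- The perturbation generated by a solution of the Teukolsky equation satisfies the linearised
Einstein equations. -/
theorem linRic_hertzFr {ψ : A} (h : S.teuk ψ = 0) (i j : Fin 4) :
    S.linRic (S.hertzFr ψ) i j + 12 * S.ksq * S.hertzFr ψ i j = 0 := by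
  rw [hertzFr, linRic_gaugeTensor, S.gaugeRic_hertz h]
  rfl

-- Taking real parts mixes 𝔪 with 𝔪*, so each Teukolsky quantity needs two complex components. This
-- one is zero because every entry of h with an index D or 𝔪 is zero. The (𝔪*, D) one sees only c,
-- the (𝔪, L̲) one only b.
set_option maxHeartbeats 2000000 in
theorem linRiem_mDmD (a b c : A) : S.linRiem (S.gaugeTensor a b c) 2 0 2 0 = 0 := by
  simp only [linRiem, linConn_gaugeTensor]
  simp [covThree, gaugeConn, conn, fr, Fin.sum_univ_four]

set_option maxHeartbeats 2000000 in
theorem linRiem_qDqD (a b c : A) : S.linRiem (S.gaugeTensor a b c) 3 0 3 0 =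
    -4 * S.ρ ^ 2 * S.D (S.D c) + 8 * S.ρ ^ 3 * S.D c - 8 * S.ρ ^ 4 * c := by
  simp only [linRiem, linConn_gaugeTensor]
  simp [covThree, gaugeConn, conn, fr, Fin.sum_univ_four, Derivation.leibniz,
    Derivation.leibniz_pow]
  ring

set_option maxHeartbeats 2000000 in
theorem linRiem_mnmn (a b c : A) : S.linRiem (S.gaugeTensor a b c) 2 1 2 1 =
    -S.ρ ^ 2 * S.up (-1) (S.δ b) := by
  simp only [linRiem, linConn_gaugeTensor]
  simp [covThree, gaugeConn, conn, fr, Fin.sum_univ_four, Derivation.leibniz, up]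
  ring

set_option maxHeartbeats 2000000 in
theorem linRiem_qnqn (a b c : A) : S.linRiem (S.gaugeTensor a b c) 3 1 3 1 =
    -(8 * S.ρ ^ 3 * (S.N - 1) + 24 * S.ρ ^ 4 * S.M) * (S.κ * a - S.δ' a)
    + 4 * S.ρ ^ 2 * S.N * (S.κ * S.D a - S.δ' (S.D a))
    - 8 * S.ρ ^ 2 * (S.κ * S.T a - S.δ' (S.T a)) + S.ρ ^ 2 * (S.κ * S.δ' b - S.δ' (S.δ' b))
    - 8 * S.ρ ^ 4 * S.N ^ 2 * c + 8 * S.ρ ^ 3 * S.N ^ 2 * S.D c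
    - 4 * S.ρ ^ 2 * S.N ^ 2 * S.D (S.D c)
    + (16 * S.ρ ^ 3 - 32 * S.ρ ^ 3 * S.N - 48 * S.ρ ^ 4 * S.M) * S.T c
    + 16 * S.ρ ^ 2 * S.N * S.T (S.D c) - 16 * S.ρ ^ 2 * S.T (S.T c) := by
  simp only [linRiem, linConn_gaugeTensor]
  simp [covThree, gaugeConn, conn, fr, Fin.sum_univ_four, Derivation.leibniz,
    Derivation.leibniz_pow]
  ring

-- This is the identity of Teukolsky–Starobinsky type behind the term -12M ∂_t α̃_G. Off shell the
-- component is of fourth order in ψ; subtracting second-order operators applied to the Teukolsky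
-- equation removes all derivatives except one ∂_t with coefficient M.
set_option maxHeartbeats 2000000 in
theorem linRiem_hertzFr_qnqn {ψ : A} (h : S.teuk ψ = 0) :
    S.linRiem (S.hertzFr ψ) 3 1 3 1 = -192 * S.ρ ^ 6 * S.M * S.T ψ := by
  have h1 := congrArg S.δ h
  have h2 := congrArg S.δ' h
  have h3 := congrArg S.δ h2
  have h4 := congrArg S.D h
  have h5 := congrArg S.D h4
  have h6 := congrArg S.T h
  have h7 := congrArg S.T h4
  rw [hertzFr, linRiem_qnqn]
  simp [up, hertzA, hertzB, hertzC, teuk, Derivation.leibniz,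
      Derivation.leibniz_pow] at h h1 h2 h3 h4 h5 h6 h7 ⊢
  -- The first terms on each line cancel the fourth-order words δδ'δδ', TD·TD and D²·D² together
  -- with their mixed products; the remaining coefficients follow by descending order.
  linear_combination 16 * S.ρ ^ 4 * h3 - 32 * S.ρ ^ 4 * S.κ * h1 + 48 * S.ρ ^ 4 * S.κ * h2
    - 32 * S.ρ ^ 2 * h7 + 16 * S.ρ ^ 2 * S.N * h5 + 32 * S.ρ ^ 3 * h6
    + (32 * S.ρ ^ 3 - 64 * S.ρ ^ 3 * S.N - 96 * S.ρ ^ 4 * S.M) * h4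
    + (96 * S.ρ ^ 4 * S.N - 96 * S.ρ ^ 4 - 64 * S.ρ ^ 4 * S.κ ^ 2 + 192 * S.ρ ^ 5 * S.M) * h

end NullCalculus
end SAdS

/-! ### Covariant derivatives evaluated on a frame -/

namespace SAdS

section Evaluation

variable {A : Type*} [CommRing A]

/-- Evaluation of a covector on a vector. -/
def evOne (v X : Fin 4 → A) : A := ∑ a, X a * v a

/-- Evaluation of a covariant 2-tensor. -/
def evTwo (h : Fin 4 → Fin 4 → A) (X Y : Fin 4 → A) : A := ∑ a, X a * evOne (h a) Y

/-- Evaluation of a covariant 3-tensor. -/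
def evThree (C : Fin 4 → Fin 4 → Fin 4 → A) (X Y Z : Fin 4 → A) : A := ∑ a, X a * evTwo (C a) Y Z

/-- Evaluation of a covariant 4-tensor. -/
def evFour (C : Fin 4 → Fin 4 → Fin 4 → Fin 4 → A) (X Y Z V : Fin 4 → A) : A :=
  ∑ a, X a * evThree (C a) Y Z V

theorem evOne_sub (v w X : Fin 4 → A) : evOne (fun a => v a - w a) X = evOne v X - evOne w X := by
  simp [evOne, mul_sub]

theorem evTwo_eq (h : Fin 4 → Fin 4 → A) (X Y : Fin 4 → A) :
    evTwo h X Y = evOne (fun a => evOne (h a) Y) X := rfl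

theorem evThree_eq (C : Fin 4 → Fin 4 → Fin 4 → A) (X Y Z : Fin 4 → A) :
    evThree C X Y Z = evOne (fun e => evOne (fun a => evOne (C e a) Z) Y) X := rfl

theorem evOne_sum_smul (v : Fin 4 → A) (w : Fin 4 → A) (V : Fin 4 → Fin 4 → A) :
    evOne v (fun b => ∑ f, w f * V f b) = ∑ f, w f * evOne v (V f) := by
  simp only [evOne, Fin.sum_univ_four]
  ring

theorem evOne_sum_left (v : Fin 4 → Fin 4 → A) (w X : Fin 4 → A) :
    evOne (fun a => ∑ f, w f * v f a) X = ∑ f, w f * evOne (v f) X := by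
  simp only [evOne, Fin.sum_univ_four]
  ring

theorem evOne_comm (h : Fin 4 → Fin 4 → A) (X Y : Fin 4 → A) :
    evOne (fun a => evOne (h a) Y) X = evOne (fun b => evOne (fun a => h a b) X) Y := by
  simp only [evOne, Fin.sum_univ_four]
  ring

theorem evThree_mid (C : Fin 4 → Fin 4 → Fin 4 → A) (X Y Z : Fin 4 → A) :
    evThree C X Y Z = evOne (fun a => evOne (fun e => evOne (C e a) Z) X) Y :=
  evOne_comm _ _ _

theorem evThree_last (C : Fin 4 → Fin 4 → Fin 4 → A) (X Y Z : Fin 4 → A) :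
    evThree C X Y Z = evOne (fun b => evTwo (fun e a => C e a b) X Y) Z := by
  simp only [evThree_eq, evTwo_eq, evOne, Fin.sum_univ_four]
  ring

end Evaluation

section TensorCalculus

variable {A : Type*} [CommRing A] [Algebra ℂ A] (d : Fin 4 → Derivation ℂ A A)
  (Γ : Fin 4 → Fin 4 → Fin 4 → A)

/-- Covariant derivative of a vector field. -/
def nablaVec (Y : Fin 4 → A) (a b : Fin 4) : A := d a (Y b) + ∑ f, Γ b a f * Y f

/-- Covariant derivative of a covector field. -/
def nablaOne (v : Fin 4 → A) (a b : Fin 4) : A := d a (v b) - ∑ f, Γ f a b * v f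

/-- Covariant derivative of a covariant 2-tensor. -/
def nablaTwo (h : Fin 4 → Fin 4 → A) (a b c : Fin 4) : A :=
  d a (h b c) - ∑ f, Γ f a b * h f c - ∑ f, Γ f a c * h b f

/-- Covariant derivative of a covariant 3-tensor. -/
def nablaThree (C : Fin 4 → Fin 4 → Fin 4 → A) (c e a b : Fin 4) : A :=
  d c (C e a b) - ∑ f, Γ f c e * C f a b - ∑ f, Γ f c a * C e f b - ∑ f, Γ f c b * C e a f

theorem evOne_nablaOne (v Y : Fin 4 → A) (a : Fin 4) :
    evOne (nablaOne d Γ v a) Y = d a (evOne v Y) - evOne v (nablaVec d Γ Y a) := by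
  simp only [evOne, nablaOne, nablaVec, Fin.sum_univ_four, map_add, Derivation.leibniz,
    smul_eq_mul]
  ring

theorem evOne_nablaTwo (h : Fin 4 → Fin 4 → A) (Z : Fin 4 → A) (a b : Fin 4) :
    evOne (nablaTwo d Γ h a b) Z =
      nablaOne d Γ (fun b => evOne (h b) Z) a b - evOne (h b) (nablaVec d Γ Z a) := by
  simp only [evOne, nablaOne, nablaTwo, nablaVec, Fin.sum_univ_four, map_add, Derivation.leibniz,
    smul_eq_mul]
  ring

theorem evOne_nablaThree (C : Fin 4 → Fin 4 → Fin 4 → A) (Z : Fin 4 → A) (c e a : Fin 4) :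
    evOne (nablaThree d Γ C c e a) Z =
      nablaTwo d Γ (fun e a => evOne (C e a) Z) c e a - evOne (C e a) (nablaVec d Γ Z c) := by
  simp only [evOne, nablaThree, nablaTwo, nablaVec, Fin.sum_univ_four, map_add,
    Derivation.leibniz, smul_eq_mul]
  ring

theorem evTwo_nablaTwo (h : Fin 4 → Fin 4 → A) (Y Z : Fin 4 → A) (a : Fin 4) :
    evTwo (nablaTwo d Γ h a) Y Z = d a (evTwo h Y Z) - evTwo h (nablaVec d Γ Y a) Z
      - evTwo h Y (nablaVec d Γ Z a) := by
  simp only [evTwo_eq, evOne_nablaTwo, evOne_sub]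
  rw [evOne_nablaOne]

theorem evThree_nablaThree (C : Fin 4 → Fin 4 → Fin 4 → A) (X Y Z : Fin 4 → A) (c : Fin 4) :
    evThree (nablaThree d Γ C c) X Y Z = d c (evThree C X Y Z)
      - evThree C (nablaVec d Γ X c) Y Z - evThree C X (nablaVec d Γ Y c) Z
      - evThree C X Y (nablaVec d Γ Z c) := by
  simp only [evThree_eq, evOne_nablaThree, evOne_sub]
  have := evTwo_nablaTwo d Γ (fun e a => evOne (C e a) Z) X Y c
  simp only [evTwo_eq] at this
  rw [this]

variable (Λ : Fin 4 → Fin 4 → A) (W : Fin 4 → Fin 4 → Fin 4 → A)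

/-- The Leibniz rule moves ∇ from the tensor to its arguments. By `hW` the derivatives of the frame
are combinations of the frame itself, so the Christoffel symbols of the coordinates give way to the
coefficients W. -/
theorem evThree_evTwo_nablaTwo
    (hW : ∀ a b c, ∑ e, Λ a e * nablaVec d Γ (Λ b) e c = ∑ f, W a b f * Λ f c)
    (h : Fin 4 → Fin 4 → A) (a b c : Fin 4) :
    evThree (nablaTwo d Γ h) (Λ a) (Λ b) (Λ c) =
      ∑ e, Λ a e * d e (evTwo h (Λ b) (Λ c)) - ∑ f, W a b f * evTwo h (Λ f) (Λ c)
        - ∑ f, W a c f * evTwo h (Λ b) (Λ f) := by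
  have e1 : ∑ e, Λ a e * evTwo h (nablaVec d Γ (Λ b) e) (Λ c) =
      ∑ f, W a b f * evTwo h (Λ f) (Λ c) := by
    simp only [evTwo_eq]
    rw [← evOne_sum_smul, ← evOne_sum_smul]
    congr 1
    funext x
    exact hW a b x
  have e2 : ∑ e, Λ a e * evTwo h (Λ b) (nablaVec d Γ (Λ c) e) =
      ∑ f, W a c f * evTwo h (Λ b) (Λ f) := by
    simp only [evTwo_eq, evOne_comm h (Λ b)]
    rw [← evOne_sum_smul, ← evOne_sum_smul]
    congr 1
    funext x
    exact hW a c x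
  rw [← e1, ← e2]
  simp only [evThree, evTwo_nablaTwo, mul_sub, Finset.sum_sub_distrib]

theorem evFour_nablaThree
    (hW : ∀ a b c, ∑ e, Λ a e * nablaVec d Γ (Λ b) e c = ∑ f, W a b f * Λ f c)
    (C : Fin 4 → Fin 4 → Fin 4 → A) (c e a b : Fin 4) :
    evFour (nablaThree d Γ C) (Λ c) (Λ e) (Λ a) (Λ b) =
      ∑ x, Λ c x * d x (evThree C (Λ e) (Λ a) (Λ b))
        - ∑ f, W c e f * evThree C (Λ f) (Λ a) (Λ b)
        - ∑ f, W c a f * evThree C (Λ e) (Λ f) (Λ b)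
        - ∑ f, W c b f * evThree C (Λ e) (Λ a) (Λ f) := by
  have key : ∀ (v : Fin 4 → A) (i : Fin 4),
      ∑ x, Λ c x * evOne v (nablaVec d Γ (Λ i) x) = ∑ f, W c i f * evOne v (Λ f) := by
    intro v i
    rw [← evOne_sum_smul, ← evOne_sum_smul]
    congr 1
    funext x
    exact hW c i x
  have e1 : ∑ x, Λ c x * evThree C (nablaVec d Γ (Λ e) x) (Λ a) (Λ b) =
      ∑ f, W c e f * evThree C (Λ f) (Λ a) (Λ b) := by
    simp only [evThree_eq]
    exact key _ e
  have e2 : ∑ x, Λ c x * evThree C (Λ e) (nablaVec d Γ (Λ a) x) (Λ b) =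
      ∑ f, W c a f * evThree C (Λ e) (Λ f) (Λ b) := by
    simp only [evThree_mid]
    exact key _ a
  have e3 : ∑ x, Λ c x * evThree C (Λ e) (Λ a) (nablaVec d Γ (Λ b) x) =
      ∑ f, W c b f * evThree C (Λ e) (Λ a) (Λ f) := by
    simp only [evThree_last]
    exact key _ b
  rw [← e1, ← e2, ← e3]
  simp only [evFour, evThree_nablaThree, mul_sub, Finset.sum_sub_distrib]

/-- Twice the linearised connection, first index lowered. -/
def linConnCoord (h : Fin 4 → Fin 4 → A) (e a b : Fin 4) : A :=
  nablaTwo d Γ h a b e + nablaTwo d Γ h b a e - nablaTwo d Γ h e a b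

/-- Twice the linearised curvature `R^a_{bcd}`, in terms of twice the linearised connection. -/
def linCurv (C : Fin 4 → Fin 4 → Fin 4 → A) (a b c e : Fin 4) : A :=
  d c (C a e b) - d e (C a c b)
    + ∑ f, (C a c f * Γ f e b + Γ a c f * C f e b - (C a e f * Γ f c b + Γ a e f * C f c b))

/-- `hP` says that P is parallel, so raising an index commutes with ∇. The Γ-terms acting on the two
differentiation indices cancel in the antisymmetrised difference because Γ is symmetric. -/
theorem linCurv_raise (P : Fin 4 → Fin 4 → A) (C : Fin 4 → Fin 4 → Fin 4 → A)
    (hΓ : ∀ a b c, Γ a b c = Γ a c b)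
    (hP : ∀ c a e, d c (P a e) = -∑ f, (Γ a c f * P f e + Γ e c f * P a f)) (a b c e : Fin 4) :
    linCurv d Γ (fun a b c => ∑ f, P a f * C f b c) a b c e =
      ∑ f, P a f * (nablaThree d Γ C c f e b - nablaThree d Γ C e f c b) := by
  simp only [linCurv, nablaThree, Fin.sum_univ_four, map_add, Derivation.leibniz, smul_eq_mul, hP,
    hΓ _ e c]
  ring

theorem evThree_linConnCoord (h : Fin 4 → Fin 4 → A) (X Y Z : Fin 4 → A) :
    evThree (linConnCoord d Γ h) X Y Z = evThree (nablaTwo d Γ h) Y Z X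
      + evThree (nablaTwo d Γ h) Z Y X - evThree (nablaTwo d Γ h) X Y Z := by
  simp only [evThree_eq, evOne, Fin.sum_univ_four]
  simp only [linConnCoord]
  ring

end TensorCalculus

end SAdS

/-! ### Spherical coordinates as a differential algebra, and passage between frame and coordinates
-/

namespace SAdS

theorem eq_zero_of_two_mul {A : Type*} [CommRing A] [Algebra ℂ A] {x : A} (h : 2 * x = 0) :
    x = 0 := by
  have h2 : algebraMap ℂ A (1 / 2) * 2 = 1 := by
    rw [← map_ofNat (algebraMap ℂ A) 2, ← map_mul]
    norm_num
  linear_combination algebraMap ℂ A (1 / 2) * h - x * h2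

theorem derivation_inverse {A : Type*} [CommRing A] [Algebra ℂ A] (d : Derivation ℂ A A) {x y : A}
    (h : x * y = 1) : d y = -y ^ 2 * d x := by
  have h1 : d (x * y) = 0 := by rw [h, Derivation.map_one_eq_zero]
  rw [Derivation.leibniz, smul_eq_mul, smul_eq_mul] at h1
  linear_combination y * h1 - d y * h

/-- Functions of the spherical coordinates `(t, r, ϑ, φ)`, with `ρ = 1 / r`, `s = sin ϑ`,
`σ = 1 / s`, `c = cos ϑ`, `N = Δ / r²`, `ν = 1 / N` and `K = k²`. -/
structure CoordCalculus (A : Type*) [CommRing A] [Algebra ℂ A] where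
  d : Fin 4 → Derivation ℂ A A
  r : A
  ρ : A
  s : A
  σ : A
  c : A
  N : A
  ν : A
  M : A
  K : A
  comm : ∀ i j u, d i (d j u) = d j (d i u)
  r_ρ : r * ρ = 1
  s_σ : s * σ = 1
  N_ν : N * ν = 1
  s_c : s ^ 2 + c ^ 2 = 1
  N_eq : N = 1 + K * r ^ 2 - 2 * M * ρ
  d_r : ∀ i, d i r = ![0, 1, 0, 0] i
  d_s : ∀ i, d i s = ![0, 0, c, 0] i
  d_c : ∀ i, d i c = ![0, 0, -s, 0] i
  d_M : ∀ i, d i M = 0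
  d_K : ∀ i, d i K = 0

theorem evTwo_swap {A : Type*} [CommRing A] (h : Fin 4 → Fin 4 → A) (X Y : Fin 4 → A) :
    evTwo (fun b e => h e b) X Y = evTwo h Y X :=
  evOne_comm _ _ _

theorem evTwo_sum_mul {A : Type*} [CommRing A] (w : Fin 4 → A) (Z : Fin 4 → Fin 4 → Fin 4 → A)
    (X Y : Fin 4 → A) :
    evTwo (fun b e => ∑ f, w f * Z f b e) X Y = ∑ f, w f * evTwo (Z f) X Y := by
  simp only [evTwo_eq, evOne_sum_left]

theorem evTwo_sum {A : Type*} [CommRing A] (Z : Fin 4 → Fin 4 → Fin 4 → A) (X Y : Fin 4 → A) :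
    evTwo (fun b e => ∑ f, Z f b e) X Y = ∑ f, evTwo (Z f) X Y := by
  simpa using evTwo_sum_mul (fun _ => (1 : A)) Z X Y

namespace CoordCalculus

variable {A : Type*} [CommRing A] [Algebra ℂ A] (Q : CoordCalculus A)

/-- The imaginary unit. -/
def I (_ : CoordCalculus A) : A := algebraMap ℂ A Complex.I

theorem I_sq : Q.I ^ 2 = -1 := by
  rw [I, ← map_pow, Complex.I_sq, map_neg, map_one]

@[simp] theorem d_I (i : Fin 4) : Q.d i Q.I = 0 := Derivation.map_algebraMap _ _

theorem d_ρ (i : Fin 4) : Q.d i Q.ρ = ![0, -Q.ρ ^ 2, 0, 0] i := by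
  rw [derivation_inverse (Q.d i) Q.r_ρ, Q.d_r]
  fin_cases i <;> simp

theorem d_σ (i : Fin 4) : Q.d i Q.σ = ![0, 0, -Q.σ ^ 2 * Q.c, 0] i := by
  rw [derivation_inverse (Q.d i) Q.s_σ, Q.d_s]
  fin_cases i <;> simp

/-- Half the `r`-derivative of `N`. -/
def N' : A := Q.K * Q.r + Q.M * Q.ρ ^ 2

theorem d_N (i : Fin 4) : Q.d i Q.N = ![0, 2 * Q.N', 0, 0] i := by
  rw [Q.N_eq]
  fin_cases i <;>
    simp [Derivation.leibniz, Derivation.leibniz_pow, NullCalculus.derivation_ofNat, Q.d_r,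
      Q.d_K, Q.d_M, Q.d_ρ, N']
  ring

theorem d_ν (i : Fin 4) : Q.d i Q.ν = ![0, -2 * Q.ν ^ 2 * Q.N', 0, 0] i := by
  rw [derivation_inverse (Q.d i) Q.N_ν, Q.d_N]
  fin_cases i <;> simp
  ring

/-- Differentiation along the null frame. -/
def null : NullCalculus A where
  T := Q.d 0
  D := Q.d 1 + Q.ν • Q.d 0
  δ := Q.d 2 + (Q.I * Q.σ) • Q.d 3
  δ' := Q.d 2 - (Q.I * Q.σ) • Q.d 3
  ρ := Q.ρ
  κ := Q.c * Q.σ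
  N := Q.N
  M := Q.M
  D_T u := by simp [Derivation.leibniz, Q.comm 1 0, Q.d_ν]
  D_δ u := by
    simp [Derivation.leibniz, Q.comm 1 2, Q.comm 0 2, Q.comm 1 3, Q.comm 0 3, Q.d_σ, Q.d_ν]
    ring
  D_δ' u := by
    simp [Derivation.leibniz, Q.comm 1 2, Q.comm 0 2, Q.comm 1 3, Q.comm 0 3, Q.d_σ, Q.d_ν]
    ring
  T_δ u := by simp [Derivation.leibniz, Q.comm 0 2, Q.comm 0 3, Q.d_σ]
  T_δ' u := by simp [Derivation.leibniz, Q.comm 0 2, Q.comm 0 3, Q.d_σ]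
  δ'_δ u := by
    simp [Derivation.leibniz, Q.comm 3 2, Q.d_σ]
    ring
  T_ρ := by simp [Q.d_ρ]
  D_ρ := by simp [Q.d_ρ]
  δ_ρ := by simp [Q.d_ρ]
  δ'_ρ := by simp [Q.d_ρ]
  T_κ := by simp [Derivation.leibniz, Q.d_σ, Q.d_c]
  D_κ := by simp [Derivation.leibniz, Q.d_σ, Q.d_c]
  δ_κ := by
    simp [Derivation.leibniz, Q.d_σ, Q.d_c]
    linear_combination -Q.s_σ
  δ'_κ := by
    simp [Derivation.leibniz, Q.d_σ, Q.d_c]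
    linear_combination -Q.s_σ
  T_N := by simp [Q.d_N]
  D_N := by
    simp [Q.d_N, N']
    linear_combination (-2 * Q.ρ) * Q.N_eq - (2 * Q.K * Q.r) * Q.r_ρ
  δ_N := by simp [Q.d_N]
  δ'_N := by simp [Q.d_N]
  T_M := by simp [Q.d_M]
  D_M := by simp [Q.d_M]
  δ_M := by simp [Q.d_M]
  δ'_M := by simp [Q.d_M]

/-- Coordinate components of the frame vectors. -/
def frame : Fin 4 → Fin 4 → A :=
  ![![Q.ν, 1, 0, 0], ![1, -Q.N, 0, 0], ![0, 0, Q.ρ, Q.I * (Q.ρ * Q.σ)],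
    ![0, 0, Q.ρ, -(Q.I * (Q.ρ * Q.σ))]]

/-- Christoffel symbols of the metric. -/
def chr : Fin 4 → Fin 4 → Fin 4 → A :=
  ![![![0, Q.N' * Q.ν, 0, 0], ![Q.N' * Q.ν, 0, 0, 0], ![0, 0, 0, 0], ![0, 0, 0, 0]],
    ![![Q.N * Q.N', 0, 0, 0], ![0, -(Q.N' * Q.ν), 0, 0], ![0, 0, -(Q.r * Q.N), 0],
      ![0, 0, 0, -(Q.r * Q.s ^ 2 * Q.N)]],
    ![![0, 0, 0, 0], ![0, 0, Q.ρ, 0], ![0, Q.ρ, 0, 0], ![0, 0, 0, -(Q.s * Q.c)]],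
    ![![0, 0, 0, 0], ![0, 0, 0, Q.ρ], ![0, 0, 0, Q.c * Q.σ], ![0, Q.ρ, Q.c * Q.σ, 0]]]

/-- Components of the metric. -/
def met : Fin 4 → Fin 4 → A :=
  ![![-Q.N, 0, 0, 0], ![0, Q.ν, 0, 0], ![0, 0, Q.r ^ 2, 0], ![0, 0, 0, Q.r ^ 2 * Q.s ^ 2]]

/-- Components of the inverse metric. -/
def metInv : Fin 4 → Fin 4 → A :=
  ![![-Q.ν, 0, 0, 0], ![0, Q.N, 0, 0], ![0, 0, Q.ρ ^ 2, 0], ![0, 0, 0, Q.ρ ^ 2 * Q.σ ^ 2]]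

theorem chr_symm (a b c : Fin 4) : Q.chr a b c = Q.chr a c b := by
  fin_cases a <;> fin_cases b <;> fin_cases c <;> rfl

set_option maxHeartbeats 1000000 in
theorem d_metInv (c a e : Fin 4) :
    Q.d c (Q.metInv a e) = -∑ f, (Q.chr a c f * Q.metInv f e + Q.chr e c f * Q.metInv a f) := by
  have h1 := Q.r_ρ
  have h2 := Q.s_σ
  have h3 := Q.N_ν
  fin_cases c <;> fin_cases a <;> fin_cases e <;>
    simp [metInv, chr, Fin.sum_univ_four, Derivation.leibniz, Derivation.leibniz_pow, Q.d_ρ,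
      Q.d_σ, Q.d_N, Q.d_ν] <;> grind

-- This makes the abstract table `conn` the Levi-Civita connection: it is checked entry by entry
-- modulo the relations rρ = 1, sσ = 1, Nν = 1, I² = -1 and the formula for N.
set_option maxHeartbeats 1000000 in
theorem frame_chr (a b c : Fin 4) :
    ∑ e, Q.frame a e * nablaVec Q.d Q.chr (Q.frame b) e c =
      ∑ f, Q.null.conn a b f * Q.frame f c := by
  have h1 := Q.r_ρ
  have h2 := Q.s_σ
  have h3 := Q.N_ν
  have h4 := Q.I_sq
  have h5 := Q.N_eq
  -- The null-frame calculus has no symbol for k², so the radial derivative of N has to be rewritten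
  -- through N - 1 and M.
  have h6 : 2 * Q.N' = 2 * (Q.N - 1) * Q.ρ + 6 * Q.M * Q.ρ ^ 2 := by
    rw [N']
    linear_combination (-2 * Q.ρ) * Q.N_eq - (2 * Q.K * Q.r) * Q.r_ρ
  fin_cases a <;> fin_cases b <;> fin_cases c <;>
    simp [nablaVec, frame, chr, Fin.sum_univ_four, Derivation.leibniz, Q.d_ρ,
      Q.d_σ, Q.d_N, Q.d_ν, NullCalculus.conn, null] <;> grind

/-- The frame is a basis, and inverting it by sums and differences of D, N⁻¹L̲ and of 𝔪, 𝔪* produces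
twice each coordinate component. -/
theorem eq_zero_of_evOne_frame {v : Fin 4 → A} (h : ∀ a, evOne v (Q.frame a) = 0) : v = 0 := by
  have h0 := h 0
  have h1 := h 1
  have h2 := h 2
  have h3 := h 3
  simp [evOne, frame, Fin.sum_univ_four] at h0 h1 h2 h3
  funext a
  apply eq_zero_of_two_mul
  fin_cases a <;> simp
  · linear_combination h1 + Q.N * h0 - v 0 * Q.N_ν
  · linear_combination h0 - Q.ν * h1 - v 1 * Q.N_ν
  · linear_combination Q.r * (h2 + h3) - 2 * v 2 * Q.r_ρ
  · linear_combination (-Q.I * Q.s * Q.r) * (h2 - h3) + 2 * Q.r * Q.s * Q.ρ * Q.σ * v 3 * Q.I_sq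
      - 2 * v 3 * Q.r_ρ * (Q.s * Q.σ) - 2 * v 3 * Q.s_σ

/-- Twice the linearised Christoffel symbols. -/
def linChr (h : Fin 4 → Fin 4 → A) (a b c : Fin 4) : A :=
  ∑ f, Q.metInv a f * linConnCoord Q.d Q.chr h f b c

/-- Frame components of a covariant 2-tensor. -/
def toFrame (h : Fin 4 → Fin 4 → A) (a b : Fin 4) : A := evTwo h (Q.frame a) (Q.frame b)

theorem frame_d (a : Fin 4) (u : A) : ∑ e, Q.frame a e * Q.d e u = Q.null.fr a u := by
  fin_cases a <;> simp [frame, Fin.sum_univ_four, NullCalculus.fr, null]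
  · ring
  · linear_combination Q.d 0 u * Q.N_ν
  · ring
  · ring

theorem evThree_linConnCoord_frame (h : Fin 4 → Fin 4 → A) (e a b : Fin 4) :
    evThree (linConnCoord Q.d Q.chr h) (Q.frame e) (Q.frame a) (Q.frame b) =
      Q.null.linConn (Q.toFrame h) e a b := by
  rw [evThree_linConnCoord]
  simp only [evThree_evTwo_nablaTwo Q.d Q.chr Q.frame Q.null.conn Q.frame_chr, frame_d]
  rfl

theorem evFour_nablaThree_frame (h : Fin 4 → Fin 4 → A) (c e a b : Fin 4) :
    evFour (nablaThree Q.d Q.chr (linConnCoord Q.d Q.chr h)) (Q.frame c) (Q.frame e) (Q.frame a)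
      (Q.frame b) = Q.null.covThree (Q.null.linConn (Q.toFrame h)) c e a b := by
  rw [evFour_nablaThree Q.d Q.chr Q.frame Q.null.conn Q.frame_chr]
  simp only [evThree_linConnCoord_frame, frame_d]
  rfl

theorem linCurv_linChr (h : Fin 4 → Fin 4 → A) (a b c e : Fin 4) :
    linCurv Q.d Q.chr (Q.linChr h) a b c e =
      ∑ f, Q.metInv a f * (nablaThree Q.d Q.chr (linConnCoord Q.d Q.chr h) c f e b
        - nablaThree Q.d Q.chr (linConnCoord Q.d Q.chr h) e f c b) :=
  linCurv_raise Q.d Q.chr Q.metInv _ Q.chr_symm Q.d_metInv a b c e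

theorem met_linCurv (h : Fin 4 → Fin 4 → A) (a b c e : Fin 4) :
    ∑ f, Q.met a f * linCurv Q.d Q.chr (Q.linChr h) f b c e =
      nablaThree Q.d Q.chr (linConnCoord Q.d Q.chr h) c a e b
        - nablaThree Q.d Q.chr (linConnCoord Q.d Q.chr h) e a c b := by
  simp only [linCurv_linChr]
  generalize nablaThree Q.d Q.chr (linConnCoord Q.d Q.chr h) = X
  have h1 := Q.r_ρ
  have h2 := Q.s_σ
  have h3 := Q.N_ν
  fin_cases a <;> simp [met, metInv, Fin.sum_univ_four]
  · linear_combination (X c 0 e b - X e 0 c b) * h3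
  · linear_combination (X c 1 e b - X e 1 c b) * h3
  · linear_combination (X c 2 e b - X e 2 c b) * (Q.r * Q.ρ + 1) * h1
  · linear_combination (X c 3 e b - X e 3 c b) * ((Q.r * Q.ρ + 1) * h1 * (Q.s * Q.σ) ^ 2
      + (Q.s * Q.σ + 1) * h2)

/-- The frame components of the linearised curvature tensor. -/
theorem evFour_met_linCurv (h : Fin 4 → Fin 4 → A) (i j : Fin 4) :
    evFour (fun a b c e => ∑ f, Q.met a f * linCurv Q.d Q.chr (Q.linChr h) f b c e)
      (Q.frame i) (Q.frame j) (Q.frame i) (Q.frame j) =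
      Q.null.linRiem (Q.toFrame h) i j i j := by
  rw [NullCalculus.linRiem, ← evFour_nablaThree_frame, ← evFour_nablaThree_frame]
  simp only [met_linCurv]
  generalize nablaThree Q.d Q.chr (linConnCoord Q.d Q.chr h) = X
  simp only [evFour, evThree, evTwo, evOne, Fin.sum_univ_four]
  ring

/-- The pairings g(D, L̲) = -2 and g(𝔪, 𝔪*) = 2 are inverted here; this is where the signs and the
normalisation of `linRic` come from. -/
theorem two_metInv (a e : Fin 4) : 2 * Q.metInv a e =
    -(Q.frame 0 a * Q.frame 1 e) - Q.frame 1 a * Q.frame 0 e + Q.frame 2 a * Q.frame 3 e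
      + Q.frame 3 a * Q.frame 2 e := by
  have h3 := Q.N_ν
  have h4 := Q.I_sq
  fin_cases a <;> fin_cases e <;> simp [metInv, frame] <;> grind

/-- The frame components of the linearised Ricci tensor. -/
theorem evTwo_linRicci (h : Fin 4 → Fin 4 → A) (i j : Fin 4) :
    2 * evTwo (fun b e => ∑ a, linCurv Q.d Q.chr (Q.linChr h) a b a e) (Q.frame i) (Q.frame j) =
      Q.null.linRic (Q.toFrame h) i j := by
  simp only [NullCalculus.linRic, NullCalculus.linRiem, ← evFour_nablaThree_frame, linCurv_linChr]
  generalize nablaThree Q.d Q.chr (linConnCoord Q.d Q.chr h) = X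
  have e1 : ∀ U V, evFour X U V (Q.frame j) (Q.frame i) =
      ∑ a, ∑ f, U a * V f * evTwo (fun b e => X a f e b) (Q.frame i) (Q.frame j) := by
    intro U V
    simp only [evTwo_swap, evFour, evThree, Finset.mul_sum, mul_assoc]
  have e2 : ∀ U V, evFour X (Q.frame j) V U (Q.frame i) =
      ∑ a, ∑ f, U a * V f * evTwo (fun b e => X e f a b) (Q.frame i) (Q.frame j) := by
    intro U V
    simp only [evFour, evThree, evTwo, evOne, Fin.sum_univ_four]
    ring
  have e3 : evTwo (fun b e => ∑ a, ∑ f, Q.metInv a f * (X a f e b - X e f a b))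
      (Q.frame i) (Q.frame j) = ∑ a, ∑ f, Q.metInv a f *
        (evTwo (fun b e => X a f e b) (Q.frame i) (Q.frame j)
          - evTwo (fun b e => X e f a b) (Q.frame i) (Q.frame j)) := by
    rw [evTwo_sum]
    refine Finset.sum_congr rfl fun a _ => ?_
    rw [evTwo_sum_mul]
    refine Finset.sum_congr rfl fun f _ => ?_
    simp only [evTwo_eq, evOne_sub]
  rw [e3]
  simp only [e1, e2, Finset.mul_sum, ← mul_assoc, two_metInv]
  simp only [Fin.sum_univ_four]
  ring

/-- The linearised Einstein equations in coordinates, from their frame components. -/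
theorem linRicci_eq (h : Fin 4 → Fin 4 → A) (κ : A)
    (hh : ∀ i j, Q.null.linRic (Q.toFrame h) i j + κ * Q.toFrame h i j = 0) (b e : Fin 4) :
    2 * ∑ a, linCurv Q.d Q.chr (Q.linChr h) a b a e + κ * h b e = 0 := by
  have h1 : (fun b e => 2 * ∑ a, linCurv Q.d Q.chr (Q.linChr h) a b a e + κ * h b e) = 0 := by
    funext x
    -- A 2-tensor vanishing on all pairs of frame vectors is zero: the basis property is used once
    -- in each slot.
    apply Q.eq_zero_of_evOne_frame
    intro j
    refine congrFun (f := fun x => evOne (fun e => 2 * ∑ a, linCurv Q.d Q.chr (Q.linChr h) a x a e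
      + κ * h x e) (Q.frame j)) (g := 0) ?_ x
    apply Q.eq_zero_of_evOne_frame
    intro i
    rw [← hh i j, ← evTwo_linRicci, toFrame]
    generalize linCurv Q.d Q.chr (Q.linChr h) = F
    generalize hX : (fun b e => ∑ a, F a b a e) = X
    have e1 : ∀ b e, ∑ a, F a b a e = X b e := fun _ _ => by rw [← hX]
    simp only [e1, evTwo, evOne, Fin.sum_univ_four]
    ring
  exact congrFun (congrFun h1 b) e

end CoordCalculus

end SAdS

/-! ### The differential algebra of smooth functions on an open set -/

namespace SAdS

open TopologicalSpace

theorem ContDiffOn.pd {E : Type*} [NormedAddCommGroup E] [NormedSpace ℝ E] {U : Set Coord}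
    (hU : IsOpen U) {f : Coord → E} (hf : ContDiffOn ℝ ∞ f U) (a : Fin 4) :
    ContDiffOn ℝ ∞ (SAdS.pd a f) U :=
  (hf.fderiv_of_isOpen hU (by simp)).clm_apply contDiffOn_const

theorem pd_congr {E : Type*} [NormedAddCommGroup E] [NormedSpace ℝ E] {U : Set Coord}
    (hU : IsOpen U) {f g : Coord → E} (h : ∀ x ∈ U, f x = g x) (a : Fin 4) {x : Coord}
    (hx : x ∈ U) : pd a f x = pd a g x := by
  have : f =ᶠ[nhds x] g := Filter.eventuallyEq_of_mem (hU.mem_nhds hx) h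
  rw [pd, pd, this.fderiv_eq]

theorem ContDiffOn.differentiableAt_of_isOpen {E : Type*} [NormedAddCommGroup E] [NormedSpace ℝ E]
    {U : Set Coord} (hU : IsOpen U) {f : Coord → E} (hf : ContDiffOn ℝ ∞ f U) {x : Coord}
    (hx : x ∈ U) : DifferentiableAt ℝ f x :=
  (hf.contDiffAt (hU.mem_nhds hx)).differentiableAt (by simp)

section pdRules

variable {x : Coord}

theorem pd_add {E : Type*} [NormedAddCommGroup E] [NormedSpace ℝ E] {f g : Coord → E} (a : Fin 4)
    (hf : DifferentiableAt ℝ f x) (hg : DifferentiableAt ℝ g x) :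
    pd a (fun y => f y + g y) x = pd a f x + pd a g x := by
  simp [pd, fderiv_fun_add hf hg]

theorem pd_mul {𝔸 : Type*} [NormedCommRing 𝔸] [NormedAlgebra ℝ 𝔸] {f g : Coord → 𝔸} (a : Fin 4)
    (hf : DifferentiableAt ℝ f x) (hg : DifferentiableAt ℝ g x) :
    pd a (fun y => f y * g y) x = f x * pd a g x + g x * pd a f x := by
  simp [pd, fderiv_fun_mul hf hg]

theorem pd_pd_comm {E : Type*} [NormedAddCommGroup E] [NormedSpace ℝ E] {U : Set Coord}
    (hU : IsOpen U) {f : Coord → E} (hf : ContDiffOn ℝ ∞ f U) (a b : Fin 4) (hx : x ∈ U) :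
    pd a (pd b f) x = pd b (pd a f) x := by
  have h1 : ContDiffAt ℝ ∞ f x := hf.contDiffAt (hU.mem_nhds hx)
  have hd : DifferentiableAt ℝ (fderiv ℝ f) x :=
    (h1.fderiv_right (m := ∞) (by simp)).differentiableAt (by simp)
  have h2 : ∀ a b : Fin 4, pd a (pd b f) x =
      fderiv ℝ (fderiv ℝ f) x (Pi.single a 1) (Pi.single b 1) := by
    intro a b
    have : pd b f = fun y => fderiv ℝ f y (Pi.single b 1) := rfl
    rw [this, pd, fderiv_clm_apply hd (differentiableAt_const _)]
    simp
  rw [h2, h2]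
  exact (h1.isSymmSndFDerivAt (by simpa using ENat.LEInfty.out)) _ _

end pdRules

/-- Extension by zero of a function defined on `U`. -/
noncomputable def extendZero {U : Opens Coord} (f : U → ℂ) : Coord → ℂ :=
  Function.extend Subtype.val f 0

@[simp] theorem extendZero_apply {U : Opens Coord} (f : U → ℂ) (x : U) : extendZero f x = f x :=
  Subtype.val_injective.extend_apply f 0 x

theorem extendZero_of_mem {U : Opens Coord} (f : U → ℂ) {x : Coord} (hx : x ∈ (U : Set Coord)) :
    extendZero f x = f ⟨x, hx⟩ :=
  extendZero_apply f ⟨x, hx⟩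

/-- The algebra of smooth complex functions on `U`. -/
def smoothAlg (U : Opens Coord) : Subalgebra ℂ (U → ℂ) where
  carrier := {f | ContDiffOn ℝ ∞ (extendZero f) U}
  mul_mem' {f g} hf hg := (hf.mul hg).congr fun x hx => by
    simp [extendZero_of_mem _ hx]
  add_mem' {f g} hf hg := (hf.add hg).congr fun x hx => by
    simp [extendZero_of_mem _ hx]
  algebraMap_mem' c := (contDiffOn_const (c := c)).congr fun x hx => by
    simp [extendZero_of_mem _ hx]

variable {U : Opens Coord}

/-- The element of the smooth algebra `u` is the restriction of `F`. -/
def IsRep (F : Coord → ℂ) (u : smoothAlg U) : Prop := ∀ x : U, F x = u.1 x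

theorem IsRep.eq {F : Coord → ℂ} {u v : smoothAlg U} (hu : IsRep F u) (hv : IsRep F v) : u = v :=
  Subtype.ext (funext fun x => (hu x).symm.trans (hv x))

theorem isRep_extendZero (u : smoothAlg U) : IsRep (extendZero u.1) u := fun x => by simp

/-- The restriction of a function that is smooth on `U`. -/
def mkSmooth (F : Coord → ℂ) (hF : ContDiffOn ℝ ∞ F U) : smoothAlg U :=
  ⟨fun x => F x, hF.congr fun x hx => by simp [extendZero_of_mem _ hx]⟩

theorem IsRep.add {F G : Coord → ℂ} {u v : smoothAlg U} (hF : IsRep F u) (hG : IsRep G v) :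
    IsRep (fun x => F x + G x) (u + v) := fun x => by simp [hF x, hG x]

theorem IsRep.sub {F G : Coord → ℂ} {u v : smoothAlg U} (hF : IsRep F u) (hG : IsRep G v) :
    IsRep (fun x => F x - G x) (u - v) := fun x => by simp [hF x, hG x]

theorem IsRep.mul {F G : Coord → ℂ} {u v : smoothAlg U} (hF : IsRep F u) (hG : IsRep G v) :
    IsRep (fun x => F x * G x) (u * v) := fun x => by simp [hF x, hG x]

theorem IsRep.congr {F G : Coord → ℂ} {u : smoothAlg U} (hF : IsRep F u)
    (h : ∀ x ∈ U, G x = F x) : IsRep G u := fun x => (h x x.2).trans (hF x)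

/-- Partial derivatives of smooth functions on `U`. -/
noncomputable def smoothPd (a : Fin 4) : Derivation ℂ (smoothAlg U) (smoothAlg U) :=
  Derivation.mk'
    { toFun := fun u => mkSmooth (pd a (extendZero u.1)) (ContDiffOn.pd U.2 u.2 a)
      map_add' := fun u v => by
        refine Subtype.ext (funext fun x => ?_)
        change pd a (extendZero (u.1 + v.1)) x = pd a (extendZero u.1) x + pd a (extendZero v.1) x
        rw [← pd_add a (ContDiffOn.differentiableAt_of_isOpen U.2 u.2 x.2)
          (ContDiffOn.differentiableAt_of_isOpen U.2 v.2 x.2)]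
        exact pd_congr U.2 (fun y hy => by simp [extendZero_of_mem _ hy]) a x.2
      map_smul' := fun c u => by
        refine Subtype.ext (funext fun x => ?_)
        change pd a (extendZero (c • u.1)) x = c * pd a (extendZero u.1) x
        have h1 := pd_mul (f := fun _ => c) a (differentiableAt_const c)
          (ContDiffOn.differentiableAt_of_isOpen U.2 u.2 x.2)
        have h2 : pd a (fun _ : Coord => c) x = 0 := by simp [pd]
        rw [h2, mul_zero, add_zero] at h1
        rw [← h1]
        exact pd_congr U.2 (fun y hy => by simp [extendZero_of_mem _ hy]) a x.2 }
    (fun u v => by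
      refine Subtype.ext (funext fun x => ?_)
      change pd a (extendZero (u.1 * v.1)) x =
        u.1 x * pd a (extendZero v.1) x + v.1 x * pd a (extendZero u.1) x
      rw [← extendZero_apply u.1 x, ← extendZero_apply v.1 x,
        ← pd_mul a (ContDiffOn.differentiableAt_of_isOpen U.2 u.2 x.2)
        (ContDiffOn.differentiableAt_of_isOpen U.2 v.2 x.2)]
      exact pd_congr U.2 (fun y hy => by simp [extendZero_of_mem _ hy]) a x.2)

theorem IsRep.pd {F : Coord → ℂ} {u : smoothAlg U} (h : IsRep F u) (a : Fin 4) :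
    IsRep (SAdS.pd a F) (smoothPd a u) := fun x =>
  pd_congr U.2 (fun y hy => by rw [extendZero_of_mem _ hy]; exact h ⟨y, hy⟩) a x.2

theorem smoothPd_comm (i j : Fin 4) (u : smoothAlg U) :
    smoothPd i (smoothPd j u) = smoothPd j (smoothPd i u) :=
  Subtype.ext (funext fun x => by
    have h := isRep_extendZero u
    rw [← ((h.pd j).pd i) x, ← ((h.pd i).pd j) x, pd_pd_comm U.2 u.2 i j x.2])

/-- The real function `G` is the real part of `u`. -/
def IsRe (G : Coord → ℝ) (u : smoothAlg U) : Prop := ∀ x : U, G x = (u.1 x).re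

theorem IsRe.contDiffOn {G : Coord → ℝ} {u : smoothAlg U} (h : IsRe G u) :
    ContDiffOn ℝ ∞ G U := by
  have h1 : ContDiffOn ℝ ∞ (fun x => (extendZero u.1 x).re) U :=
    Complex.reCLM.contDiff.comp_contDiffOn u.2
  exact h1.congr fun x hx => by
    rw [extendZero_of_mem _ hx]
    exact h ⟨x, hx⟩

theorem IsRe.pd {G : Coord → ℝ} {u : smoothAlg U} (h : IsRe G u) (a : Fin 4) :
    IsRe (SAdS.pd a G) (smoothPd a u) := fun x => by
  have h1 : SAdS.pd a G x = SAdS.pd a (fun x => (extendZero u.1 x).re) x :=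
    pd_congr U.2 (fun y hy => by rw [extendZero_of_mem _ hy]; exact h ⟨y, hy⟩) a x.2
  rw [h1, ← (isRep_extendZero u).pd a x]
  have h2 := (Complex.reCLM.hasFDerivAt (x := extendZero u.1 x)).comp (x : Coord)
    (ContDiffOn.differentiableAt_of_isOpen U.2 u.2 x.2).hasFDerivAt
  have h3 : HasFDerivAt (fun x => (extendZero u.1 x).re)
    (Complex.reCLM.comp (fderiv ℝ (extendZero u.1) x)) (x : Coord) := h2
  simp [SAdS.pd, h3.fderiv]

theorem IsRe.add {F G : Coord → ℝ} {u v : smoothAlg U} (hF : IsRe F u) (hG : IsRe G v) :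
    IsRe (fun x => F x + G x) (u + v) := fun x => by simp [hF x, hG x]

theorem IsRe.sub {F G : Coord → ℝ} {u v : smoothAlg U} (hF : IsRe F u) (hG : IsRe G v) :
    IsRe (fun x => F x - G x) (u - v) := fun x => by simp [hF x, hG x]

theorem IsRe.sum {F : Fin 4 → Coord → ℝ} {u : Fin 4 → smoothAlg U} (h : ∀ i, IsRe (F i) (u i)) :
    IsRe (fun x => ∑ i, F i x) (∑ i, u i) := fun x => by
  simp [fun i => h i x]

/-- Multiplication by a real function commutes with taking real parts. As the background metric is
real, this allows the real perturbation to be replaced by the complex tensor throughout the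
linearisation. -/
theorem IsRep.mul_isRe {F G : Coord → ℝ} {u v : smoothAlg U}
    (hF : IsRep (fun x => (F x : ℂ)) u) (hG : IsRe G v) : IsRe (fun x => F x * G x) (u * v) :=
  fun x => by simp [hG x, ← hF x]

theorem IsRep.isRe {F : Coord → ℝ} {u : smoothAlg U} (hF : IsRep (fun x => (F x : ℂ)) u) :
    IsRe F u := fun x => by simp [← hF x]

theorem IsRep.pd_ofReal {F : Coord → ℝ} {u : smoothAlg U} (hF : IsRep (fun x => (F x : ℂ)) u)
    (a : Fin 4) : IsRep (fun x => ((SAdS.pd a F x : ℝ) : ℂ)) (smoothPd a u) := fun x => by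
  have h1 : DifferentiableAt ℝ F x :=
    ContDiffOn.differentiableAt_of_isOpen U.2 hF.isRe.contDiffOn x.2
  have h2 := (Complex.ofRealCLM.hasFDerivAt (x := F x)).comp (x : Coord) h1.hasFDerivAt
  have h3 : HasFDerivAt (fun x => (F x : ℂ)) (Complex.ofRealCLM.comp (fderiv ℝ F x)) (x : Coord) :=
    h2
  rw [← hF.pd a x]
  simp [SAdS.pd, h3.fderiv]

end SAdS

/-! ### Differentiating Christoffel symbols and curvature in ε -/

namespace SAdS

section Linearisation

theorem contDiffAt_matrix_det {E : Type*} [NormedAddCommGroup E] [NormedSpace ℝ E]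
    {G : E → Matrix (Fin 4) (Fin 4) ℝ} {p : E} (hG : ∀ i j, ContDiffAt ℝ ∞ (fun q => G q i j) p) :
    ContDiffAt ℝ ∞ (fun q => (G q).det) p := by
  simp only [Matrix.det_apply]
  refine ContDiffAt.sum fun σ _ => ?_
  refine ContDiffAt.const_smul _ ?_
  exact contDiffAt_prod fun i _ => hG _ _

theorem contDiffAt_matrix_inv {E : Type*} [NormedAddCommGroup E] [NormedSpace ℝ E]
    {G : E → Matrix (Fin 4) (Fin 4) ℝ} {p : E} (hG : ∀ i j, ContDiffAt ℝ ∞ (fun q => G q i j) p)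
    (hdet : (G p).det ≠ 0) (i j : Fin 4) : ContDiffAt ℝ ∞ (fun q => (G q)⁻¹ i j) p := by
  have h1 : (fun q => (G q)⁻¹ i j) = fun q => (G q).det⁻¹ * (G q).adjugate i j := by
    funext q
    simp [Matrix.inv_def]
  rw [h1]
  refine ((contDiffAt_matrix_det hG).inv hdet).mul ?_
  simp only [Matrix.adjugate_apply]
  refine contDiffAt_matrix_det fun k l => ?_
  simp only [Matrix.updateRow_apply]
  split_ifs
  · exact contDiffAt_const
  · exact hG _ _

/-- Derivatives in the parameter and in space commute. -/
theorem hasDerivAt_pd_of_contDiffAt {F : ℝ × Coord → ℝ} {x : Coord}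
    (hF : ContDiffAt ℝ ∞ F (0, x)) (e : Fin 4) :
    HasDerivAt (fun ε => pd e (fun y => F (ε, y)) x)
      (pd e (fun y => deriv (fun ε => F (ε, y)) 0) x) 0 := by
  have hev : ∀ᶠ p in nhds ((0 : ℝ), x), DifferentiableAt ℝ F p :=
    ((hF.of_le (m := 1) (by simp)).eventually (by simp)).mono
      fun p hp => hp.differentiableAt (by simp)
  have hd : DifferentiableAt ℝ (fderiv ℝ F) (0, x) :=
    (hF.fderiv_right (m := ∞) (by simp)).differentiableAt (by simp)
  have hcε : Continuous fun ε : ℝ => (ε, x) := by fun_prop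
  have hcy : Continuous fun y : Coord => ((0 : ℝ), y) := by fun_prop
  have h1 : ∀ᶠ ε in nhds (0 : ℝ),
      pd e (fun y => F (ε, y)) x = fderiv ℝ F (ε, x) (0, Pi.single e 1) := by
    filter_upwards [hcε.continuousAt.eventually hev] with ε hε
    have := hε.hasFDerivAt.comp x (hasFDerivAt_prodMk_right (𝕜 := ℝ) ε x)
    have h' : HasFDerivAt (fun y => F (ε, y)) _ x := this
    simp [pd, h'.fderiv]
  have h2 : ∀ᶠ y in nhds x, deriv (fun ε => F (ε, y)) 0 = fderiv ℝ F (0, y) (1, 0) := by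
    filter_upwards [hcy.continuousAt.eventually hev] with y hy
    have := hy.hasFDerivAt.comp (0 : ℝ) (hasFDerivAt_prodMk_left (𝕜 := ℝ) (0 : ℝ) y)
    have h' : HasFDerivAt (fun ε => F (ε, y)) _ 0 := this
    rw [h'.hasDerivAt.deriv]
    simp
  have h3 : HasDerivAt (fun ε => fderiv ℝ F (ε, x) (0, Pi.single e 1))
      (fderiv ℝ (fderiv ℝ F) (0, x) (1, 0) (0, Pi.single e 1)) 0 := by
    have := hd.hasFDerivAt.comp (0 : ℝ) (hasFDerivAt_prodMk_left (𝕜 := ℝ) (0 : ℝ) x)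
    have h' : HasFDerivAt (fun ε => fderiv ℝ F (ε, x)) _ 0 := this
    have h'' := (h'.clm_apply (hasFDerivAt_const ((0 : ℝ), (Pi.single e 1 : Coord)) 0)).hasDerivAt
    simpa using h''
  have h4 : pd e (fun y => deriv (fun ε => F (ε, y)) 0) x =
      fderiv ℝ (fderiv ℝ F) (0, x) (0, Pi.single e 1) (1, 0) := by
    have hee : (fun y => deriv (fun ε => F (ε, y)) 0) =ᶠ[nhds x]
      fun y => fderiv ℝ F (0, y) (1, 0) := h2
    rw [pd, hee.fderiv_eq]
    have := hd.hasFDerivAt.comp x (hasFDerivAt_prodMk_right (𝕜 := ℝ) (0 : ℝ) x)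
    have h' : HasFDerivAt (fun y => fderiv ℝ F (0, y)) _ x := this
    have h'' := h'.clm_apply (hasFDerivAt_const ((1 : ℝ), (0 : Coord)) x)
    rw [h''.fderiv]
    simp
  -- Both sides are the mixed second derivative of F at (0, x), so Schwarz's theorem closes the gap.
  rw [h4, (hF.isSymmSndFDerivAt (by simpa using ENat.LEInfty.out)) _ _]
  exact h3.congr_of_eventuallyEq h1

/-- `∂_b g_{dc} + ∂_c g_{db} - ∂_d g_{bc}`. -/
noncomputable def chrLower (g : Tensor2) (d b c : Fin 4) (x : Coord) : ℝ :=
  pd b (fun y => g y d c) x + pd c (fun y => g y d b) x - pd d (fun y => g y b c) x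

/-- The linearised Christoffel symbols. -/
noncomputable def linChristoffel (g h : Tensor2) (a b c : Fin 4) (x : Coord) : ℝ :=
  (1 / 2) * ∑ d, ((g x)⁻¹ a d * chrLower h d b c x
    - ((g x)⁻¹ * h x * (g x)⁻¹) a d * chrLower g d b c x)

/-- `g` is a smooth metric and `h` a smooth tensor on the open set `U`. -/
structure SmoothPair (U : Set Coord) (g h : Tensor2) : Prop where
  isOpen : IsOpen U
  metric : ∀ i j, ContDiffOn ℝ ∞ (fun y => g y i j) U
  tensor : ∀ i j, ContDiffOn ℝ ∞ (fun y => h y i j) U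
  det_ne : ∀ x ∈ U, (g x).det ≠ 0

variable {U : Set Coord} {g h : Tensor2}

/-- Differentiability comes from the adjugate formula; the value of the derivative then follows by
differentiating (A + εB)(A + εB)⁻¹ = 1. -/
theorem hasDerivAt_inv_perturb {A B : Matrix (Fin 4) (Fin 4) ℝ} (hA : A.det ≠ 0) (i j : Fin 4) :
    HasDerivAt (fun ε : ℝ => (A + ε • B)⁻¹ i j) (-(A⁻¹ * B * A⁻¹) i j) 0 := by
  have hs : ∀ k l, ContDiffAt ℝ ∞ (fun ε : ℝ => (A + ε • B) k l) 0 := by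
    intro k l
    simp only [Matrix.add_apply, Matrix.smul_apply, smul_eq_mul]
    fun_prop
  have hA0 : (A + (0 : ℝ) • B).det ≠ 0 := by simpa using hA
  have hP : ∀ k l, DifferentiableAt ℝ (fun ε : ℝ => (A + ε • B)⁻¹ k l) 0 := fun k l =>
    (contDiffAt_matrix_inv hs hA0 k l).differentiableAt (by simp)
  set P' : Matrix (Fin 4) (Fin 4) ℝ := Matrix.of fun k l => deriv (fun ε : ℝ => (A + ε • B)⁻¹ k l) 0
    with hP'
  have hPd : ∀ k l, HasDerivAt (fun ε : ℝ => (A + ε • B)⁻¹ k l) (P' k l) 0 := fun k l =>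
    (hP k l).hasDerivAt
  have hev : ∀ᶠ ε in nhds (0 : ℝ), (A + ε • B).det ≠ 0 :=
    (contDiffAt_matrix_det hs).continuousAt.eventually_ne hA0
  have key : B * A⁻¹ + A * P' = 0 := by
    ext k l
    have h1 : HasDerivAt (fun ε : ℝ => ((A + ε • B) * (A + ε • B)⁻¹) k l)
        (∑ m, (B k m * A⁻¹ m l + A k m * P' m l)) 0 := by
      simp only [Matrix.mul_apply]
      refine HasDerivAt.fun_sum fun m _ => ?_
      have h2 : HasDerivAt (fun ε : ℝ => (A + ε • B) k m) (B k m) 0 := by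
        simp only [Matrix.add_apply, Matrix.smul_apply, smul_eq_mul]
        simpa using ((hasDerivAt_id (0 : ℝ)).mul_const (B k m)).const_add (A k m)
      simpa using h2.fun_mul (hPd m l)
    have h3 : (fun ε : ℝ => ((A + ε • B) * (A + ε • B)⁻¹) k l) =ᶠ[nhds 0]
        fun _ => (1 : Matrix (Fin 4) (Fin 4) ℝ) k l := by
      filter_upwards [hev] with ε hε
      rw [Matrix.mul_nonsing_inv _ (isUnit_iff_ne_zero.mpr hε)]
    have h4 := (h1.congr_of_eventuallyEq h3.symm).unique (hasDerivAt_const _ _)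
    simpa [Matrix.mul_apply, Finset.sum_add_distrib] using h4
  have h5 : P' = -(A⁻¹ * B * A⁻¹) := by
    have h6 : A⁻¹ * (B * A⁻¹ + A * P') = 0 := by rw [key, mul_zero]
    rw [mul_add, ← mul_assoc, ← mul_assoc,
      Matrix.nonsing_inv_mul _ (isUnit_iff_ne_zero.mpr hA), one_mul] at h6
    exact eq_neg_of_add_eq_zero_right h6
  have := hPd i j
  rw [h5] at this
  exact this

theorem chrLower_perturb (hS : SmoothPair U g h) (ε : ℝ) (d b c : Fin 4) {y : Coord} (hy : y ∈ U) :
    chrLower (perturb g h ε) d b c y = chrLower g d b c y + ε * chrLower h d b c y := by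
  have key : ∀ b d c, pd b (fun y => perturb g h ε y d c) y =
      pd b (fun y => g y d c) y + ε * pd b (fun y => h y d c) y := by
    intro b d c
    have h1 := ContDiffOn.differentiableAt_of_isOpen hS.isOpen (hS.metric d c) hy
    have h2 := ContDiffOn.differentiableAt_of_isOpen hS.isOpen (hS.tensor d c) hy
    have h3 : (fun y => perturb g h ε y d c) = fun y => g y d c + ε * h y d c := rfl
    rw [h3, pd_add b h1 (h2.const_mul ε), pd_mul b (differentiableAt_const ε) h2]
    simp [pd]
  simp only [chrLower, key]
  ring

theorem christoffel_perturb (hS : SmoothPair U g h) (ε : ℝ) (a b c : Fin 4) {y : Coord}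
    (hy : y ∈ U) :
    christoffel (perturb g h ε) a b c y =
      (1 / 2) * ∑ d, (g y + ε • h y)⁻¹ a d * (chrLower g d b c y + ε * chrLower h d b c y) := by
  refine congrArg _ (Finset.sum_congr rfl fun d _ => ?_)
  rw [← chrLower_perturb hS ε d b c hy]
  rfl

theorem hasDerivAt_christoffel (hS : SmoothPair U g h) (a b c : Fin 4) {x : Coord} (hx : x ∈ U) :
    HasDerivAt (fun ε => christoffel (perturb g h ε) a b c x) (linChristoffel g h a b c x) 0 := by
  rw [funext fun ε => christoffel_perturb hS ε a b c hx]
  refine HasDerivAt.const_mul _ ?_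
  refine HasDerivAt.fun_sum fun d _ => ?_
  have h1 : HasDerivAt (fun ε : ℝ => chrLower g d b c x + ε * chrLower h d b c x)
      (chrLower h d b c x) 0 := by
    simpa using ((hasDerivAt_id (0 : ℝ)).mul_const (chrLower h d b c x)).const_add
      (chrLower g d b c x)
  have h2 := (hasDerivAt_inv_perturb (B := h x) (hS.det_ne x hx) a d).fun_mul h1
  refine h2.congr_deriv ?_
  rw [zero_smul, add_zero, zero_mul, add_zero]
  ring

theorem hasDerivAt_pd_christoffel (hS : SmoothPair U g h) (e a b c : Fin 4) {x : Coord}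
    (hx : x ∈ U) :
    HasDerivAt (fun ε => pd e (christoffel (perturb g h ε) a b c) x)
      (pd e (linChristoffel g h a b c) x) 0 := by
  have hs : ∀ (f : Coord → ℝ), ContDiffOn ℝ ∞ f U →
      ContDiffAt ℝ ∞ (fun p : ℝ × Coord => f p.2) (0, x) := fun f hf =>
    ContDiffAt.comp ((0 : ℝ), x) (hf.contDiffAt (hS.isOpen.mem_nhds hx)) contDiffAt_snd
  have hlow : ∀ k : Tensor2, (∀ i j, ContDiffOn ℝ ∞ (fun y => k y i j) U) → ∀ d,
      ContDiffOn ℝ ∞ (chrLower k d b c) U := fun k hk d =>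
    ((ContDiffOn.pd hS.isOpen (hk d c) b).add (ContDiffOn.pd hS.isOpen (hk d b) c)).sub
      (ContDiffOn.pd hS.isOpen (hk b c) d)
  -- Exchanging ∂_ε with ∂_e requires smoothness jointly in (ε, x), not only in each variable
  -- separately.
  have hF : ContDiffAt ℝ ∞ (fun p : ℝ × Coord => (1 / 2) * ∑ d, (g p.2 + p.1 • h p.2)⁻¹ a d *
      (chrLower g d b c p.2 + p.1 * chrLower h d b c p.2)) (0, x) := by
    refine contDiffAt_const.mul (ContDiffAt.sum fun d _ => ?_)
    refine ContDiffAt.mul ?_ ((hs _ (hlow g hS.metric d)).add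
      (contDiffAt_fst.mul (hs _ (hlow h hS.tensor d))))
    refine contDiffAt_matrix_inv (fun i j => ?_) (by simpa using hS.det_ne x hx) a d
    exact (hs _ (hS.metric i j)).add (contDiffAt_fst.mul (hs _ (hS.tensor i j)))
  have h1 := hasDerivAt_pd_of_contDiffAt hF e
  have h2 : ∀ ε, pd e (christoffel (perturb g h ε) a b c) x = pd e (fun y => (1 / 2) * ∑ d,
      (g y + ε • h y)⁻¹ a d * (chrLower g d b c y + ε * chrLower h d b c y)) x := fun ε =>
    pd_congr hS.isOpen (fun y hy => christoffel_perturb hS ε a b c hy) e hx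
  have h3 : pd e (linChristoffel g h a b c) x = pd e (fun y => deriv (fun ε => (1 / 2) * ∑ d,
      (g y + ε • h y)⁻¹ a d * (chrLower g d b c y + ε * chrLower h d b c y)) 0) x := by
    refine pd_congr hS.isOpen (fun y hy => ?_) e hx
    rw [← (hasDerivAt_christoffel hS a b c hy).deriv]
    rw [funext fun ε => christoffel_perturb hS ε a b c hy]
  simp only [h2, h3]
  exact h1

/-- The linearised curvature tensor. -/
theorem hasDerivAt_riemannUp (hS : SmoothPair U g h) (a b c d : Fin 4) {x : Coord} (hx : x ∈ U) :
    HasDerivAt (fun ε => riemannUp (perturb g h ε) a b c d x)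
      (pd c (linChristoffel g h a d b) x - pd d (linChristoffel g h a c b) x
        + ∑ e, (linChristoffel g h a c e x * christoffel g e d b x
          + christoffel g a c e x * linChristoffel g h e d b x
          - (linChristoffel g h a d e x * christoffel g e c b x
          + christoffel g a d e x * linChristoffel g h e c b x))) 0 := by
  have h0 : perturb g h 0 = g := by
    funext y
    simp [perturb]
  have hc := fun a b c => hasDerivAt_christoffel hS a b c hx
  refine ((hasDerivAt_pd_christoffel hS c a d b hx).sub
    (hasDerivAt_pd_christoffel hS d a c b hx)).add ?_
  refine HasDerivAt.fun_sum fun e _ => ?_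
  have := ((hc a c e).fun_mul (hc e d b)).fun_sub ((hc a d e).fun_mul (hc e c b))
  simpa [h0] using this

end Linearisation

end SAdS

/-! ### Christoffel symbols of the background and frame components of the gauge tensor -/

namespace SAdS

namespace CoordCalculus

variable {A : Type*} [CommRing A] [Algebra ℂ A] (Q : CoordCalculus A)

-- This ties the tabulated symbols to the metric; it is stated doubled, so that no division is
-- needed in the algebra.
set_option maxHeartbeats 1000000 in
theorem two_chr (a b c : Fin 4) : 2 * Q.chr a b c = ∑ e, Q.metInv a e *
    (Q.d b (Q.met e c) + Q.d c (Q.met e b) - Q.d e (Q.met b c)) := by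
  have h1 := Q.r_ρ
  have h2 := Q.s_σ
  have h3 := Q.N_ν
  fin_cases a <;> fin_cases b <;> fin_cases c <;>
    simp [metInv, met, chr, Fin.sum_univ_four, Derivation.leibniz, Derivation.leibniz_pow, Q.d_r,
      Q.d_s, Q.d_N, Q.d_ν] <;> grind

/-- Of the six Christoffel terms in the three covariant derivatives, four cancel by the symmetry of
Γ and h. What is left is the form in which the linearised Christoffel symbols come out of
differentiating ½ g⁻¹∂g. -/
theorem linConnCoord_chr {h : Fin 4 → Fin 4 → A} (hs : ∀ a b, h a b = h b a) (e a b : Fin 4) :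
    linConnCoord Q.d Q.chr h e a b = Q.d a (h e b) + Q.d b (h e a) - Q.d e (h a b)
      - 2 * ∑ f, h e f * Q.chr f a b := by
  simp only [linConnCoord, nablaTwo, Q.chr_symm _ b a, Q.chr_symm _ e a, Q.chr_symm _ e b,
    hs _ e, hs b, Fin.sum_univ_four]
  ring

theorem ksq_eq : Q.null.ksq = Q.K := by
  change (Q.N - 1) * Q.ρ ^ 2 + 2 * Q.M * Q.ρ ^ 3 = Q.K
  linear_combination Q.ρ ^ 2 * Q.N_eq + Q.K * (Q.r * Q.ρ + 1) * Q.r_ρ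

/-- The one-form `2 du`. -/
def twoDu : Fin 4 → A := ![1, -Q.ν, 0, 0]

/-- The one-form `σ = dϑ + i sin ϑ dφ`. -/
def sigma : Fin 4 → A := ![0, 0, 1, Q.I * Q.s]

/-- Coordinate components of `a (2du σ + σ 2du) + b 2du 2du + c σ σ`. -/
def gauge (a b c : A) (i j : Fin 4) : A :=
  a * (Q.twoDu i * Q.sigma j + Q.sigma i * Q.twoDu j) + b * (Q.twoDu i * Q.twoDu j)
    + c * (Q.sigma i * Q.sigma j)

theorem gauge_symm (a b c : A) (i j : Fin 4) : Q.gauge a b c i j = Q.gauge a b c j i := by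
  simp only [gauge]
  ring

/-- Both du and σ annihilate D and 𝔪, while 2du(L̲) = 2 and σ(𝔪*) = 2ρ. The factors 2 and 4 convert
between 2du, which is free of fractions, and du. -/
theorem toFrame_gauge (a b c : A) :
    Q.toFrame (Q.gauge a b c) = Q.null.gaugeTensor (2 * a) (4 * b) c := by
  have e : ∀ i j, Q.toFrame (Q.gauge a b c) i j =
      a * (evOne Q.twoDu (Q.frame i) * evOne Q.sigma (Q.frame j)
        + evOne Q.sigma (Q.frame i) * evOne Q.twoDu (Q.frame j))
      + b * (evOne Q.twoDu (Q.frame i) * evOne Q.twoDu (Q.frame j))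
      + c * (evOne Q.sigma (Q.frame i) * evOne Q.sigma (Q.frame j)) := by
    intro i j
    simp only [toFrame, gauge, evTwo, evOne, Fin.sum_univ_four]
    ring
  have hd : (fun i => evOne Q.twoDu (Q.frame i)) = ![0, 2, 0, 0] := by
    funext i
    fin_cases i <;> simp [evOne, twoDu, frame, Fin.sum_univ_four]
    linear_combination Q.N_ν
  have hs : (fun i => evOne Q.sigma (Q.frame i)) = ![0, 0, 0, 2 * Q.ρ] := by
    funext i
    fin_cases i <;> simp [evOne, sigma, frame, Fin.sum_univ_four]
    · linear_combination Q.ρ * Q.s * Q.σ * Q.I_sq - Q.ρ * Q.s_σ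
    · linear_combination -Q.ρ * Q.s * Q.σ * Q.I_sq + Q.ρ * Q.s_σ
  funext i j
  rw [e, congrFun hd i, congrFun hd j, congrFun hs i, congrFun hs j]
  fin_cases i <;> fin_cases j <;> simp [NullCalculus.gaugeTensor, null] <;> ring

end CoordCalculus

open TopologicalSpace

/-- `N = Δ / r²`. -/
noncomputable def lapse (M k r : ℝ) : ℝ := 1 + k ^ 2 * r ^ 2 - 2 * M / r

theorem Del_eq (M k : ℝ) {r : ℝ} (hr : r ≠ 0) : Del M k r = r ^ 2 * lapse M k r := by
  rw [Del, lapse]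
  field_simp

theorem pd_coord {φ : ℝ → ℝ} {φ' : ℝ} (i j : Fin 4) {x : Coord} (h : HasDerivAt φ φ' (x j)) :
    pd i (fun y => φ (y j)) x = if i = j then φ' else 0 := by
  have h1 : HasFDerivAt (fun y : Coord => y j) (ContinuousLinearMap.proj (R := ℝ) j) x :=
    hasFDerivAt_apply j x
  have h2 : HasFDerivAt (fun y : Coord => φ (y j)) _ x := h.comp_hasFDerivAt x h1
  simp [pd, h2.fderiv, Pi.single_apply, eq_comm]

/-- An open set of spherical coordinates in the exterior, off the axis. -/
structure ExteriorChart (M k : ℝ) (U : Opens Coord) : Prop where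
  r_pos : ∀ x ∈ U, 0 < x 1
  lapse_pos : ∀ x ∈ U, 0 < lapse M k (x 1)
  sin_pos : ∀ x ∈ U, 0 < Real.sin (x 2)

variable {M k : ℝ} {U : Opens Coord}

/-- The restriction to `U` of a real function. -/
noncomputable def mkReal (F : Coord → ℝ) (hF : ContDiffOn ℝ ∞ F U) : smoothAlg U :=
  mkSmooth (fun x => (F x : ℂ)) (Complex.ofRealCLM.contDiff.comp_contDiffOn hF)

theorem isRep_mkReal {F : Coord → ℝ} (hF : ContDiffOn ℝ ∞ F U) :
    IsRep (fun x => (F x : ℂ)) (mkReal F hF) := fun _ => rfl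

theorem contDiff_coord (i : Fin 4) : ContDiff ℝ ∞ (fun x : Coord => x i) :=
  contDiff_apply ℝ ℝ i

end SAdS

/-! ### The exterior chart: actual linearised curvature versus the algebraic one -/

namespace SAdS

open TopologicalSpace

variable {M k : ℝ} {U : Opens Coord}

namespace ExteriorChart

theorem contDiffOn_inv_r (hU : ExteriorChart M k U) :
    ContDiffOn ℝ ∞ (fun x : Coord => (x 1)⁻¹) U :=
  (contDiff_coord 1).contDiffOn.inv fun x hx => (hU.r_pos x hx).ne'

theorem contDiffOn_sin : ContDiffOn ℝ ∞ (fun x : Coord => Real.sin (x 2)) U :=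
  (Real.contDiff_sin.comp (contDiff_coord 2)).contDiffOn

theorem contDiffOn_cos : ContDiffOn ℝ ∞ (fun x : Coord => Real.cos (x 2)) U :=
  (Real.contDiff_cos.comp (contDiff_coord 2)).contDiffOn

theorem contDiffOn_inv_sin (hU : ExteriorChart M k U) :
    ContDiffOn ℝ ∞ (fun x : Coord => (Real.sin (x 2))⁻¹) U :=
  contDiffOn_sin.inv fun x hx => (hU.sin_pos x hx).ne'

theorem contDiffOn_lapse (hU : ExteriorChart M k U) :
    ContDiffOn ℝ ∞ (fun x : Coord => lapse M k (x 1)) U := by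
  simp only [lapse, div_eq_mul_inv]
  exact (contDiffOn_const.add (contDiffOn_const.mul ((contDiff_coord 1).contDiffOn.pow 2))).sub
    (contDiffOn_const.mul hU.contDiffOn_inv_r)

theorem contDiffOn_inv_lapse (hU : ExteriorChart M k U) :
    ContDiffOn ℝ ∞ (fun x : Coord => (lapse M k (x 1))⁻¹) U :=
  hU.contDiffOn_lapse.inv fun x hx => (hU.lapse_pos x hx).ne'

/-- The coordinate calculus on `U`. -/
noncomputable def calculus (hU : ExteriorChart M k U) : CoordCalculus (smoothAlg U) where
  d := smoothPd
  r := mkReal (fun x => x 1) (contDiff_coord 1).contDiffOn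
  ρ := mkReal (fun x => (x 1)⁻¹) hU.contDiffOn_inv_r
  s := mkReal (fun x => Real.sin (x 2)) contDiffOn_sin
  σ := mkReal (fun x => (Real.sin (x 2))⁻¹) hU.contDiffOn_inv_sin
  c := mkReal (fun x => Real.cos (x 2)) contDiffOn_cos
  N := mkReal (fun x => lapse M k (x 1)) hU.contDiffOn_lapse
  ν := mkReal (fun x => (lapse M k (x 1))⁻¹) hU.contDiffOn_inv_lapse
  M := algebraMap ℂ _ M
  K := algebraMap ℂ _ (k ^ 2)
  comm := smoothPd_comm
  r_ρ := Subtype.ext (funext fun x => by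
    change ((x.1 1 : ℝ) : ℂ) * (((x.1 1)⁻¹ : ℝ) : ℂ) = 1
    rw [← Complex.ofReal_mul, mul_inv_cancel₀ (hU.r_pos x x.2).ne', Complex.ofReal_one])
  s_σ := Subtype.ext (funext fun x => by
    change ((Real.sin (x.1 2) : ℝ) : ℂ) * (((Real.sin (x.1 2))⁻¹ : ℝ) : ℂ) = 1
    rw [← Complex.ofReal_mul, mul_inv_cancel₀ (hU.sin_pos x x.2).ne', Complex.ofReal_one])
  N_ν := Subtype.ext (funext fun x => by
    change ((lapse M k (x.1 1) : ℝ) : ℂ) * (((lapse M k (x.1 1))⁻¹ : ℝ) : ℂ) = 1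
    rw [← Complex.ofReal_mul, mul_inv_cancel₀ (hU.lapse_pos x x.2).ne', Complex.ofReal_one])
  s_c := Subtype.ext (funext fun x => by
    change ((Real.sin (x.1 2) : ℝ) : ℂ) ^ 2 + ((Real.cos (x.1 2) : ℝ) : ℂ) ^ 2 = 1
    exact_mod_cast Real.sin_sq_add_cos_sq (x.1 2))
  N_eq := Subtype.ext (funext fun x => by
    change ((lapse M k (x.1 1) : ℝ) : ℂ) = 1 + (k : ℂ) ^ 2 * ((x.1 1 : ℝ) : ℂ) ^ 2
      - 2 * (M : ℂ) * (((x.1 1)⁻¹ : ℝ) : ℂ)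
    rw [lapse]
    push_cast
    ring)
  d_r i := Subtype.ext (funext fun x => by
    rw [← (isRep_mkReal (contDiff_coord 1).contDiffOn).pd_ofReal i x]
    change ((pd i (fun y => id (y 1)) x.1 : ℝ) : ℂ) = _
    rw [pd_coord i 1 (hasDerivAt_id (x.1 1))]
    fin_cases i <;> simp)
  d_s i := Subtype.ext (funext fun x => by
    rw [← (isRep_mkReal contDiffOn_sin).pd_ofReal i x]
    change ((pd i (fun y => Real.sin (y 2)) x.1 : ℝ) : ℂ) = _
    rw [pd_coord i 2 (Real.hasDerivAt_sin _)]
    fin_cases i <;> simp [mkReal, mkSmooth])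
  d_c i := Subtype.ext (funext fun x => by
    rw [← (isRep_mkReal contDiffOn_cos).pd_ofReal i x]
    change ((pd i (fun y => Real.cos (y 2)) x.1 : ℝ) : ℂ) = _
    rw [pd_coord i 2 (Real.hasDerivAt_cos _)]
    fin_cases i <;> simp [mkReal, mkSmooth])
  d_M i := Derivation.map_algebraMap _ _
  d_K i := Derivation.map_algebraMap _ _


variable (hU : ExteriorChart M k U)

theorem metric_eq (x : Coord) : metric M k x = Matrix.diagonal ![-lapse M k (x 1),
    (lapse M k (x 1))⁻¹, x 1 ^ 2, x 1 ^ 2 * Real.sin (x 2) ^ 2] := rfl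

theorem metric_inv (hU : ExteriorChart M k U) {x : Coord} (hx : x ∈ U) :
    (metric M k x)⁻¹ = Matrix.diagonal ![-(lapse M k (x 1))⁻¹, lapse M k (x 1), (x 1)⁻¹ ^ 2,
      (x 1)⁻¹ ^ 2 * (Real.sin (x 2))⁻¹ ^ 2] := by
  have h1 := (hU.r_pos x hx).ne'
  have h2 := (hU.sin_pos x hx).ne'
  have h3 := (hU.lapse_pos x hx).ne'
  apply Matrix.inv_eq_right_inv
  rw [metric_eq, Matrix.diagonal_mul_diagonal, ← Matrix.diagonal_one]
  congr 1
  funext i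
  fin_cases i <;> simp <;> field_simp

theorem isRep_metric (i j : Fin 4) :
    IsRep (fun x => (metric M k x i j : ℂ)) (hU.calculus.met i j) := fun x => by
  change ((metric M k x.1 i j : ℝ) : ℂ) = _
  rw [metric_eq]
  fin_cases i <;> fin_cases j <;>
    simp [CoordCalculus.met, calculus, mkReal, mkSmooth]

theorem isRep_metric_inv (i j : Fin 4) :
    IsRep (fun x => ((metric M k x)⁻¹ i j : ℂ)) (hU.calculus.metInv i j) := fun x => by
  change (((metric M k x.1)⁻¹ i j : ℝ) : ℂ) = _
  rw [metric_inv hU x.2]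
  fin_cases i <;> fin_cases j <;>
    simp [CoordCalculus.metInv, calculus, mkReal, mkSmooth]

theorem isRep_chrLower (e b c : Fin 4) :
    IsRep (fun x => (chrLower (metric M k) e b c x : ℂ)) (smoothPd b (hU.calculus.met e c)
      + smoothPd c (hU.calculus.met e b) - smoothPd e (hU.calculus.met b c)) :=
  ((((hU.isRep_metric e c).pd_ofReal b).add ((hU.isRep_metric e b).pd_ofReal c)).sub
    ((hU.isRep_metric b c).pd_ofReal e)).congr fun x _ => by simp [chrLower]

theorem isRep_christoffel (a b c : Fin 4) :
    IsRep (fun x => (christoffel (metric M k) a b c x : ℂ)) (hU.calculus.chr a b c) := fun x => by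
  have h1 := congrFun (congrArg Subtype.val (hU.calculus.two_chr a b c)) x
  have h2 : ((christoffel (metric M k) a b c x : ℝ) : ℂ) = (1 / 2) * ∑ e,
      ((metric M k x)⁻¹ a e : ℂ) * (chrLower (metric M k) e b c x : ℂ) := by
    simp [christoffel, chrLower]
  have h3 : 2 * (hU.calculus.chr a b c).1 x = ∑ e,
      ((metric M k x)⁻¹ a e : ℂ) * (chrLower (metric M k) e b c x : ℂ) := by
    have h4 : ∑ e, ((metric M k x)⁻¹ a e : ℂ) * (chrLower (metric M k) e b c x : ℂ) =
        ∑ e, (hU.calculus.metInv a e).1 x * (smoothPd b (hU.calculus.met e c)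
          + smoothPd c (hU.calculus.met e b) - smoothPd e (hU.calculus.met b c)).1 x :=
      Finset.sum_congr rfl fun e _ =>
        congrArg₂ _ (hU.isRep_metric_inv a e x) (hU.isRep_chrLower e b c x)
    rw [h4]
    refine Eq.trans h1 ?_
    rw [← Subalgebra.coe_val]
    simp
    rfl
  change ((christoffel (metric M k) a b c x : ℝ) : ℂ) = _
  rw [h2, ← h3]
  ring

theorem smoothPair (hU : ExteriorChart M k U) {h : Tensor2} {hc : Fin 4 → Fin 4 → smoothAlg U}
    (hh : ∀ i j, IsRe (fun x => h x i j) (hc i j)) : SmoothPair U (metric M k) h where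
  isOpen := U.2
  metric i j := (hU.isRep_metric i j).isRe.contDiffOn
  tensor i j := (hh i j).contDiffOn
  det_ne x hx := by
    have h1 := (hU.r_pos x hx).ne'
    have h2 := (hU.sin_pos x hx).ne'
    have h3 := (hU.lapse_pos x hx).ne'
    rw [metric_eq, Matrix.det_diagonal]
    simp [Fin.prod_univ_four, h1, h2, h3]

/-- The variation of g⁻¹ contributes -g⁻¹ h Γ, which combines with the partial derivatives of h into
covariant derivatives; hence δΓ is the raised tensor `linConnCoord`. -/
theorem isRe_linChristoffel {h : Tensor2} {hc : Fin 4 → Fin 4 → smoothAlg U}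
    (hh : ∀ i j, IsRe (fun x => h x i j) (hc i j)) (hs : ∀ i j, hc i j = hc j i) (a b c : Fin 4) :
    IsRe (fun x => 2 * linChristoffel (metric M k) h a b c x) (hU.calculus.linChr hc a b c) := by
  have h0 : ∀ x f, 2 * christoffel (metric M k) f b c x =
      ∑ d, (metric M k x)⁻¹ f d * chrLower (metric M k) d b c x := by
    intro x f
    rw [christoffel]
    simp only [chrLower]
    ring
  have h1 : ∀ x ∈ U, 2 * linChristoffel (metric M k) h a b c x = ∑ e, (metric M k x)⁻¹ a e *
      (chrLower h e b c x
        - 2 * ∑ f, christoffel (metric M k) f b c x * h x e f) := by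
    intro x hx
    have h2 : ∀ e, 2 * ∑ f, christoffel (metric M k) f b c x * h x e f = ∑ f, h x e f *
        ∑ d, (metric M k x)⁻¹ f d * chrLower (metric M k) d b c x := by
      intro e
      simp only [← h0 x, Finset.mul_sum]
      exact Finset.sum_congr rfl fun f _ => by ring
    simp only [h2]
    simp only [linChristoffel, Matrix.mul_apply, Fin.sum_univ_four]
    ring
  have h3 : ∀ e, IsRe (fun x => chrLower h e b c x) (smoothPd b (hc e c) + smoothPd c (hc e b)
      - smoothPd e (hc b c)) := fun e =>
    (((hh e c).pd b).add ((hh e b).pd c)).sub ((hh b c).pd e)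
  have h4 : ∀ e, IsRe (fun x => chrLower h e b c x
      - 2 * ∑ f, christoffel (metric M k) f b c x * h x e f)
      (linConnCoord smoothPd hU.calculus.chr hc e b c) := by
    intro e x
    have h5 := IsRe.sum (fun f => (hU.isRep_christoffel f b c).mul_isRe (hh e f)) x
    have h6 := hU.calculus.linConnCoord_chr hs e b c
    have h7 : ∑ f, hc e f * hU.calculus.chr f b c = ∑ f, hU.calculus.chr f b c * hc e f :=
      Finset.sum_congr rfl fun f _ => mul_comm _ _
    rw [h7] at h6
    change linConnCoord smoothPd hU.calculus.chr hc e b c = _ at h6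
    rw [h6]
    change chrLower h e b c x - 2 * ∑ f, christoffel (metric M k) f b c x * h x e f = _
    replace h5 : ∑ f, christoffel (metric M k) f b c x * h x e f = _ := h5
    have h9 : chrLower h e b c x = _ := h3 e x
    rw [h5, h9]
    have h8 : ((2 * ∑ f, hU.calculus.chr f b c * hc e f : smoothAlg U).1 x).re =
        2 * ((∑ f, hU.calculus.chr f b c * hc e f : smoothAlg U).1 x).re := by
      generalize (∑ f, hU.calculus.chr f b c * hc e f : smoothAlg U) = z
      rw [two_mul, two_mul]
      rfl
    rw [← h8]
    rfl
  intro x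
  refine (h1 x x.2).trans ?_
  exact IsRe.sum (fun e => (hU.isRep_metric_inv a e).mul_isRe (h4 e)) x

/-- The linearised curvature tensor at the Schwarzschild–Anti-de Sitter metric. -/
theorem hasDerivAt_riemannUp {h : Tensor2} {hc : Fin 4 → Fin 4 → smoothAlg U}
    (hh : ∀ i j, IsRe (fun x => h x i j) (hc i j)) (hs : ∀ i j, hc i j = hc j i)
    (a b c e : Fin 4) (x : U) :
    HasDerivAt (fun ε => riemannUp (perturb (metric M k) h ε) a b c e x)
      ((1 / 2) *
        ((linCurv smoothPd hU.calculus.chr (hU.calculus.linChr hc) a b c e).1 x).re) 0 := by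
  have h1 := SAdS.hasDerivAt_riemannUp (hU.smoothPair hh) a b c e x.2
  have hC := fun a b c => hU.isRe_linChristoffel hh hs a b c
  have hd : ∀ e a b c, 2 * pd e (linChristoffel (metric M k) h a b c) x =
      ((smoothPd e (hU.calculus.linChr hc a b c)).1 x).re := by
    intro e a b c
    rw [← (hC a b c).pd e x]
    have h2 : DifferentiableAt ℝ (linChristoffel (metric M k) h a b c) x := by
      have h3 : ContDiffOn ℝ ∞ (linChristoffel (metric M k) h a b c) U :=
        ((contDiffOn_const (c := (1 / 2 : ℝ))).mul (hC a b c).contDiffOn).congr fun y _ => by ring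
      exact ContDiffOn.differentiableAt_of_isOpen U.2 h3 x.2
    rw [pd_mul e (differentiableAt_const _) h2]
    simp [pd]
  have h2 := IsRe.sum (fun f =>
    (((hU.isRep_christoffel f e b).mul_isRe (hC a c f)).add
      ((hU.isRep_christoffel a c f).mul_isRe (hC f e b))).sub
    (((hU.isRep_christoffel f c b).mul_isRe (hC a e f)).add
      ((hU.isRep_christoffel a e f).mul_isRe (hC f c b)))) x
  have h3 : (linCurv smoothPd hU.calculus.chr (hU.calculus.linChr hc) a b c e) =
      smoothPd c (hU.calculus.linChr hc a e b) - smoothPd e (hU.calculus.linChr hc a c b)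
      + ∑ f, (hU.calculus.chr f e b * hU.calculus.linChr hc a c f
        + hU.calculus.chr a c f * hU.calculus.linChr hc f e b
        - (hU.calculus.chr f c b * hU.calculus.linChr hc a e f
        + hU.calculus.chr a e f * hU.calculus.linChr hc f c b)) := by
    refine congrArg _ (Finset.sum_congr rfl fun f _ => ?_)
    ring
  refine h1.congr_deriv ?_
  rw [h3]
  have h4 : ∀ u v w : smoothAlg U, ((u - v + w : smoothAlg U).1 x).re =
      (u.1 x).re - (v.1 x).re + (w.1 x).re := fun u v w => rfl
  rw [h4, ← h2, ← hd, ← hd]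
  simp only [Fin.sum_univ_four]
  ring

/-- The linearised Ricci tensor at the Schwarzschild–Anti-de Sitter metric. -/
theorem hasDerivAt_ricci {h : Tensor2} {hc : Fin 4 → Fin 4 → smoothAlg U}
    (hh : ∀ i j, IsRe (fun x => h x i j) (hc i j)) (hs : ∀ i j, hc i j = hc j i)
    (b e : Fin 4) (x : U) :
    HasDerivAt (fun ε => ricci (perturb (metric M k) h ε) b e x)
      ((1 / 2) * ((∑ a, linCurv smoothPd hU.calculus.chr (hU.calculus.linChr hc) a b a e :
        smoothAlg U).1 x).re) 0 := by
  refine (HasDerivAt.fun_sum fun a _ => hU.hasDerivAt_riemannUp hh hs a b a e x).congr_deriv ?_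
  simp [Finset.mul_sum]

/-- Solutions of the Teukolsky equation generate solutions of the linearised Einstein equations. -/
theorem linEinsteinAt {h : Tensor2} {hc : Fin 4 → Fin 4 → smoothAlg U}
    (hh : ∀ i j, IsRe (fun x => h x i j) (hc i j)) (hs : ∀ i j, hc i j = hc j i)
    (hein : ∀ i j, hU.calculus.null.linRic (hU.calculus.toFrame hc) i j
      + 12 * hU.calculus.null.ksq * hU.calculus.toFrame hc i j = 0) (x : U) :
    LinEinsteinAt (-3 * k ^ 2) (metric M k) h x := by
  intro b e
  -- With `linCurv` twice the linearised curvature, this reads 4 δRic + 12 k² h = 0 for the complex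
  -- tensor. Its real part, divided by 4, is the claim.
  have h1 := hU.calculus.linRicci_eq hc _ hein b e
  rw [hU.calculus.ksq_eq] at h1
  have h2 : HasDerivAt (fun ε : ℝ => perturb (metric M k) h ε x b e) (h x b e) 0 := by
    change HasDerivAt (fun ε : ℝ => metric M k x b e + ε * h x b e) (h x b e) 0
    simpa using ((hasDerivAt_id (0 : ℝ)).mul_const (h x b e)).const_add (metric M k x b e)
  refine ((hU.hasDerivAt_ricci hh hs b e x).fun_sub (h2.const_mul (-3 * k ^ 2))).congr_deriv ?_
  have h4 : (2 : ℂ) * (∑ a, linCurv smoothPd hU.calculus.chr (hU.calculus.linChr hc) a b a e :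
      smoothAlg U).1 x + 12 * ((k : ℂ) ^ 2) * (hc b e).1 x = 0 :=
    congrArg (fun u : smoothAlg U => u.1 x) h1
  generalize (∑ a, linCurv smoothPd hU.calculus.chr (hU.calculus.linChr hc) a b a e :
    smoothAlg U).1 x = z at h4 ⊢
  have h7 : h x b e = _ := hh b e x
  rw [h7]
  have h5 := congrArg Complex.re h4
  have h6 : ((12 : ℂ) * ((k : ℂ) ^ 2) * (hc b e).1 x).re = 12 * k ^ 2 * ((hc b e).1 x).re := by
    rw [show (12 : ℂ) * ((k : ℂ) ^ 2) = ((12 * k ^ 2 : ℝ) : ℂ) by push_cast; ring,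
      Complex.re_ofReal_mul]
  rw [Complex.add_re, h6] at h5
  simp at h5
  linarith

end ExteriorChart
end SAdS

/-! ### Translation of the differential operators into the algebra -/

namespace SAdS

open TopologicalSpace

variable {M k : ℝ} {U : Opens Coord}

theorem IsRep.apply {F : Coord → ℂ} {u : smoothAlg U} (h : IsRep F u) (x : U) : F x = u.1 x := h x

/-- The spin-weighted Laplacian factors through the raising and lowering operators as 𝓛^{[-2]} = 2 -
𝓛†₋₁𝓛₂, which removes sin ϑ from the calculation in favour of δ, δ' and κ. -/
theorem CoordCalculus.angMinusTwo_eq {A : Type*} [CommRing A] [Algebra ℂ A] (Q : CoordCalculus A)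
    (u : A) : 2 * u - Q.null.δ' (Q.null.up 2 u) + Q.null.κ * Q.null.up 2 u =
      -1 * (Q.σ * Q.d 2 (Q.s * Q.d 2 u) + Q.σ * Q.σ * Q.d 3 (Q.d 3 u)
        + -4 * Q.I * (Q.c * (Q.σ * Q.σ)) * Q.d 3 u - 4 * (Q.c * Q.σ * (Q.c * Q.σ) * u)
        - 4 * u) := by
  have i1 := Q.I_sq
  have i2 := Q.s_σ
  have i3 := Q.comm 3 2 u
  have c1 : Q.null.up 2 u = Q.d 2 u + Q.I * Q.σ * Q.d 3 u + 2 * (Q.c * Q.σ) * u := by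
    simp only [NullCalculus.up, Int.cast_ofNat]
    rfl
  have c2 : ∀ v, Q.null.δ' v = Q.d 2 v - Q.I * Q.σ * Q.d 3 v := fun v => rfl
  have c3 : Q.null.κ = Q.c * Q.σ := rfl
  rw [c1, c2, c3]
  simp [Derivation.leibniz, NullCalculus.derivation_ofNat, Q.d_σ, Q.d_c, Q.d_s, i3]
  linear_combination Q.σ ^ 2 * Q.d 3 (Q.d 3 u) * i1 + (2 * u + Q.d 2 (Q.d 2 u)) * i2

namespace ExteriorChart

variable (hU : ExteriorChart M k U)

theorem isRep_r : IsRep (fun x => ((x 1 : ℝ) : ℂ)) hU.calculus.r := fun _ => rfl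
theorem isRep_ρ : IsRep (fun x => (((x 1)⁻¹ : ℝ) : ℂ)) hU.calculus.ρ := fun _ => rfl
theorem isRep_s : IsRep (fun x => ((Real.sin (x 2) : ℝ) : ℂ)) hU.calculus.s := fun _ => rfl
theorem isRep_σ : IsRep (fun x => (((Real.sin (x 2))⁻¹ : ℝ) : ℂ)) hU.calculus.σ := fun _ => rfl
theorem isRep_c : IsRep (fun x => ((Real.cos (x 2) : ℝ) : ℂ)) hU.calculus.c := fun _ => rfl
theorem isRep_N : IsRep (fun x => ((lapse M k (x 1) : ℝ) : ℂ)) hU.calculus.N := fun _ => rfl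
theorem isRep_ν : IsRep (fun x => (((lapse M k (x 1))⁻¹ : ℝ) : ℂ)) hU.calculus.ν := fun _ => rfl

theorem isRep_const (z : ℂ) : IsRep (fun _ => z) (algebraMap ℂ (smoothAlg U) z) := fun _ => rfl

theorem Del_div (hU : ExteriorChart M k U) {x : Coord} (hx : x ∈ U) :
    Del M k (x 1) / x 1 ^ 2 = lapse M k (x 1) := by
  rw [Del_eq M k (hU.r_pos x hx).ne']
  have := (hU.r_pos x hx).ne'
  field_simp

theorem w_eq (hU : ExteriorChart M k U) {x : Coord} (hx : x ∈ U) :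
    w M k (x 1) = lapse M k (x 1) / x 1 ^ 2 := by
  rw [w, Del_eq M k (hU.r_pos x hx).ne']
  have := (hU.r_pos x hx).ne'
  field_simp

theorem isRep_rMul (n : ℕ) {F : Coord → ℂ} {u : smoothAlg U} (h : IsRep F u) :
    IsRep (rMul n F) (hU.calculus.r ^ n * u) := fun x => by
  have h1 : F x = _ := h x
  simp [rMul, h1, ← hU.isRep_r.apply x]

theorem isRep_L {F : Coord → ℂ} {u : smoothAlg U} (h : IsRep F u) :
    IsRep (L M k F) (hU.calculus.N * hU.calculus.null.D u) := by
  have e : hU.calculus.N * hU.calculus.null.D u = smoothPd 0 u + hU.calculus.N * smoothPd 1 u := by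
    have h1 := hU.calculus.N_ν
    change hU.calculus.N * (smoothPd 1 u + hU.calculus.ν * smoothPd 0 u) = _
    linear_combination smoothPd 0 u * h1
  rw [e]
  exact ((h.pd 0).add (hU.isRep_N.mul (h.pd 1))).congr fun x hx => by
    rw [L, Del_div hU hx]

theorem isRep_Lbar {F : Coord → ℂ} {u : smoothAlg U} (h : IsRep F u) :
    IsRep (Lbar M k F) (2 * hU.calculus.null.T u - hU.calculus.N * hU.calculus.null.D u) := by
  have e : 2 * hU.calculus.null.T u - hU.calculus.N * hU.calculus.null.D u =
      smoothPd 0 u - hU.calculus.N * smoothPd 1 u := by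
    have h1 := hU.calculus.N_ν
    change 2 * smoothPd 0 u - hU.calculus.N * (smoothPd 1 u + hU.calculus.ν * smoothPd 0 u) = _
    linear_combination -smoothPd 0 u * h1
  rw [e]
  exact ((h.pd 0).sub (hU.isRep_N.mul (h.pd 1))).congr fun x hx => by
    rw [Lbar, Del_div hU hx]

theorem isRep_wL {F : Coord → ℂ} {u : smoothAlg U} (h : IsRep F u) :
    IsRep (wL M k F) (hU.calculus.r ^ 2 * hU.calculus.null.D u) := by
  have e : hU.calculus.r ^ 2 * hU.calculus.null.D u =
      hU.calculus.r * hU.calculus.r * hU.calculus.ν *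
        (hU.calculus.N * hU.calculus.null.D u) := by
    have h1 := hU.calculus.N_ν
    linear_combination -hU.calculus.r ^ 2 * hU.calculus.null.D u * h1
  rw [e]
  refine (((hU.isRep_r.mul hU.isRep_r).mul hU.isRep_ν).mul (hU.isRep_L h)).congr fun x hx => ?_
  rw [wL, w_eq hU hx]
  push_cast
  rw [inv_div]
  ring

theorem isRep_angL (n : ℤ) {F : Coord → ℂ} {u : smoothAlg U} (h : IsRep F u) :
    IsRep (angL n F) (hU.calculus.null.up n u) := by
  have e : hU.calculus.null.up n u =
      (smoothPd 2 u + algebraMap ℂ _ Complex.I * hU.calculus.σ * smoothPd 3 u)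
        + algebraMap ℂ _ (n : ℂ) * (hU.calculus.c * hU.calculus.σ) * u := by
    rw [map_intCast]
    rfl
  rw [e]
  refine (((h.pd 2).add (((isRep_const _).mul hU.isRep_σ).mul (h.pd 3))).add
    (((isRep_const _).mul (hU.isRep_c.mul hU.isRep_σ)).mul h)).congr fun x hx => ?_
  simp only [angL]
  push_cast
  ring

theorem isRep_angMinusTwo {F : Coord → ℂ} {u : smoothAlg U} (h : IsRep F u) :
    IsRep (angMinusTwo F) (2 * u - hU.calculus.null.δ' (hU.calculus.null.up 2 u)
      + hU.calculus.null.κ * hU.calculus.null.up 2 u) := by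
  have h2 := (hU.isRep_s.mul (h.pd 2)).pd 2
  have h1 := ((((hU.isRep_σ.mul h2).add ((hU.isRep_σ.mul hU.isRep_σ).mul ((h.pd 3).pd 3))).add
    (((isRep_const (2 * (-2) * Complex.I)).mul (hU.isRep_c.mul (hU.isRep_σ.mul hU.isRep_σ))).mul
      (h.pd 3))).sub ((isRep_const 4).mul (((hU.isRep_c.mul hU.isRep_σ).mul
      (hU.isRep_c.mul hU.isRep_σ)).mul h))).sub ((isRep_const 4).mul h)
  have h3 := (isRep_const (U := U) (-1)).mul h1
  have e := hU.calculus.angMinusTwo_eq u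
  have c4 : algebraMap ℂ (smoothAlg U) (2 * (-2) * Complex.I) = -4 * hU.calculus.I := by
    rw [CoordCalculus.I, ← map_ofNat (algebraMap ℂ (smoothAlg U)) 4, ← map_neg, ← map_mul]
    norm_num
  have c5 : algebraMap ℂ (smoothAlg U) 4 = 4 := map_ofNat _ 4
  have c6 : algebraMap ℂ (smoothAlg U) (-1) = -1 := by rw [map_neg, map_one]
  rw [c4, c5, c6] at h3
  rw [e]
  refine h3.congr fun x hx => ?_
  simp only [angMinusTwo]
  push_cast
  ring

end ExteriorChart
end SAdS

/-! ### The Teukolsky equation and the Hertz tensor in terms of ψ = r⁵ α̃_G -/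

namespace SAdS

open TopologicalSpace

namespace NullCalculus

variable {A : Type*} [CommRing A] [Algebra ℂ A] (S : NullCalculus A)

/-- The power 5 is the least for which a, b, c and the Teukolsky operator contain only non-negative
powers of ρ: the coefficient c contains r⁵D²α̃_G. No relation rρ = 1 is then needed in
`NullCalculus`. -/
theorem teuk_pow_mul (ψ : A) : -(S.N * S.D (2 * S.T (S.ρ ^ 5 * ψ) - S.N * S.D (S.ρ ^ 5 * ψ)))
      - 2 * (2 * (S.N - 1) * S.ρ + 6 * S.M * S.ρ ^ 2 - 2 * S.N * S.ρ) * (S.N * S.D (S.ρ ^ 5 * ψ))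
      - S.N * S.ρ ^ 2 * (2 * (S.ρ ^ 5 * ψ) - S.δ' (S.up 2 (S.ρ ^ 5 * ψ))
        + S.κ * S.up 2 (S.ρ ^ 5 * ψ) + (-2 + 6 * S.M * S.ρ) * (S.ρ ^ 5 * ψ)) =
    S.N * S.ρ ^ 5 * S.teuk ψ := by
  simp [up, teuk, Derivation.leibniz, Derivation.leibniz_pow]
  ring

end NullCalculus

namespace CoordCalculus

variable {A : Type*} [CommRing A] [Algebra ℂ A] (Q : CoordCalculus A)

theorem ρ_pow_mul_r_pow (n : ℕ) : Q.ρ ^ n * Q.r ^ n = 1 := by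
  rw [← mul_pow, mul_comm, Q.r_ρ, one_pow]

theorem null_D_r : Q.null.D Q.r = 1 := by
  change Q.d 1 Q.r + Q.ν * Q.d 0 Q.r = 1
  simp [Q.d_r]

theorem null_δ_r : Q.null.δ Q.r = 0 := by
  change Q.d 2 Q.r + Q.I * Q.σ * Q.d 3 Q.r = 0
  simp [Q.d_r]

theorem hertzA_eq (u : A) : Q.null.hertzA (Q.r ^ 5 * u) =
    2 * (-4 * Q.null.up 2 (Q.r ^ 2 * Q.null.D (Q.r ^ 1 * u))) := by
  have hρ : Q.null.ρ = Q.ρ := rfl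
  simp [NullCalculus.hertzA, NullCalculus.up, Derivation.leibniz, Derivation.leibniz_pow,
    null_D_r, null_δ_r, hρ]
  linear_combination 8 * Q.r ^ 3 * (Q.null.δ (Q.null.D u) + 2 * Q.null.κ * Q.null.D u) *
      Q.ρ_pow_mul_r_pow 2 + (Q.null.δ u + 2 * Q.null.κ * u) *
      (40 * Q.r ^ 2 * Q.ρ_pow_mul_r_pow 2 - 32 * Q.r ^ 2 * Q.ρ_pow_mul_r_pow 3)

theorem hertzB_eq (u : A) : Q.null.hertzB (Q.r ^ 5 * u) =
    4 * (-4 * Q.null.up 1 (Q.null.up 2 (Q.r ^ 1 * u))) := by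
  have hρ : Q.null.ρ = Q.ρ := rfl
  simp [NullCalculus.hertzB, NullCalculus.up, Derivation.leibniz, Derivation.leibniz_pow,
    null_δ_r, hρ]
  linear_combination 16 * Q.r *
      (Q.null.δ (Q.null.δ u) + 3 * Q.null.κ * Q.null.δ u - 2 * u) * Q.ρ_pow_mul_r_pow 4

theorem hertzC_eq (u : A) : Q.null.hertzC (Q.r ^ 5 * u) =
    -4 * (Q.ρ * (Q.r ^ 2 * Q.null.D (Q.r ^ 2 * (Q.r ^ 2 * Q.null.D u)))) := by
  have hρ : Q.null.ρ = Q.ρ := rfl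
  simp [NullCalculus.hertzC, Derivation.leibniz, Derivation.leibniz_pow, null_D_r, hρ]
  linear_combination -(4 * Q.r ^ 5 * Q.null.D (Q.null.D u) + 40 * Q.r ^ 4 * Q.null.D u
      + 120 * Q.r ^ 3 * u) * Q.ρ_pow_mul_r_pow 1 + 40 * Q.r ^ 3 * u * Q.ρ_pow_mul_r_pow 2

end CoordCalculus

variable {M k : ℝ} {U : Opens Coord}

namespace ExteriorChart

variable (hU : ExteriorChart M k U)

/-- Since w = N/r², the logarithmic derivative times N is N' - 2N/r, and N' is expressed without k².
-/
theorem lapse_mul_deriv_log (hU : ExteriorChart M k U) {x : Coord} (hx : x ∈ U) :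
    lapse M k (x 1) * deriv (fun r => Real.log (Del M k r / r ^ 4)) (x 1) =
      2 * (lapse M k (x 1) - 1) * (x 1)⁻¹ + 6 * M * (x 1)⁻¹ ^ 2
        - 2 * lapse M k (x 1) * (x 1)⁻¹ := by
  have hr := (hU.r_pos x hx).ne'
  have hN := (hU.lapse_pos x hx).ne'
  have hD : Del M k (x 1) = x 1 ^ 2 * lapse M k (x 1) := Del_eq M k hr
  have hD0 : Del M k (x 1) ≠ 0 := by
    rw [hD]
    positivity
  have h1 : HasDerivAt (fun r => Del M k r)
      (2 * x 1 + k ^ 2 * (4 * x 1 ^ 3) - 2 * M) (x 1) := by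
    have := (((hasDerivAt_pow 2 (x 1)).fun_add ((hasDerivAt_pow 4 (x 1)).const_mul (k ^ 2))).fun_sub
      ((hasDerivAt_id (x 1)).const_mul (2 * M)))
    refine this.congr_deriv ?_
    norm_num
  have h2 := (h1.fun_div (hasDerivAt_pow 4 (x 1)) (by positivity)).log
    (div_ne_zero hD0 (by positivity))
  rw [h2.deriv, hD]
  have hK : k ^ 2 * x 1 ^ 3 = x 1 * lapse M k (x 1) - x 1 + 2 * M := by
    rw [lapse]
    field_simp
    ring
  have hK' : k ^ 2 * (4 * x 1 ^ 3) = 4 * (x 1 * lapse M k (x 1) - x 1 + 2 * M) := by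
    rw [← hK]
    ring
  rw [hK']
  generalize lapse M k (x 1) = N at hN ⊢
  field_simp
  ring

theorem isRep_teukolsky {F : Coord → ℂ} {u : smoothAlg U} (h : IsRep F u) :
    IsRep (teukolskyMinusTwo M k F) (hU.calculus.null.N * hU.calculus.null.ρ ^ 5 *
      hU.calculus.null.teuk (hU.calculus.r ^ 5 * u)) := by
  -- Writing u as ρ⁵ times ψ = r⁵u brings the operator to the form of `teuk_pow_mul`.
  have hu : u = hU.calculus.null.ρ ^ 5 * (hU.calculus.r ^ 5 * u) := by
    have := hU.calculus.ρ_pow_mul_r_pow 5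
    change u = hU.calculus.ρ ^ 5 * (hU.calculus.r ^ 5 * u)
    linear_combination -u * this
  rw [← NullCalculus.teuk_pow_mul, ← hu]
  have c2 : algebraMap ℂ (smoothAlg U) 2 = 2 := map_ofNat _ 2
  have c6 : algebraMap ℂ (smoothAlg U) 6 = 6 := map_ofNat _ 6
  have c1 : algebraMap ℂ (smoothAlg U) 1 = 1 := map_one _
  have cm : algebraMap ℂ (smoothAlg U) (-1) = -1 := by rw [map_neg, map_one]
  have cm2 : algebraMap ℂ (smoothAlg U) (-2) = -2 := by rw [map_neg, map_ofNat]
  have r2 := isRep_const (U := U) 2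
  have r6 := isRep_const (U := U) 6
  have r1 := isRep_const (U := U) 1
  have rm := isRep_const (U := U) (-1)
  have rm2 := isRep_const (U := U) (-2)
  rw [c2] at r2
  rw [c6] at r6
  rw [c1] at r1
  rw [cm] at rm
  rw [cm2] at rm2
  have rM : IsRep (fun _ => (M : ℂ)) hU.calculus.null.M := fun _ => rfl
  have rρ : IsRep (fun x => (((x 1)⁻¹ : ℝ) : ℂ)) hU.calculus.null.ρ := fun _ => rfl
  have rN : IsRep (fun x => ((lapse M k (x 1) : ℝ) : ℂ)) hU.calculus.null.N := fun _ => rfl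
  have hρ2 := rρ.mul rρ
  rw [← sq] at hρ2
  have hK := (((r2.mul (rN.sub r1)).mul rρ).add ((r6.mul rM).mul hρ2)).sub ((r2.mul rN).mul rρ)
  have hV := rm2.add ((r6.mul rM).mul rρ)
  have h1 := hU.isRep_L (hU.isRep_Lbar h)
  have h2 := (r2.mul hK).mul (hU.isRep_L h)
  have h3 := (rN.mul hρ2).mul ((hU.isRep_angMinusTwo h).add (hV.mul h))
  have h4 := ((rm.mul h1).sub h2).sub h3
  rw [neg_one_mul (_ : smoothAlg U)] at h4
  refine h4.congr fun x hx => ?_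
  rw [teukolskyMinusTwo, Del_div hU hx, hU.lapse_mul_deriv_log hx]
  have h5 : Del M k (x 1) / x 1 ^ 4 = lapse M k (x 1) * (x 1)⁻¹ ^ 2 := by
    have := hU.w_eq hx
    rw [w] at this
    rw [this, div_eq_mul_inv, inv_pow]
  rw [h5]
  push_cast
  rw [div_eq_mul_inv]
  ring

theorem teuk_eq_zero {F : Coord → ℂ} {u : smoothAlg U} (h : IsRep F u)
    (hF : ∀ x ∈ U, teukolskyMinusTwo M k F x = 0) :
    hU.calculus.null.teuk (hU.calculus.r ^ 5 * u) = 0 := by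
  have h1 := (hU.isRep_teukolsky h).eq (v := 0) fun x => hF x x.2
  have h2 := hU.calculus.ρ_pow_mul_r_pow 5
  have h3 := hU.calculus.N_ν
  change hU.calculus.N * hU.calculus.ρ ^ 5 * _ = 0 at h1
  linear_combination hU.calculus.ν * hU.calculus.r ^ 5 * h1 -
    hU.calculus.null.teuk (hU.calculus.r ^ 5 * u) *
      (hU.calculus.N * hU.calculus.ν * h2 + h3)

/-- The tensor generating `𝔥[f]`. -/
noncomputable def hertzCoord (u : smoothAlg U) : Fin 4 → Fin 4 → smoothAlg U :=
  hU.calculus.gauge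
    (-4 * hU.calculus.null.up 2 (hU.calculus.r ^ 2 * hU.calculus.null.D (hU.calculus.r ^ 1 * u)))
    (-4 * hU.calculus.null.up 1 (hU.calculus.null.up 2 (hU.calculus.r ^ 1 * u)))
    (-4 * (hU.calculus.ρ * (hU.calculus.r ^ 2 * hU.calculus.null.D
      (hU.calculus.r ^ 2 * (hU.calculus.r ^ 2 * hU.calculus.null.D u)))))

theorem toFrame_hertzCoord (u : smoothAlg U) :
    hU.calculus.toFrame (hU.hertzCoord u) = hU.calculus.null.hertzFr (hU.calculus.r ^ 5 * u) := by
  rw [hertzCoord, CoordCalculus.toFrame_gauge, NullCalculus.hertzFr, CoordCalculus.hertzA_eq,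
    CoordCalculus.hertzB_eq, CoordCalculus.hertzC_eq]

theorem isRe_hertz {f : Coord → ℂ} {u : smoothAlg U} (h : IsRep f u) (i j : Fin 4) :
    IsRe (fun x => hertz M k f x i j) (hU.hertzCoord u i j) := by
  have hX := hU.isRep_angL 2 (hU.isRep_wL (hU.isRep_rMul 1 h))
  have hY := hU.isRep_angL 1 (hU.isRep_angL 2 (hU.isRep_rMul 1 h))
  have hZ := hU.isRep_wL (hU.isRep_rMul 2 (hU.isRep_wL h))
  have hdu : ∀ i, IsRep (fun x => 2 * du M k x i) (hU.calculus.twoDu i) := by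
    intro i x
    have h1 : x.1 1 ^ 2 / Del M k (x.1 1) = (lapse M k (x.1 1))⁻¹ := by
      rw [← hU.Del_div x.2, inv_div]
    fin_cases i <;> simp [du, CoordCalculus.twoDu]
    · norm_cast
      rw [h1]
      push_cast
      rw [← hU.isRep_ν.apply x]
      push_cast
      ring
  have hsig : ∀ i, IsRep (fun x => sig x i) (hU.calculus.sigma i) := by
    intro i x
    fin_cases i <;> simp [sig, CoordCalculus.sigma]
    rw [← hU.isRep_s.apply x]
    simp [CoordCalculus.I]
  have h4 : IsRep (fun x => -4 * (2 * angL 2 (wL M k (rMul 1 f)) x *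
      (du M k x i * sig x j + sig x i * du M k x j)
      + 4 * angL 1 (angL 2 (rMul 1 f)) x * (du M k x i * du M k x j)
      + (x 1 : ℂ)⁻¹ * wL M k (rMul 2 (wL M k f)) x * (sig x i * sig x j)))
      (hU.hertzCoord u i j) := by
    have c4 : algebraMap ℂ (smoothAlg U) (-4) = -4 := by rw [map_neg, map_ofNat]
    rw [hertzCoord, CoordCalculus.gauge, ← c4]
    refine (((((isRep_const (-4)).mul hX).mul (((hdu i).mul (hsig j)).add
      ((hsig i).mul (hdu j)))).add (((isRep_const (-4)).mul hY).mul ((hdu i).mul (hdu j)))).add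
      (((isRep_const (-4)).mul (hU.isRep_ρ.mul hZ)).mul ((hsig i).mul (hsig j)))).congr
      fun x _ => ?_
    push_cast
    ring
  intro x
  rw [← h4 x]
  simp [hertz]

end ExteriorChart
end SAdS

/-! ### Curvature of the background -/

namespace SAdS

namespace CoordCalculus

variable {A : Type*} [CommRing A] [Algebra ℂ A] (Q : CoordCalculus A)

theorem d_N' (i : Fin 4) : Q.d i Q.N' = ![0, Q.K - 2 * Q.M * Q.ρ ^ 3, 0, 0] i := by
  rw [N']
  fin_cases i <;>
    simp [Derivation.leibniz, Derivation.leibniz_pow, Q.d_r, Q.d_K, Q.d_M, Q.d_ρ]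
  ring

/-- Sectional curvatures of the coordinate planes. -/
def sec : Fin 4 → Fin 4 → A :=
  ![![0, 2 * Q.M * Q.ρ ^ 3 - Q.K, -(Q.N' * Q.ρ), -(Q.N' * Q.ρ)],
    ![2 * Q.M * Q.ρ ^ 3 - Q.K, 0, -(Q.N' * Q.ρ), -(Q.N' * Q.ρ)],
    ![-(Q.N' * Q.ρ), -(Q.N' * Q.ρ), 0, (1 - Q.N) * Q.ρ ^ 2],
    ![-(Q.N' * Q.ρ), -(Q.N' * Q.ρ), (1 - Q.N) * Q.ρ ^ 2, 0]]

/-- The curvature tensor of the metric. -/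
def curv (a b c e : Fin 4) : A :=
  Q.d c (Q.chr a e b) - Q.d e (Q.chr a c b)
    + ∑ f, (Q.chr a c f * Q.chr f e b - Q.chr a e f * Q.chr f c b)

theorem curv_antisymm (a b c e : Fin 4) : Q.curv a b c e = -Q.curv a b e c := by
  simp only [curv, Fin.sum_univ_four]
  ring

set_option maxHeartbeats 1000000 in
theorem curv_eq_of_lt (a b c e : Fin 4) (hce : c < e) :
    Q.curv a b c e =
      Q.sec a b * ((if a = c then Q.met b e else 0) - if a = e then Q.met b c else 0) := by
  have h1 := Q.r_ρ
  have h2 := Q.s_σ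
  have h3 := Q.N_ν
  have h4 := Q.s_c
  fin_cases c <;> fin_cases e <;> first | (exfalso; revert hce; decide) | skip
  all_goals
    clear hce
    fin_cases a <;> fin_cases b <;>
    simp [curv, sec, met, chr, Fin.sum_univ_four, Derivation.leibniz, Derivation.leibniz_pow,
      Q.d_ρ, Q.d_σ, Q.d_N, Q.d_ν, Q.d_N', Q.d_r, Q.d_s, Q.d_c] 
  all_goals try ring1
  all_goals grind

/-- The background is of constant curvature on each coordinate plane. -/
theorem curv_eq (a b c e : Fin 4) :
    Q.curv a b c e =
      Q.sec a b * ((if a = c then Q.met b e else 0) - if a = e then Q.met b c else 0) := by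
  rcases lt_trichotomy c e with h | rfl | h
  · exact Q.curv_eq_of_lt a b c e h
  · simp [curv]
  · rw [curv_antisymm, Q.curv_eq_of_lt a b e c h]
    ring

end CoordCalculus

end SAdS

/-! ### Linearised Weyl scalars on a transverse null pair -/

namespace SAdS

section Weyl

/-- The complex bilinear extension of a real matrix. -/
def bil (G : Fin 4 → Fin 4 → ℝ) (X Y : Fin 4 → ℂ) : ℂ := ∑ a, ∑ b, (G a b : ℂ) * X a * Y b

theorem sum_mul_sum_four (F H : Fin 4 → Fin 4 → ℂ) :
    (∑ a, ∑ c, F a c) * ∑ b, ∑ d, H b d = ∑ a, ∑ b, ∑ c, ∑ d, F a c * H b d := by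
  simp only [Finset.sum_mul_sum]

/-- On arguments (X, Y, X, Y) the trace corrections are products of two bilinear forms, each of
which vanishes on a transverse null pair. The curvature keeps its upper index, so that the perturbed
metric lowering it acts on X instead. -/
theorem weylEval_eq (g : Tensor2) (x : Coord) (X Y : Fin 4 → ℂ) :
    weylEval g x X Y X Y =
      ∑ f, (∑ a, (g x a f : ℂ) * X a) *
        (∑ b, ∑ c, ∑ d, (riemannUp g f b c d x : ℂ) * (Y b * X c * Y d))
      - (1 / 2) * (bil (g x) X X * bil (fun a b => ricci g a b x) Y Y
        + bil (g x) Y Y * bil (fun a b => ricci g a b x) X X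
        - bil (g x) X Y * bil (fun a b => ricci g a b x) Y X
        - bil (g x) Y X * bil (fun a b => ricci g a b x) X Y)
      + (scalarCurv g x / 6 : ℝ) *
        (bil (g x) X X * bil (g x) Y Y - bil (g x) X Y * bil (g x) Y X) := by
  have e1 : ∑ f, (∑ a, (g x a f : ℂ) * X a) *
        (∑ b, ∑ c, ∑ d, (riemannUp g f b c d x : ℂ) * (Y b * X c * Y d)) =
      ∑ a, ∑ b, ∑ c, ∑ d, (riemann g a b c d x : ℂ) * X a * Y b * X c * Y d := by
    simp only [riemann, Complex.ofReal_sum, Complex.ofReal_mul, Finset.sum_mul]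
    simp only [Finset.mul_sum]
    rw [Finset.sum_comm]
    refine Finset.sum_congr rfl fun a _ => ?_
    rw [Finset.sum_comm]
    refine Finset.sum_congr rfl fun b _ => ?_
    rw [Finset.sum_comm]
    refine Finset.sum_congr rfl fun c _ => ?_
    rw [Finset.sum_comm]
    refine Finset.sum_congr rfl fun d _ => ?_
    refine Finset.sum_congr rfl fun f _ => ?_
    ring
  have e2 : ∀ (G H : Fin 4 → Fin 4 → ℝ) (U V W Z : Fin 4 → ℂ), bil G U W * bil H V Z =
      ∑ a, ∑ b, ∑ c, ∑ d, (G a c * H b d : ℂ) * (U a * V b * W c * Z d) := by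
    intro G H U V W Z
    simp only [bil, sum_mul_sum_four]
    refine Finset.sum_congr rfl fun a _ => Finset.sum_congr rfl fun b _ =>
      Finset.sum_congr rfl fun c _ => Finset.sum_congr rfl fun d _ => ?_
    ring
  have e3 : ∀ (G H : Fin 4 → Fin 4 → ℝ) (U V W Z : Fin 4 → ℂ), bil G U Z * bil H V W =
      ∑ a, ∑ b, ∑ c, ∑ d, (G a d * H b c : ℂ) * (U a * V b * W c * Z d) := by
    intro G H U V W Z
    rw [e2]
    refine Finset.sum_congr rfl fun a _ => Finset.sum_congr rfl fun b _ => ?_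
    rw [Finset.sum_comm]
    refine Finset.sum_congr rfl fun c _ => Finset.sum_congr rfl fun d _ => ?_
    ring
  rw [e1, e2 (g x) (fun a b => ricci g a b x), mul_comm (bil (g x) Y Y), e2 _ (g x),
    e3 (g x) (fun a b => ricci g a b x), mul_comm (bil (g x) Y X), e3 _ (g x), e2 (g x) (g x),
    e3 (g x) (g x)]
  simp only [Finset.mul_sum, ← Finset.sum_add_distrib, ← Finset.sum_sub_distrib, weylEval]
  refine Finset.sum_congr rfl fun a _ => Finset.sum_congr rfl fun b _ =>
    Finset.sum_congr rfl fun c _ => Finset.sum_congr rfl fun d _ => ?_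
  rw [weyl]
  push_cast
  ring

/-- `f` vanishes at `0`, where it is differentiable. -/
def VanishOne (f : ℝ → ℂ) : Prop := f 0 = 0 ∧ DifferentiableAt ℝ f 0

/-- `f` vanishes at `0` together with its derivative. -/
def VanishTwo (f : ℝ → ℂ) : Prop := f 0 = 0 ∧ HasDerivAt f 0 0

variable {f g : ℝ → ℂ}

theorem VanishOne.mul (hf : VanishOne f) (hg : VanishOne g) : VanishTwo fun ε => f ε * g ε := by
  refine ⟨by simp [hf.1], ?_⟩
  have := hf.2.hasDerivAt.fun_mul hg.2.hasDerivAt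
  simpa [hf.1, hg.1] using this

theorem VanishTwo.mul_left (hf : VanishTwo f) (hg : DifferentiableAt ℝ g 0) :
    VanishTwo fun ε => g ε * f ε := by
  refine ⟨by simp [hf.1], ?_⟩
  have := hg.hasDerivAt.fun_mul hf.2
  simpa [hf.1] using this

theorem VanishTwo.add (hf : VanishTwo f) (hg : VanishTwo g) : VanishTwo fun ε => f ε + g ε :=
  ⟨by simp [hf.1, hg.1], by simpa using hf.2.fun_add hg.2⟩

theorem VanishTwo.sub (hf : VanishTwo f) (hg : VanishTwo g) : VanishTwo fun ε => f ε - g ε :=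
  ⟨by simp [hf.1, hg.1], by simpa using hf.2.fun_sub hg.2⟩

theorem VanishTwo.sum {F : Fin 4 → ℝ → ℂ} (hF : ∀ i, VanishTwo (F i)) :
    VanishTwo fun ε => ∑ i, F i ε :=
  ⟨by simp [(hF _).1], by simpa using HasDerivAt.fun_sum (u := Finset.univ) fun i _ => (hF i).2⟩

/-- A curvature tensor with the algebraic symmetries of the spherically symmetric backgrounds: the
sectional curvatures of the coordinate planes. -/
def secMat (p q s : ℝ) : Fin 4 → Fin 4 → ℝ :=
  ![![0, p, q, q], ![p, 0, q, q], ![q, q, 0, s], ![q, q, s, 0]]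

/-- The background curvature term, whose frame contraction vanishes to second order. -/
theorem vanishTwo_background (d : Fin 4 → ℝ) (p q s : ℝ) {v e m : ℝ → Fin 4 → ℂ}
    (hv : ∀ i, DifferentiableAt ℝ (fun ε => v ε i) 0)
    (he : ∀ i, DifferentiableAt ℝ (fun ε => e ε i) 0)
    (hm : ∀ i, DifferentiableAt ℝ (fun ε => m ε i) 0) (hv0 : ∀ i, v 0 i = d i * m 0 i)
    (he2 : e 0 2 = 0) (he3 : e 0 3 = 0) (hm0 : m 0 0 = 0) (hm1 : m 0 1 = 0)
    (hee : d 0 * e 0 0 ^ 2 + d 1 * e 0 1 ^ 2 = 0) (hmm : d 2 * m 0 2 ^ 2 + d 3 * m 0 3 ^ 2 = 0) :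
    VanishTwo fun ε => ∑ f, v ε f * ∑ b, ∑ c, ∑ k, ((secMat p q s f b *
      ((if f = c then (if b = k then d b else 0) else 0)
        - (if f = k then (if b = c then d b else 0) else 0)) : ℝ) : ℂ) *
          (e ε b * m ε c * e ε k) := by
  have h1 : (fun ε => ∑ f, v ε f * ∑ b, ∑ c, ∑ k, ((secMat p q s f b *
      ((if f = c then (if b = k then d b else 0) else 0)
        - (if f = k then (if b = c then d b else 0) else 0)) : ℝ) : ℂ) *
          (e ε b * m ε c * e ε k)) = fun ε =>
      ((∑ b, secMat p q s 0 b * d b * (e ε b * e ε b)) * (v ε 0 * m ε 0)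
        + (∑ b, secMat p q s 1 b * d b * (e ε b * e ε b)) * (v ε 1 * m ε 1)
        + ((v ε 2 * m ε 2 + v ε 3 * m ε 3) * (q * (d 0 * e ε 0 ^ 2 + d 1 * e ε 1 ^ 2))
          + (s * d 3 * (v ε 2 * m ε 2)) * (e ε 3 * e ε 3)
          + (s * d 2 * (v ε 3 * m ε 3)) * (e ε 2 * e ε 2)))
      - ∑ f, ∑ b, (secMat p q s f b * d b) * ((v ε f * e ε f) * (e ε b * m ε b)) := by
    funext ε
    have h2 : ∀ f, ∑ b, ∑ c, ∑ k, ((secMat p q s f b *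
        ((if f = c then (if b = k then d b else 0) else 0)
        - (if f = k then (if b = c then d b else 0) else 0)) : ℝ) : ℂ) *
          (e ε b * m ε c * e ε k) =
        (∑ b, secMat p q s f b * d b * (e ε b * e ε b)) * m ε f
          - ∑ b, secMat p q s f b * d b * e ε f * (e ε b * m ε b) := by
      intro f
      rw [Finset.sum_mul, ← Finset.sum_sub_distrib]
      refine Finset.sum_congr rfl fun b _ => ?_
      simp only [Complex.ofReal_mul, Complex.ofReal_sub, apply_ite Complex.ofReal,
        Complex.ofReal_zero, mul_sub, sub_mul, Finset.sum_sub_distrib, mul_ite, ite_mul, mul_zero,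
        zero_mul, Finset.sum_ite_irrel, Finset.sum_const_zero, Finset.sum_ite_eq, Finset.mem_univ,
        if_true]
      ring
    simp only [h2]
    simp only [mul_sub, Finset.sum_sub_distrib]
    congr 1
    · simp only [Fin.sum_univ_four]
      simp [secMat]
      ring
    · simp only [Finset.mul_sum]
      refine Finset.sum_congr rfl fun f _ => Finset.sum_congr rfl fun b _ => ?_
      ring
  rw [h1]
  -- At ε = 0 the vectors e and m have disjoint supports in the coordinates, m and its lowered form
  -- v have no t or r part, e has no angular part, and both e and m are null.
  have em : ∀ b, VanishOne fun ε => e ε b * m ε b := fun b =>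
    ⟨by fin_cases b <;> simp [he2, he3, hm0, hm1], (he b).fun_mul (hm b)⟩
  have ve : ∀ b, VanishOne fun ε => v ε b * e ε b := fun b =>
    ⟨by change v 0 b * e 0 b = 0; rw [hv0]; fin_cases b <;> simp [he2, he3, hm0, hm1],
      (hv b).fun_mul (he b)⟩
  have v0 : VanishOne fun ε => v ε 0 := ⟨by simp [hv0, hm0], hv 0⟩
  have v1 : VanishOne fun ε => v ε 1 := ⟨by simp [hv0, hm1], hv 1⟩
  have m0 : VanishOne fun ε => m ε 0 := ⟨hm0, hm 0⟩
  have m1 : VanishOne fun ε => m ε 1 := ⟨hm1, hm 1⟩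
  have e2 : VanishOne fun ε => e ε 2 := ⟨he2, he 2⟩
  have e3 : VanishOne fun ε => e ε 3 := ⟨he3, he 3⟩
  have ee : VanishOne fun ε => (q : ℂ) * (d 0 * e ε 0 ^ 2 + d 1 * e ε 1 ^ 2) :=
    ⟨by simp [hee], by fun_prop⟩
  have vm : VanishOne fun ε => v ε 2 * m ε 2 + v ε 3 * m ε 3 :=
    ⟨by change v 0 2 * m 0 2 + v 0 3 * m 0 3 = 0; rw [hv0, hv0, ← hmm]; ring, by fun_prop⟩
  refine VanishTwo.sub (VanishTwo.add (VanishTwo.add ?_ ?_)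
    (VanishTwo.add (VanishTwo.add ?_ ?_) ?_)) ?_
  · exact (v0.mul m0).mul_left (by fun_prop)
  · exact (v1.mul m1).mul_left (by fun_prop)
  · exact vm.mul ee
  · exact (e3.mul e3).mul_left (by fun_prop)
  · exact (e2.mul e2).mul_left (by fun_prop)
  · exact VanishTwo.sum fun f => VanishTwo.sum fun b =>
      ((ve f).mul (em b)).mul_left (by fun_prop)

theorem differentiableAt_ofReal_comp {f : ℝ → ℝ} (hf : DifferentiableAt ℝ f 0) :
    DifferentiableAt ℝ (fun ε => (f ε : ℂ)) 0 :=
  Complex.ofRealCLM.differentiableAt.comp 0 hf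

theorem differentiableAt_bil {G : ℝ → Fin 4 → Fin 4 → ℝ} {X Y : ℝ → Fin 4 → ℂ}
    (hG : ∀ a b, DifferentiableAt ℝ (fun ε => G ε a b) 0)
    (hX : ∀ i, DifferentiableAt ℝ (fun ε => X ε i) 0)
    (hY : ∀ i, DifferentiableAt ℝ (fun ε => Y ε i) 0) :
    DifferentiableAt ℝ (fun ε => bil (G ε) (X ε) (Y ε)) 0 :=
  DifferentiableAt.fun_sum fun a _ => DifferentiableAt.fun_sum fun b _ =>
    ((differentiableAt_ofReal_comp (hG a b)).fun_mul (hX a)).fun_mul (hY b)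

theorem bil_diagonal {G : Fin 4 → Fin 4 → ℝ} {d : Fin 4 → ℝ} (hG : G = Matrix.diagonal d)
    (X Y : Fin 4 → ℂ) : bil G X Y = ∑ a, d a * (X a * Y a) := by
  simp [bil, hG, Matrix.diagonal_apply, apply_ite Complex.ofReal, ite_mul, mul_assoc]

theorem perturb_zero (g h : Tensor2) : perturb g h 0 = g := by
  funext y
  simp [perturb]

/-- The linearised Weyl curvature, on a transverse null pair of vectors of the background. -/
theorem hasDerivAt_weylEval {g h : Tensor2} {x : Coord} {R' : Fin 4 → Fin 4 → Fin 4 → Fin 4 → ℝ}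
    {d : Fin 4 → ℝ} {p q s : ℝ}
    (hR : ∀ a b c k, HasDerivAt (fun ε => riemannUp (perturb g h ε) a b c k x) (R' a b c k) 0)
    (hdet : (g x).det ≠ 0) (hg : g x = Matrix.diagonal d)
    (hS : ∀ f b c k, riemannUp g f b c k x = secMat p q s f b *
      ((if f = c then (if b = k then d b else 0) else 0)
        - (if f = k then (if b = c then d b else 0) else 0))) {e m : ℝ → Fin 4 → ℂ}
    (he : ∀ i, DifferentiableAt ℝ (fun ε => e ε i) 0)
    (hm : ∀ i, DifferentiableAt ℝ (fun ε => m ε i) 0)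
    (he2 : e 0 2 = 0) (he3 : e 0 3 = 0) (hm0 : m 0 0 = 0) (hm1 : m 0 1 = 0)
    (hee : d 0 * e 0 0 ^ 2 + d 1 * e 0 1 ^ 2 = 0) (hmm : d 2 * m 0 2 ^ 2 + d 3 * m 0 3 ^ 2 = 0) :
    HasDerivAt (fun ε => weylEval (perturb g h ε) x (m ε) (e ε) (m ε) (e ε))
      (∑ f, d f * m 0 f * ∑ b, ∑ c, ∑ k, (R' f b c k : ℂ) * (e 0 b * m 0 c * e 0 k)) 0 := by
  have hG : ∀ a b, DifferentiableAt ℝ (fun ε => perturb g h ε x a b) 0 := fun a b => by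
    change DifferentiableAt ℝ (fun ε : ℝ => g x a b + ε * h x a b) 0
    fun_prop
  have hRic : ∀ a b, DifferentiableAt ℝ (fun ε => ricci (perturb g h ε) a b x) 0 := fun a b =>
    DifferentiableAt.fun_sum fun c _ => (hR c a c b).differentiableAt
  have hscal : DifferentiableAt ℝ (fun ε => scalarCurv (perturb g h ε) x) 0 :=
    DifferentiableAt.fun_sum fun a _ => DifferentiableAt.fun_sum fun b _ =>
      (hasDerivAt_inv_perturb (B := h x) hdet a b).differentiableAt.fun_mul (hRic a b)
  have hG0 : perturb g h 0 x = Matrix.diagonal d := by rw [perturb_zero, hg]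
  -- The background Ricci tensor is a multiple of g on the (t, r) plane and another multiple on the
  -- sphere, so e and m remain null and orthogonal for it.
  have hRic0 : (fun a b => ricci (perturb g h 0) a b x) = Matrix.diagonal
      ![(p + 2 * q) * d 0, (p + 2 * q) * d 1, (2 * q + s) * d 2, (2 * q + s) * d 3] := by
    funext a b
    simp only [perturb_zero, ricci, hS, Fin.sum_univ_four]
    fin_cases a <;> fin_cases b <;> simp [secMat] <;> ring
  have hv : ∀ f, DifferentiableAt ℝ (fun ε => ∑ a, (perturb g h ε x a f : ℂ) * m ε a) 0 := fun f =>
    DifferentiableAt.fun_sum fun a _ => (differentiableAt_ofReal_comp (hG a f)).fun_mul (hm a)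
  have hv0 : ∀ f, ∑ a, (perturb g h 0 x a f : ℂ) * m 0 a = d f * m 0 f := fun f => by
    simp [hG0, Matrix.diagonal_apply, apply_ite Complex.ofReal, ite_mul]
  have hGmm : VanishOne fun ε => bil (perturb g h ε x) (m ε) (m ε) :=
    ⟨by
      refine (bil_diagonal hG0 _ _).trans ?_
      rw [Fin.sum_univ_four, hm0, hm1]
      linear_combination hmm, differentiableAt_bil hG hm hm⟩
  have hGee : VanishOne fun ε => bil (perturb g h ε x) (e ε) (e ε) :=
    ⟨by
      refine (bil_diagonal hG0 _ _).trans ?_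
      rw [Fin.sum_univ_four, he2, he3]
      linear_combination hee, differentiableAt_bil hG he he⟩
  have hGme : VanishOne fun ε => bil (perturb g h ε x) (m ε) (e ε) :=
    ⟨by simp [bil_diagonal hG0, Fin.sum_univ_four, he2, he3, hm0, hm1],
      differentiableAt_bil hG hm he⟩
  have hGem : VanishOne fun ε => bil (perturb g h ε x) (e ε) (m ε) :=
    ⟨by simp [bil_diagonal hG0, Fin.sum_univ_four, he2, he3, hm0, hm1],
      differentiableAt_bil hG he hm⟩
  have hRmm : VanishOne fun ε => bil (fun a b => ricci (perturb g h ε) a b x) (m ε) (m ε) :=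
    ⟨by
      refine (bil_diagonal hRic0 _ _).trans ?_
      rw [Fin.sum_univ_four, hm0, hm1]
      simp
      linear_combination (2 * q + s) * hmm, differentiableAt_bil hRic hm hm⟩
  have hRee : VanishOne fun ε => bil (fun a b => ricci (perturb g h ε) a b x) (e ε) (e ε) :=
    ⟨by
      refine (bil_diagonal hRic0 _ _).trans ?_
      rw [Fin.sum_univ_four, he2, he3]
      simp
      linear_combination (p + 2 * q) * hee, differentiableAt_bil hRic he he⟩
  have hRme : VanishOne fun ε => bil (fun a b => ricci (perturb g h ε) a b x) (m ε) (e ε) :=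
    ⟨by simp [bil_diagonal hRic0, Fin.sum_univ_four, he2, he3, hm0, hm1],
      differentiableAt_bil hRic hm he⟩
  have hRem : VanishOne fun ε => bil (fun a b => ricci (perturb g h ε) a b x) (e ε) (m ε) :=
    ⟨by simp [bil_diagonal hRic0, Fin.sum_univ_four, he2, he3, hm0, hm1],
      differentiableAt_bil hRic he hm⟩
  have h1 : VanishTwo fun ε => (1 / 2 : ℂ) *
      (bil (perturb g h ε x) (m ε) (m ε) * bil (fun a b => ricci (perturb g h ε) a b x) (e ε) (e ε)
      + bil (perturb g h ε x) (e ε) (e ε) * bil (fun a b => ricci (perturb g h ε) a b x) (m ε) (m ε)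
      - bil (perturb g h ε x) (m ε) (e ε) * bil (fun a b => ricci (perturb g h ε) a b x) (e ε) (m ε)
      - bil (perturb g h ε x) (e ε) (m ε) *
        bil (fun a b => ricci (perturb g h ε) a b x) (m ε) (e ε)) :=
    ((((hGmm.mul hRee).add (hGee.mul hRmm)).sub (hGme.mul hRem)).sub (hGem.mul hRme)).mul_left
      (differentiableAt_const _)
  have h2 : VanishTwo fun ε => ((scalarCurv (perturb g h ε) x / 6 : ℝ) : ℂ) *
      (bil (perturb g h ε x) (m ε) (m ε) * bil (perturb g h ε x) (e ε) (e ε)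
      - bil (perturb g h ε x) (m ε) (e ε) * bil (perturb g h ε x) (e ε) (m ε)) :=
    ((hGmm.mul hGee).sub (hGme.mul hGem)).mul_left
      (differentiableAt_ofReal_comp (hscal.div_const 6))
  have h3 := vanishTwo_background d p q s hv he hm hv0 he2 he3 hm0 hm1 hee hmm
  -- The curvature is split into its background value, handled by `h3`, and the increment. The
  -- latter vanishes at ε = 0, so neither the variation of the frame nor that of the lowering metric
  -- contributes.
  have h4 : HasDerivAt (fun ε => ∑ f, (∑ a, (perturb g h ε x a f : ℂ) * m ε a) * ∑ b, ∑ c, ∑ k,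
      ((riemannUp (perturb g h ε) f b c k x - riemannUp g f b c k x : ℝ) : ℂ) *
        (e ε b * m ε c * e ε k))
      (∑ f, d f * m 0 f * ∑ b, ∑ c, ∑ k, (R' f b c k : ℂ) * (e 0 b * m 0 c * e 0 k)) 0 := by
    refine HasDerivAt.fun_sum fun f _ => ?_
    have h5 : HasDerivAt (fun ε => ∑ b, ∑ c, ∑ k,
        ((riemannUp (perturb g h ε) f b c k x - riemannUp g f b c k x : ℝ) : ℂ) *
          (e ε b * m ε c * e ε k))
        (∑ b, ∑ c, ∑ k, (R' f b c k : ℂ) * (e 0 b * m 0 c * e 0 k)) 0 := by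
      refine HasDerivAt.fun_sum fun b _ => HasDerivAt.fun_sum fun c _ =>
        HasDerivAt.fun_sum fun k _ => ?_
      have h6 := ((hR f b c k).sub_const (riemannUp g f b c k x)).ofReal_comp
      have h7 := (((he b).fun_mul (hm c)).fun_mul (he k)).hasDerivAt
      refine (h6.fun_mul h7).congr_deriv ?_
      simp [perturb_zero]
    refine ((hv f).hasDerivAt.fun_mul h5).congr_deriv ?_
    rw [hv0]
    simp [perturb_zero]
  have h5 := ((h4.fun_add h3.2).fun_sub h1.2).fun_add h2.2
  simp only [add_zero, sub_zero] at h5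
  refine h5.congr_of_eventuallyEq (Filter.Eventually.of_forall fun ε => ?_)
  simp only [weylEval_eq]
  congr 2
  rw [← Finset.sum_add_distrib]
  refine Finset.sum_congr rfl fun f _ => ?_
  rw [← mul_add]
  congr 1
  simp only [← Finset.sum_add_distrib]
  refine Finset.sum_congr rfl fun b _ => Finset.sum_congr rfl fun c _ =>
    Finset.sum_congr rfl fun k _ => ?_
  rw [← hS, Complex.ofReal_sub]
  ring

end Weyl

end SAdS

/-! ### Weyl scalars of a real part in terms of complex frame components -/

namespace SAdS

open TopologicalSpace

variable {M k : ℝ} {U : Opens Coord}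

/-- Evaluation at a point. -/
def evalAt (x : U) : smoothAlg U →+* ℂ := (Pi.evalRingHom _ x).comp (smoothAlg U).val.toRingHom

theorem evalAt_apply (x : U) (u : smoothAlg U) : evalAt x u = u.1 x := rfl

theorem IsRep.sum {F : Fin 4 → Coord → ℂ} {u : Fin 4 → smoothAlg U} (h : ∀ i, IsRep (F i) (u i)) :
    IsRep (fun x => ∑ i, F i x) (∑ i, u i) := fun x => by
  rw [← evalAt_apply, map_sum]
  exact Finset.sum_congr rfl fun i _ => h i x

namespace ExteriorChart

variable (hU : ExteriorChart M k U)

theorem isRep_riemannUp (a b c e : Fin 4) :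
    IsRep (fun x => (riemannUp (metric M k) a b c e x : ℂ)) (hU.calculus.curv a b c e) := by
  have h1 := hU.isRep_christoffel
  refine ((((h1 a e b).pd_ofReal c).sub ((h1 a c b).pd_ofReal e)).add (IsRep.sum fun f =>
    ((h1 a c f).mul (h1 f e b)).sub ((h1 a e f).mul (h1 f c b)))).congr fun x _ => ?_
  simp [riemannUp]

/-- The diagonal components of the metric. -/
noncomputable def metricDiag (M k : ℝ) (x : Coord) : Fin 4 → ℝ :=
  ![-lapse M k (x 1), (lapse M k (x 1))⁻¹, x 1 ^ 2, x 1 ^ 2 * Real.sin (x 2) ^ 2]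

theorem isRep_metricDiag (a : Fin 4) :
    IsRep (fun x => (metricDiag M k x a : ℂ)) (hU.calculus.met a a) :=
  (hU.isRep_metric a a).congr fun x _ => by
    rw [metric_eq, Matrix.diagonal_apply_eq]
    rfl

theorem met_of_ne {A : Type*} [CommRing A] [Algebra ℂ A] (Q : CoordCalculus A) {a b : Fin 4}
    (h : a ≠ b) : Q.met a b = 0 := by
  fin_cases a <;> fin_cases b <;> first | rfl | exact absurd rfl h

theorem riemannUp_metric (hU : ExteriorChart M k U) (x : U) (a b c e : Fin 4) :
    riemannUp (metric M k) a b c e x =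
      secMat (2 * M * (x.1 1)⁻¹ ^ 3 - k ^ 2) (-((k ^ 2 * x.1 1 + M * (x.1 1)⁻¹ ^ 2) * (x.1 1)⁻¹))
        ((1 - lapse M k (x.1 1)) * (x.1 1)⁻¹ ^ 2) a b *
      ((if a = c then (if b = e then metricDiag M k x b else 0) else 0)
        - (if a = e then (if b = c then metricDiag M k x b else 0) else 0)) := by
  have h1 : ((riemannUp (metric M k) a b c e x : ℝ) : ℂ) = _ := hU.isRep_riemannUp a b c e x
  have h2 : ∀ b e, evalAt x (hU.calculus.met b e) =
      if b = e then (metricDiag M k x b : ℂ) else 0 := by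
    intro b e
    split_ifs with h
    · rw [← h]
      exact (hU.isRep_metricDiag b x).symm
    · rw [met_of_ne _ h, map_zero]
  have h3 : evalAt x (hU.calculus.sec a b) =
      ((secMat (2 * M * (x.1 1)⁻¹ ^ 3 - k ^ 2) (-((k ^ 2 * x.1 1 + M * (x.1 1)⁻¹ ^ 2) * (x.1 1)⁻¹))
        ((1 - lapse M k (x.1 1)) * (x.1 1)⁻¹ ^ 2) a b : ℝ) : ℂ) := by
    have r1 : evalAt x hU.calculus.r = ((x.1 1 : ℝ) : ℂ) := rfl
    have r2 : evalAt x hU.calculus.ρ = (((x.1 1)⁻¹ : ℝ) : ℂ) := rfl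
    have r3 : evalAt x hU.calculus.N = ((lapse M k (x.1 1) : ℝ) : ℂ) := rfl
    have r4 : evalAt x hU.calculus.M = (M : ℂ) := rfl
    have r5 : evalAt x hU.calculus.K = (k : ℂ) ^ 2 := rfl
    have r6 : evalAt x 2 = 2 := map_ofNat _ 2
    fin_cases a <;> fin_cases b <;>
      simp [CoordCalculus.sec, secMat, CoordCalculus.N', r1, r2, r3, r4, r5, r6]
  rw [← evalAt_apply, hU.calculus.curv_eq, map_mul, map_sub, apply_ite (evalAt x),
    apply_ite (evalAt x), map_zero, h2, h2, h3] at h1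
  apply Complex.ofReal_injective
  rw [h1]
  simp only [Complex.ofReal_mul, Complex.ofReal_sub, apply_ite Complex.ofReal, Complex.ofReal_zero]

/-- The linearised Weyl scalars in terms of the frame components of the linearised curvature. -/
theorem hasLinWeylScalar {h : Tensor2} {hc : Fin 4 → Fin 4 → smoothAlg U}
    (hh : ∀ i j, IsRe (fun x => h x i j) (hc i j)) (hs : ∀ i j, hc i j = hc j i) (x : U)
    {i i' j : Fin 4} {eB : Fin 4 → ℝ} {mB : Fin 4 → ℂ} {l : ℝ}
    (hm : ∀ a, mB a = evalAt x (hU.calculus.frame i a))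
    (hm' : ∀ a, starRingEnd ℂ (mB a) = evalAt x (hU.calculus.frame i' a))
    (he : ∀ a, (eB a : ℂ) = l * evalAt x (hU.calculus.frame j a))
    (he2 : eB 2 = 0) (he3 : eB 3 = 0) (hm0 : mB 0 = 0) (hm1 : mB 1 = 0)
    (hee : metricDiag M k x 0 * eB 0 ^ 2 + metricDiag M k x 1 * eB 1 ^ 2 = 0)
    (hmm : metricDiag M k x 2 * mB 2 ^ 2 + metricDiag M k x 3 * mB 3 ^ 2 = 0) :
    HasLinWeylScalar M k h x eB mB (((x.1 1 * lapse M k (x.1 1) : ℝ) : ℂ) * (l ^ 2 * (1 / 4) *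
      (evalAt x (hU.calculus.null.linRiem (hU.calculus.toFrame hc) i j i j) +
        starRingEnd ℂ
          (evalAt x (hU.calculus.null.linRiem (hU.calculus.toFrame hc) i' j i' j))))) := by
  intro e m hde hdm he0 hm00
  have hr := (hU.r_pos x x.2).ne'
  have h0 : Del M k (x.1 1) / x.1 1 = x.1 1 * lapse M k (x.1 1) := by
    rw [Del_eq M k hr]
    field_simp
  rw [h0]
  refine HasDerivAt.const_mul _ ?_
  have hdet := (hU.smoothPair hh).det_ne x x.2
  have h1 := SAdS.hasDerivAt_weylEval (fun a b c k => hU.hasDerivAt_riemannUp hh hs a b c k x) hdet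
    (metric_eq x.1) (hU.riemannUp_metric x) (e := fun ε a => (e ε a : ℂ)) (m := m)
    (fun i => differentiableAt_ofReal_comp (differentiableAt_pi.mp hde i))
    (fun i => differentiableAt_pi.mp hdm i) (by rw [he0, he2, Complex.ofReal_zero])
    (by rw [he0, he3, Complex.ofReal_zero]) (by rw [hm00, hm0]) (by rw [hm00, hm1])
    (by rw [he0]; exact_mod_cast hee) (by rw [hm00]; exact hmm)
  refine h1.congr_deriv ?_
  rw [he0, hm00]
  change ∑ f, (metricDiag M k x f : ℂ) * mB f * _ = _
  rw [← hU.calculus.evFour_met_linCurv, ← hU.calculus.evFour_met_linCurv]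
  have key : ∀ (v : Fin 4 → ℂ) (i : Fin 4), (∀ a, v a = evalAt x (hU.calculus.frame i a)) →
      (l : ℂ) ^ 2 * evalAt x (evFour (fun a b c e => ∑ f, hU.calculus.met a f *
        linCurv hU.calculus.d hU.calculus.chr (hU.calculus.linChr hc) f b c e)
        (hU.calculus.frame i) (hU.calculus.frame j) (hU.calculus.frame i) (hU.calculus.frame j)) =
      ∑ f, (metricDiag M k x f : ℂ) * v f * ∑ b, ∑ c, ∑ k,
        evalAt x (linCurv smoothPd hU.calculus.chr (hU.calculus.linChr hc) f b c k) *
          (eB b * v c * eB k) := by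
    intro v i hv
    have h2 : ∀ a b c e, ∑ f, hU.calculus.met a f *
        linCurv hU.calculus.d hU.calculus.chr (hU.calculus.linChr hc) f b c e =
        hU.calculus.met a a *
          linCurv hU.calculus.d hU.calculus.chr (hU.calculus.linChr hc) a b c e := fun a b c e =>
      Finset.sum_eq_single a (fun f _ hf => by rw [met_of_ne _ hf.symm, zero_mul]) (by simp)
    have h3 : ∀ a, evalAt x (hU.calculus.met a a) = (metricDiag M k x a : ℂ) := fun a =>
      (hU.isRep_metricDiag a x).symm
    have h4 : hU.calculus.d = smoothPd := rfl
    simp only [h2]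
    simp only [h4, evFour, evThree, evTwo, evOne, map_sum, map_mul, h3, ← hv, he,
      Finset.mul_sum]
    refine Finset.sum_congr rfl fun f _ => Finset.sum_congr rfl fun b _ =>
      Finset.sum_congr rfl fun c _ => Finset.sum_congr rfl fun e _ => ?_
    ring
  -- The real part is half of z + z̄. The conjugate half, evaluated on 𝔪, is the conjugate of the
  -- complex curvature evaluated on the conjugate vector, which is frame vector i'. With `linRiem`
  -- twice the curvature this gives the factor 1/4.
  have k1 := key mB i hm
  have k2 := congrArg (starRingEnd ℂ) (key (fun a => starRingEnd ℂ (mB a)) i' hm')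
  simp only [map_mul, map_pow, map_sum, Complex.conj_ofReal, Complex.conj_conj] at k2
  rw [mul_right_comm, mul_comm, mul_add, k1, k2, ← Finset.sum_add_distrib, Finset.mul_sum]
  refine Finset.sum_congr rfl fun f _ => ?_
  rw [← mul_add, mul_left_comm]
  congr 1
  simp only [← Finset.sum_add_distrib, Finset.mul_sum]
  refine Finset.sum_congr rfl fun b _ => Finset.sum_congr rfl fun c _ =>
    Finset.sum_congr rfl fun k _ => ?_
  rw [← add_mul, Complex.add_conj, evalAt_apply]
  push_cast
  ring

end ExteriorChart

end SAdS

/-! ### The Teukolsky quantities of the perturbation -/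

namespace SAdS

open TopologicalSpace

namespace CoordCalculus

variable {A : Type*} [CommRing A] [Algebra ℂ A] (Q : CoordCalculus A)

/-- The second-order radial operator on c completes the two derivatives already in c to a fourth
power of r²D, the operator representing w⁻¹L. -/
theorem linRiem_hertzFr_qDqD (u : A) : Q.null.linRiem (Q.null.hertzFr (Q.r ^ 5 * u)) 3 0 3 0 =
    16 * Q.ρ ^ 5 * (Q.r ^ 2 * Q.null.D (Q.r ^ 2 * Q.null.D (Q.r ^ 2 * Q.null.D
      (Q.r ^ 2 * Q.null.D u)))) := by
  have h1 : Q.null.hertzC (Q.r ^ 5 * u) =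
      -4 * (2 * Q.r ^ 2 * (Q.r ^ 2 * Q.null.D u) + Q.r ^ 3 * Q.null.D (Q.r ^ 2 * Q.null.D u)) := by
    rw [hertzC_eq]
    generalize Q.r ^ 2 * Q.null.D u = v
    simp [Derivation.leibniz, Derivation.leibniz_pow, null_D_r]
    linear_combination (4 * Q.r ^ 3 * Q.null.D v + 8 * Q.r ^ 2 * v) * Q.r_ρ
  rw [NullCalculus.hertzFr, NullCalculus.linRiem_qDqD, h1]
  have hρ : Q.null.ρ = Q.ρ := rfl
  generalize Q.r ^ 2 * Q.null.D u = v
  simp [Derivation.leibniz, Derivation.leibniz_pow, null_D_r, hρ]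
  have := Q.r_ρ
  grind

theorem linRiem_hertzFr_mnmn (u : A) : Q.null.linRiem (Q.null.hertzFr (Q.r ^ 5 * u)) 2 1 2 1 =
    16 * Q.ρ * Q.null.up (-1) (Q.null.up 0 (Q.null.up 1 (Q.null.up 2 u))) := by
  have h1 : Q.null.hertzB (Q.r ^ 5 * u) = -16 * Q.r * Q.null.up 1 (Q.null.up 2 u) := by
    rw [hertzB_eq]
    simp [NullCalculus.up, Derivation.leibniz, null_δ_r]
    ring
  rw [NullCalculus.hertzFr, NullCalculus.linRiem_mnmn, h1]
  have hρ : Q.null.ρ = Q.ρ := rfl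
  generalize Q.null.up 1 (Q.null.up 2 u) = v
  simp [NullCalculus.up, Derivation.leibniz, null_δ_r, hρ]
  have := Q.r_ρ
  grind

theorem linRiem_hertzFr_qnqn {u : A} (h : Q.null.teuk (Q.r ^ 5 * u) = 0) :
    Q.null.linRiem (Q.null.hertzFr (Q.r ^ 5 * u)) 3 1 3 1 = -192 * Q.ρ * Q.M * Q.d 0 u := by
  rw [Q.null.linRiem_hertzFr_qnqn h]
  have h1 : Q.null.T (Q.r ^ 5 * u) = Q.r ^ 5 * Q.d 0 u := by
    change Q.d 0 _ = _
    simp [Derivation.leibniz, Derivation.leibniz_pow, Q.d_r]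
  rw [h1]
  change -192 * Q.ρ ^ 6 * Q.M * _ = _
  linear_combination -192 * Q.ρ * Q.M * Q.d 0 u * Q.ρ_pow_mul_r_pow 5

end CoordCalculus

theorem pd_conj (a : Fin 4) (f : Coord → ℂ) (x : Coord) :
    pd a (fun y => starRingEnd ℂ (f y)) x = starRingEnd ℂ (pd a f x) := by
  have h1 : (fun y => starRingEnd ℂ (f y)) = Complex.conjCLE ∘ f := rfl
  rw [pd, h1, ContinuousLinearEquiv.comp_fderiv]
  rfl

theorem wL_conj (M k : ℝ) (f : Coord → ℂ) :
    wL M k (fun y => starRingEnd ℂ (f y)) = fun y => starRingEnd ℂ (wL M k f y) := by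
  funext x
  simp only [wL, L, pd_conj, map_mul, map_add, Complex.conj_ofReal]

/-- Only the sign of i/sin ϑ changes under conjugation. The daggered operators and α̃_G* in the
result both stem from the conjugate half of the real part. -/
theorem angLdag_conj (n : ℤ) (f : Coord → ℂ) :
    angLdag n (fun y => starRingEnd ℂ (f y)) = fun y => starRingEnd ℂ (angL n f y) := by
  funext x
  simp only [angLdag, angL, pd_conj, map_mul, map_add, map_div₀, Complex.conj_ofReal,
    Complex.conj_I, map_intCast]
  ring

variable {M k : ℝ} {U : Opens Coord}

namespace ExteriorChart

variable (hU : ExteriorChart M k U)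

theorem evalAt_frame (x : U) (i a : Fin 4) : evalAt x (hU.calculus.frame i a) =
    (![![((lapse M k (x.1 1))⁻¹ : ℂ), 1, 0, 0], ![1, -(lapse M k (x.1 1) : ℂ), 0, 0],
      ![0, 0, (x.1 1 : ℂ)⁻¹, Complex.I * ((x.1 1 : ℂ)⁻¹ * (Real.sin (x.1 2) : ℂ)⁻¹)],
      ![0, 0, (x.1 1 : ℂ)⁻¹, -(Complex.I * ((x.1 1 : ℂ)⁻¹ * (Real.sin (x.1 2) : ℂ)⁻¹))]] :
        Fin 4 → Fin 4 → ℂ) i a := by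
  have r1 : evalAt x hU.calculus.ρ = (((x.1 1)⁻¹ : ℝ) : ℂ) := rfl
  have r2 : evalAt x hU.calculus.σ = (((Real.sin (x.1 2))⁻¹ : ℝ) : ℂ) := rfl
  have r3 : evalAt x hU.calculus.N = ((lapse M k (x.1 1) : ℝ) : ℂ) := rfl
  have r4 : evalAt x hU.calculus.ν = (((lapse M k (x.1 1))⁻¹ : ℝ) : ℂ) := rfl
  have r5 : evalAt x hU.calculus.I = Complex.I := rfl
  fin_cases i <;> fin_cases a <;> simp [CoordCalculus.frame, r1, r2, r3, r4, r5]

theorem hertzCoord_symm (u : smoothAlg U) (i j : Fin 4) :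
    hU.hertzCoord u i j = hU.hertzCoord u j i :=
  hU.calculus.gauge_symm _ _ _ i j

theorem metricDiag_mVec (hU : ExteriorChart M k U) (x : U) :
    (metricDiag M k x 2 : ℂ) * mVec x 2 ^ 2 + metricDiag M k x 3 * mVec x 3 ^ 2 = 0 := by
  have h1 : (x.1 1 : ℂ) ≠ 0 := by exact_mod_cast (hU.r_pos x x.2).ne'
  have h2 : Complex.sin (x.1 2 : ℂ) ≠ 0 := by exact_mod_cast (hU.sin_pos x x.2).ne'
  simp [metricDiag, mVec]
  field_simp
  simp

/-- Here e₄ = √N D, the (𝔪, D) component vanishes, and the constant is rN · N/4 · 16ρ⁵ = 4w². -/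
theorem hasTeukolskyPlus (hU : ExteriorChart M k U) {f : Coord → ℂ} {u : smoothAlg U}
    (h : IsRep f u) (x : U) :
    HasTeukolskyPlus M k (hertz M k f) x (4 * ((w M k (x.1 1) ^ 2 : ℝ) *
      wL M k (wL M k (wL M k (wL M k (fun y => starRingEnd ℂ (f y))))) x)) := by
  have hN := hU.lapse_pos x x.2
  have hr := (hU.r_pos x x.2).ne'
  have hs := (hU.sin_pos x x.2).ne'
  have hl : Real.sqrt (lapse M k (x.1 1)) ≠ 0 := (Real.sqrt_pos.mpr hN).ne'
  have hl2 : Real.sqrt (lapse M k (x.1 1)) ^ 2 = lapse M k (x.1 1) := Real.sq_sqrt hN.le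
  have hw := hU.isRep_wL (hU.isRep_wL (hU.isRep_wL (hU.isRep_wL h)))
  have key := hU.hasLinWeylScalar (hU.isRe_hertz h) (hU.hertzCoord_symm u) x (i := 2) (i' := 3)
    (j := 0) (eB := e4 M k x) (mB := mVec x) (l := Real.sqrt (lapse M k (x.1 1)))
    (fun a => by rw [evalAt_frame]; fin_cases a <;> simp [mVec]; ring)
    (fun a => by rw [evalAt_frame]; fin_cases a <;> simp [mVec, ← Complex.sin_conj]; ring)
    (fun a => by
      rw [evalAt_frame, e4, Del_div hU x.2]
      fin_cases a <;> simp
      -- The first two occurrences of the lapse stand under roots; the bare third one is written as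
      -- a squared root so that the roots cancel.
      nth_rewrite 3 [← hl2]
      push_cast
      field_simp)
    rfl rfl rfl rfl
    (by
      rw [e4, Del_div hU x.2]
      simp [metricDiag, hl2]
      field_simp
      simp)
    (hU.metricDiag_mVec x)
  rw [HasTeukolskyPlus]
  convert key using 1
  rw [wL_conj, wL_conj, wL_conj, wL_conj, toFrame_hertzCoord, CoordCalculus.linRiem_hertzFr_qDqD,
    NullCalculus.hertzFr, NullCalculus.linRiem_mDmD, map_zero, zero_add]
  beta_reduce
  rw [hw.apply x, ← evalAt_apply, hU.w_eq x.2]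
  have r1 : evalAt x hU.calculus.ρ = (((x.1 1)⁻¹ : ℝ) : ℂ) := rfl
  have r2 : evalAt x 16 = 16 := map_ofNat _ 16
  simp only [map_mul, map_pow, r1, r2, Complex.conj_ofReal, map_ofNat]
  have hlc : ((Real.sqrt (lapse M k (x.1 1)) : ℝ) : ℂ) ^ 2 = (lapse M k (x.1 1) : ℂ) := by
    exact_mod_cast hl2
  rw [hlc]
  have hr' : (x.1 1 : ℂ) ≠ 0 := by exact_mod_cast hr
  push_cast
  field_simp
  ring

/-- Here e₃ = L̲/√N, so the prefactor is r/4. The components 16ρ 𝓛₋₁𝓛₀𝓛₁𝓛₂ u, conjugated, and -192ρM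
∂_t u give the coefficients 4 and -48M. -/
theorem hasTeukolskyMinus (hU : ExteriorChart M k U) {f : Coord → ℂ} {u : smoothAlg U}
    (h : IsRep f u) (hF : ∀ x ∈ U, teukolskyMinusTwo M k f x = 0) (x : U) :
    HasTeukolskyMinus M k (hertz M k f) x
      (4 * (angLdag (-1) (angLdag 0 (angLdag 1 (angLdag 2 (fun y => starRingEnd ℂ (f y))))) x
          - 12 * M * pd 0 f x)) := by
  have hN := hU.lapse_pos x x.2
  have hr := (hU.r_pos x x.2).ne'
  have hl : Real.sqrt (lapse M k (x.1 1)) ≠ 0 := (Real.sqrt_pos.mpr hN).ne'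
  have hl2 : Real.sqrt (lapse M k (x.1 1)) ^ 2 = lapse M k (x.1 1) := Real.sq_sqrt hN.le
  have ha := hU.isRep_angL (-1) (hU.isRep_angL 0 (hU.isRep_angL 1 (hU.isRep_angL 2 h)))
  have key := hU.hasLinWeylScalar (hU.isRe_hertz h) (hU.hertzCoord_symm u) x (i := 3) (i' := 2)
    (j := 1) (eB := e3 M k x) (mB := mVecBar x) (l := (Real.sqrt (lapse M k (x.1 1)))⁻¹)
    (fun a => by rw [evalAt_frame]; fin_cases a <;> simp [mVec, mVecBar, ← Complex.sin_conj]; ring)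
    (fun a => by rw [evalAt_frame]; fin_cases a <;> simp [mVec, mVecBar, ← Complex.sin_conj]; ring)
    (fun a => by
      rw [evalAt_frame, e3, Del_div hU x.2]
      fin_cases a <;> simp
      nth_rewrite 3 [← hl2]
      push_cast
      field_simp)
    rfl rfl (by simp [mVecBar, mVec]) (by simp [mVecBar, mVec])
    (by
      rw [e3, Del_div hU x.2]
      simp [metricDiag, hl2]
      field_simp
      simp)
    (by simpa [mVecBar] using congrArg (starRingEnd ℂ) (hU.metricDiag_mVec x))
  rw [HasTeukolskyMinus]
  convert key using 1
  rw [angLdag_conj, angLdag_conj, angLdag_conj, angLdag_conj, toFrame_hertzCoord,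
    CoordCalculus.linRiem_hertzFr_qnqn _ (hU.teuk_eq_zero h hF),
    CoordCalculus.linRiem_hertzFr_mnmn]
  beta_reduce
  rw [ha.apply x, (h.pd 0).apply x, ← evalAt_apply, ← evalAt_apply]
  have r1 : evalAt x hU.calculus.ρ = (((x.1 1)⁻¹ : ℝ) : ℂ) := rfl
  have r2 : evalAt x 16 = 16 := map_ofNat _ 16
  have r3 : evalAt x (-192) = -192 := by rw [map_neg, map_ofNat]
  have r4 : evalAt x hU.calculus.M = (M : ℂ) := rfl
  have r5 : hU.calculus.d 0 u = smoothPd 0 u := rfl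
  simp only [map_mul, r1, r2, r3, r4, r5, Complex.conj_ofReal, map_ofNat]
  have hlc : ((((Real.sqrt (lapse M k (x.1 1)))⁻¹ : ℝ) : ℂ)) ^ 2 = (lapse M k (x.1 1) : ℂ)⁻¹ := by
    push_cast
    rw [inv_pow]
    congr 1
    exact_mod_cast hl2
  rw [hlc]
  have hr' : (x.1 1 : ℂ) ≠ 0 := by exact_mod_cast hr
  have hN' : (lapse M k (x.1 1) : ℂ) ≠ 0 := by exact_mod_cast hN.ne'
  push_cast
  field_simp
  ring

end ExteriorChart

end SAdS

/-! ### Spherical versus Cartesian coordinates, and the frame of the sphere -/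

namespace SAdS

open TopologicalSpace

section Spherical

/-- The Jacobian of spherical coordinates. -/
noncomputable def sphJac (x : Coord) : Fin 4 → Fin 4 → ℝ :=
  ![![1, 0, 0, 0],
    ![0, Real.sin (x 2) * Real.cos (x 3), Real.sin (x 2) * Real.sin (x 3), Real.cos (x 2)],
    ![0, x 1 * (Real.cos (x 2) * Real.cos (x 3)), x 1 * (Real.cos (x 2) * Real.sin (x 3)),
      x 1 * -Real.sin (x 2)],
    ![0, x 1 * Real.sin (x 2) * -Real.sin (x 3), x 1 * Real.sin (x 2) * Real.cos (x 3), 0]]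

theorem pd_sph (x : Coord) (a i : Fin 4) : pd a (fun y => sph y i) x = sphJac x a i := by
  have h0 : pd a (fun y : Coord => y 0) x = if a = 0 then 1 else 0 :=
    pd_coord a 0 (hasDerivAt_id (x 0))
  have h1 : pd a (fun y : Coord => y 1) x = if a = 1 then 1 else 0 :=
    pd_coord a 1 (hasDerivAt_id (x 1))
  have hs2 := pd_coord a 2 (Real.hasDerivAt_sin (x 2))
  have hc2 := pd_coord a 2 (Real.hasDerivAt_cos (x 2))
  have hs3 := pd_coord a 3 (Real.hasDerivAt_sin (x 3))
  have hc3 := pd_coord a 3 (Real.hasDerivAt_cos (x 3))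
  fin_cases i
  · change pd a (fun y : Coord => y 0) x = _
    rw [h0]
    fin_cases a <;> simp [sphJac]
  · change pd a (fun y : Coord => y 1 * Real.sin (y 2) * Real.cos (y 3)) x = _
    rw [pd_mul a (by fun_prop) (by fun_prop), pd_mul a (by fun_prop) (by fun_prop), h1, hs2, hc3]
    fin_cases a <;> simp [sphJac] <;> ring
  · change pd a (fun y : Coord => y 1 * Real.sin (y 2) * Real.sin (y 3)) x = _
    rw [pd_mul a (by fun_prop) (by fun_prop), pd_mul a (by fun_prop) (by fun_prop), h1, hs2, hs3]
    fin_cases a <;> simp [sphJac] <;> ring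
  · change pd a (fun y : Coord => y 1 * Real.cos (y 2)) x = _
    rw [pd_mul a (by fun_prop) (by fun_prop), h1, hc2]
    fin_cases a <;> simp [sphJac]

theorem contDiff_sph : ContDiff ℝ ∞ sph := by
  have hs := fun i => Real.contDiff_sin.comp (contDiff_coord i)
  have hc := fun i => Real.contDiff_cos.comp (contDiff_coord i)
  rw [contDiff_pi]
  intro i
  fin_cases i
  · exact contDiff_coord 0
  · exact ((contDiff_coord 1).mul (hs 2)).mul (hc 3)
  · exact ((contDiff_coord 1).mul (hs 2)).mul (hs 3)
  · exact (contDiff_coord 1).mul (hc 2)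

theorem pd_comp_sph {F : Coord → ℝ} {x : Coord} (hF : DifferentiableAt ℝ F (sph x)) (a : Fin 4) :
    pd a (fun y => F (sph y)) x = ∑ i, sphJac x a i * pd i F (sph x) := by
  have h1 : HasFDerivAt sph (fderiv ℝ sph x) x :=
    (contDiff_sph.differentiable (by simp)).differentiableAt.hasFDerivAt
  have h2 : HasFDerivAt (fun y => F (sph y)) _ x := hF.hasFDerivAt.comp x h1
  have h3 : ∀ i, fderiv ℝ sph x (Pi.single a 1) i = sphJac x a i := fun i => by
    rw [← pd_sph]
    have : HasFDerivAt (fun y => sph y i) _ x := (hasFDerivAt_pi'.mp h1) i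
    rw [pd, this.fderiv]
    rfl
  rw [pd, h2.fderiv, ContinuousLinearMap.comp_apply]
  have h4 : fderiv ℝ sph x (Pi.single a 1) = ∑ i, sphJac x a i • (Pi.single i 1 : Coord) := by
    funext j
    rw [h3]
    simp [Pi.single_apply]
  rw [h4, map_sum]
  simp [pd]

theorem spaceNorm_sph {x : Coord} (hx : 0 < x 1) : spaceNorm (sph x) = x 1 := by
  rw [spaceNorm]
  have : sph x 1 ^ 2 + sph x 2 ^ 2 + sph x 3 ^ 2 = x 1 ^ 2 := by
    have h1 := Real.sin_sq_add_cos_sq (x 2)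
    have h2 := Real.sin_sq_add_cos_sq (x 3)
    simp only [sph, Matrix.cons_val]
    linear_combination x 1 ^ 2 * Real.sin (x 2) ^ 2 * h2 + x 1 ^ 2 * h1
  rw [this, Real.sqrt_sq hx.le]

end Spherical

/-- The unit vectors along ϑ, φ and r form an orthonormal basis. It is stated over a commutative
ring to serve both the smooth algebra and real numbers at a point. -/
theorem sphericalFrame_completeness {A : Type*} [CommRing A] {s c p q : A} (h1 : s ^ 2 + c ^ 2 = 1)
    (h2 : q ^ 2 + p ^ 2 = 1) (i j : Fin 3) :
    (![c * p, c * q, -s] : Fin 3 → A) i * (![c * p, c * q, -s] : Fin 3 → A) j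
      + (![-q, p, 0] : Fin 3 → A) i * (![-q, p, 0] : Fin 3 → A) j
      + (![s * p, s * q, c] : Fin 3 → A) i * (![s * p, s * q, c] : Fin 3 → A) j =
      if i = j then 1 else 0 := by
  fin_cases i <;> fin_cases j <;> simp <;> grind

variable {M k : ℝ} {U : Opens Coord} {D : Set Coord}

/-- An open subset of the exterior, in Cartesian coordinates. -/
structure CartesianDomain (M k : ℝ) (D : Set Coord) : Prop where
  isOpen : IsOpen D
  norm_pos : ∀ p ∈ D, 0 < spaceNorm p
  lapse_pos : ∀ p ∈ D, 0 < lapse M k (spaceNorm p)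

theorem CartesianDomain.contDiffOn_spaceNorm (hD : CartesianDomain M k D) :
    ContDiffOn ℝ ∞ spaceNorm D := by
  refine ContDiffOn.sqrt (((((contDiff_coord 1).pow 2).add ((contDiff_coord 2).pow 2)).add
    ((contDiff_coord 3).pow 2)).contDiffOn) fun p hp => ?_
  exact (Real.sqrt_pos.mp (hD.norm_pos p hp)).ne'

theorem CartesianDomain.contDiffOn_inv_spaceNorm (hD : CartesianDomain M k D) :
    ContDiffOn ℝ ∞ (fun p => (spaceNorm p)⁻¹) D :=
  hD.contDiffOn_spaceNorm.inv fun p hp => (hD.norm_pos p hp).ne'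

theorem CartesianDomain.contDiffOn_inv_lapse (hD : CartesianDomain M k D) :
    ContDiffOn ℝ ∞ (fun p => (lapse M k (spaceNorm p))⁻¹) D := by
  refine ContDiffOn.inv ?_ fun p hp => (hD.lapse_pos p hp).ne'
  simp only [lapse, div_eq_mul_inv]
  exact (contDiffOn_const.add (contDiffOn_const.mul (hD.contDiffOn_spaceNorm.pow 2))).sub
    (contDiffOn_const.mul hD.contDiffOn_inv_spaceNorm)

/-- The function on `U` induced by a smooth function on `D`. -/
noncomputable def pull (hUD : ∀ x ∈ U, sph x ∈ D) (F : Coord → ℝ) (hF : ContDiffOn ℝ ∞ F D) :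
    smoothAlg U :=
  mkReal (fun x => F (sph x)) (hF.comp contDiff_sph.contDiffOn hUD)

theorem isRep_pull (hUD : ∀ x ∈ U, sph x ∈ D) {F : Coord → ℝ} (hF : ContDiffOn ℝ ∞ F D) :
    IsRep (fun x => (F (sph x) : ℂ)) (pull hUD F hF) := fun _ => rfl

theorem isRep_smoothPd_pull (hD : IsOpen D) (hUD : ∀ x ∈ U, sph x ∈ D) {F : Coord → ℝ}
    (hF : ContDiffOn ℝ ∞ F D) (a : Fin 4) :
    IsRep (fun x => ∑ i, (sphJac x a i : ℂ) * ((pd i F (sph x) : ℝ) : ℂ))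
      (smoothPd a (pull hUD F hF)) :=
  ((isRep_pull hUD hF).pd_ofReal a).congr fun x hx => by
    rw [pd_comp_sph (ContDiffOn.differentiableAt_of_isOpen hD hF (hUD x hx))]
    simp

namespace ExteriorChart

variable (hU : ExteriorChart M k U)

/-- `cos φ`. -/
noncomputable def cosφ : smoothAlg U :=
  mkReal (fun x => Real.cos (x 3)) (Real.contDiff_cos.comp (contDiff_coord 3)).contDiffOn

/-- `sin φ`. -/
noncomputable def sinφ : smoothAlg U :=
  mkReal (fun x => Real.sin (x 3)) (Real.contDiff_sin.comp (contDiff_coord 3)).contDiffOn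

theorem isRep_cosφ : IsRep (fun x => ((Real.cos (x 3) : ℝ) : ℂ)) (cosφ (U := U)) := fun _ => rfl
theorem isRep_sinφ : IsRep (fun x => ((Real.sin (x 3) : ℝ) : ℂ)) (sinφ (U := U)) := fun _ => rfl

theorem d_sinφ (i : Fin 4) : smoothPd i (sinφ (U := U)) = ![0, 0, 0, cosφ] i :=
  Subtype.ext (funext fun x => by
    rw [← isRep_sinφ.pd_ofReal i x]
    change ((pd i (fun y => Real.sin (y 3)) x.1 : ℝ) : ℂ) = _
    rw [pd_coord i 3 (Real.hasDerivAt_sin _)]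
    fin_cases i <;> simp [cosφ, mkReal, mkSmooth])

theorem d_cosφ (i : Fin 4) : smoothPd i (cosφ (U := U)) = ![0, 0, 0, -sinφ] i :=
  Subtype.ext (funext fun x => by
    rw [← isRep_cosφ.pd_ofReal i x]
    change ((pd i (fun y => Real.cos (y 3)) x.1 : ℝ) : ℂ) = _
    rw [pd_coord i 3 (Real.hasDerivAt_cos _)]
    fin_cases i <;> simp [sinφ, mkReal, mkSmooth])

theorem sinφ_sq_add : (sinφ : smoothAlg U) ^ 2 + cosφ ^ 2 = 1 :=
  Subtype.ext (funext fun x => by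
    change ((Real.sin (x.1 3) : ℝ) : ℂ) ^ 2 + ((Real.cos (x.1 3) : ℝ) : ℂ) ^ 2 = 1
    exact_mod_cast Real.sin_sq_add_cos_sq (x.1 3))

/-- The radial unit vector. -/
noncomputable def om : Fin 3 → smoothAlg U :=
  ![hU.calculus.s * cosφ, hU.calculus.s * sinφ, hU.calculus.c]

/-- The unit vector along `∂_ϑ`. -/
noncomputable def th : Fin 3 → smoothAlg U :=
  ![hU.calculus.c * cosφ, hU.calculus.c * sinφ, -hU.calculus.s]

/-- The unit vector along `∂_φ`. -/
noncomputable def ph : Fin 3 → smoothAlg U := ![-sinφ, cosφ, 0]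

/-- The vector `𝔪*`, scaled by `r`. -/
noncomputable def mb (i : Fin 3) : smoothAlg U := hU.th i - hU.calculus.I * ph i

/-- The vector `𝔪`, scaled by `r`. -/
noncomputable def mm (i : Fin 3) : smoothAlg U := hU.th i + hU.calculus.I * ph i

theorem completeness (i j : Fin 3) :
    hU.th i * hU.th j + ph i * ph j + hU.om i * hU.om j = if i = j then 1 else 0 :=
  sphericalFrame_completeness hU.calculus.s_c sinφ_sq_add i j

theorem isRep_mb (i : Fin 3) : IsRep (fun x => mBarSpace x i) (hU.mb i) := fun x => by
  have e1 : evalAt x hU.calculus.s = ((Real.sin (x.1 2) : ℝ) : ℂ) := rfl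
  have e2 : evalAt x hU.calculus.c = ((Real.cos (x.1 2) : ℝ) : ℂ) := rfl
  have e3 : evalAt x cosφ = ((Real.cos (x.1 3) : ℝ) : ℂ) := rfl
  have e4 : evalAt x sinφ = ((Real.sin (x.1 3) : ℝ) : ℂ) := rfl
  have e5 : evalAt x hU.calculus.I = Complex.I := rfl
  change mBarSpace x.1 i = evalAt x (hU.mb i)
  fin_cases i <;> simp [mb, th, ph, mBarSpace, e1, e2, e3, e4, e5]

theorem d_zero_mb (i : Fin 3) : hU.calculus.d 0 (hU.mb i) = 0 := by
  have hd : hU.calculus.d = smoothPd := rfl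
  have hs := hU.calculus.d_s 0
  have hc := hU.calculus.d_c 0
  have hi := hU.calculus.d_I 0
  rw [hd] at *
  fin_cases i <;> simp [mb, th, ph, Derivation.leibniz, d_cosφ, d_sinφ, hs, hc, hi]

theorem d_one_mb (i : Fin 3) : hU.calculus.d 1 (hU.mb i) = 0 := by
  have hd : hU.calculus.d = smoothPd := rfl
  have hs := hU.calculus.d_s 1
  have hc := hU.calculus.d_c 1
  have hi := hU.calculus.d_I 1
  rw [hd] at *
  fin_cases i <;> simp [mb, th, ph, Derivation.leibniz, d_cosφ, d_sinφ, hs, hc, hi]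

theorem d_two_mb (i : Fin 3) : hU.calculus.d 2 (hU.mb i) = -hU.om i := by
  have hd : hU.calculus.d = smoothPd := rfl
  have hs := hU.calculus.d_s 2
  have hc := hU.calculus.d_c 2
  have hi := hU.calculus.d_I 2
  rw [hd] at *
  fin_cases i <;> simp [mb, th, ph, om, Derivation.leibniz, d_cosφ, d_sinφ, hs, hc, hi] <;> ring

theorem d_three_mb (i : Fin 3) : hU.calculus.d 3 (hU.mb i) =
    hU.calculus.I * (hU.calculus.c * hU.mb i + hU.calculus.s * hU.om i) := by
  have hd : hU.calculus.d = smoothPd := rfl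
  have hs := hU.calculus.d_s 3
  have hc := hU.calculus.d_c 3
  have hi := hU.calculus.d_I 3
  have h1 := hU.calculus.I_sq
  have h2 := hU.calculus.s_c
  rw [hd] at *
  fin_cases i <;> simp [mb, th, ph, om, Derivation.leibniz, d_cosφ, d_sinφ, hs, hc, hi]
  · linear_combination -hU.calculus.c * sinφ * h1 - hU.calculus.I * cosφ * h2
  · linear_combination hU.calculus.c * cosφ * h1 - hU.calculus.I * sinφ * h2
  · ring

end ExteriorChart

end SAdS

/-! ### Tangential vector and tensor fields in Cartesian components -/

namespace SAdS

open TopologicalSpace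

section Algebra

variable {A : Type*} [CommRing A] [Algebra ℂ A]

/-- The `ð`-derivative of a traceless tangential tensor is its divergence. -/
theorem sum_mm_mb_mb {a : Fin 3 → Fin 3 → Fin 3 → A} {m n o : Fin 3 → A}
    (hδ : ∀ k i, n k * m i + m k * n i + 2 * (o k * o i) = if k = i then 2 else 0)
    (hsym : ∀ k i j, a k i j = a k j i) (htr : ∀ k, ∑ i, a k i i = 0)
    (ho : ∀ k, ∑ i, ∑ j, a k i j * (o i * o j) = 0)
    (ho' : ∀ j, ∑ k, ∑ i, a k i j * (o k * o i) = 0) :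
    ∑ i, ∑ j, (∑ k, m k * a k i j) * (n i * n j) = 2 * ∑ j, (∑ i, a i i j) * n j := by
  -- The mixed contraction with m and n is half the trace minus the radial part, and both of these
  -- vanish.
  have h1 : ∀ k, ∑ i, ∑ j, a k i j * (m i * n j) = 0 := by
    intro k
    apply eq_zero_of_two_mul
    have e1 : ∑ i, ∑ j, a k i j * (n i * m j + m i * n j + 2 * (o i * o j)) =
        ∑ i, ∑ j, a k i j * (if i = j then 2 else 0) := by simp only [hδ]
    have e2 : ∑ i, ∑ j, a k i j * (n i * m j) = ∑ i, ∑ j, a k i j * (m i * n j) := by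
      rw [Finset.sum_comm]
      refine Finset.sum_congr rfl fun i _ => Finset.sum_congr rfl fun j _ => ?_
      rw [hsym]
      ring
    simp only [mul_add, Finset.sum_add_distrib, e2, mul_left_comm _ (2 : A), ← Finset.mul_sum,
      ho] at e1
    simp only [mul_ite, mul_zero, Finset.sum_ite_eq, Finset.mem_univ, if_true, ← Finset.sum_mul,
      htr] at e1
    linear_combination e1
  -- Completeness on the derivative index and the first tensor index trades m_k n_i for the
  -- divergence, minus n_k m_i. The latter drops out by the mixed contraction just computed.
  have e1 : ∑ j, n j * ∑ k, ∑ i, a k i j * (n k * m i + m k * n i + 2 * (o k * o i)) =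
      ∑ j, n j * ∑ k, ∑ i, a k i j * (if k = i then 2 else 0) := by simp only [hδ]
  have e2 : ∑ j, n j * ∑ k, ∑ i, a k i j * (n k * m i) =
      ∑ k, n k * ∑ i, ∑ j, a k i j * (m i * n j) := by
    simp only [Fin.sum_univ_three]
    ring
  simp only [mul_add, Finset.sum_add_distrib, e2, h1, mul_left_comm _ (2 : A), ← Finset.mul_sum,
    ho'] at e1
  simp only [mul_ite, mul_zero, Finset.sum_ite_eq, Finset.mem_univ, if_true, ← Finset.sum_mul,
    Finset.sum_const_zero, zero_add, add_zero] at e1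
  have e3 : ∑ i, ∑ j, (∑ k, m k * a k i j) * (n i * n j) =
      ∑ j, n j * ∑ k, ∑ i, a k i j * (m k * n i) := by
    simp only [Fin.sum_univ_three]
    ring
  rw [e3, e1, Finset.mul_sum]
  exact Finset.sum_congr rfl fun j _ => by ring

end Algebra

variable {M k : ℝ} {U : Opens Coord} {D : Set Coord}

/-- Differentiation of a pairing with the position vector. -/
theorem pd_sum_mul_position (hD : IsOpen D) {F : Fin 3 → Coord → ℝ}
    (hF : ∀ j, ContDiffOn ℝ ∞ (F j) D) (h0 : ∀ p ∈ D, ∑ j, F j p * p j.succ = 0) {p : Coord}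
    (hp : p ∈ D) (a : Fin 4) :
    ∑ j, pd a (F j) p * p j.succ + ∑ j : Fin 3, F j p * (if a = j.succ then 1 else 0) = 0 := by
  have h1 : pd a (fun q => ∑ j, F j q * q j.succ) p = 0 := by
    rw [pd_congr hD (g := fun _ => (0 : ℝ)) h0 a hp]
    simp [pd]
  have hd := fun j => ContDiffOn.differentiableAt_of_isOpen hD (hF j) hp
  have hx : ∀ j : Fin 4, DifferentiableAt ℝ (fun q : Coord => q j) p := fun j => by fun_prop
  simp only [Fin.sum_univ_three] at h1 ⊢
  rw [pd_add a (((hd 0).fun_mul (hx _)).fun_add ((hd 1).fun_mul (hx _))) ((hd 2).fun_mul (hx _)),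
    pd_add a ((hd 0).fun_mul (hx _)) ((hd 1).fun_mul (hx _)), pd_mul a (hd 0) (hx _),
    pd_mul a (hd 1) (hx _), pd_mul a (hd 2) (hx _)] at h1
  have h2 : ∀ j : Fin 4, pd a (fun q : Coord => q j) p = if a = j then 1 else 0 := fun j =>
    pd_coord a j (hasDerivAt_id (p j))
  simp only [h2] at h1
  linear_combination h1

/-- A smooth vector field tangent to the spheres. -/
structure SphereVector (D : Set Coord) where
  toFun : Fin 3 → Coord → ℝ
  smooth : ∀ j, ContDiffOn ℝ ∞ (toFun j) D
  tang : ∀ p ∈ D, ∑ j, toFun j p * p j.succ = 0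

/-- A smooth symmetric traceless 2-tensor field tangent to the spheres. -/
structure SphereTensor (D : Set Coord) where
  toFun : Fin 3 → Fin 3 → Coord → ℝ
  smooth : ∀ i j, ContDiffOn ℝ ∞ (toFun i j) D
  symm : ∀ p ∈ D, ∀ i j, toFun i j p = toFun j i p
  trace : ∀ p ∈ D, ∑ i, toFun i i p = 0
  tang : ∀ p ∈ D, ∀ i, ∑ j, toFun i j p * p j.succ = 0

namespace SphereVector

/-- Product with a function. -/
def smul (V : SphereVector D) (F : Coord → ℝ) (hF : ContDiffOn ℝ ∞ F D) : SphereVector D where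
  toFun j p := F p * V.toFun j p
  smooth j := hF.mul (V.smooth j)
  tang p hp := by simp only [mul_assoc, ← Finset.mul_sum, V.tang p hp, mul_zero]

theorem pd_tang (V : SphereVector D) (hD : IsOpen D) {p : Coord} (hp : p ∈ D) (a : Fin 3) :
    ∑ j, pd a.succ (V.toFun j) p * p j.succ = -V.toFun a p := by
  have := pd_sum_mul_position hD V.smooth V.tang hp a.succ
  simp at this
  linear_combination this

/-- The component of weight `-1`. -/
noncomputable def spin (V : SphereVector D) (hU : ExteriorChart M k U) (hUD : ∀ x ∈ U, sph x ∈ D) :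
    smoothAlg U :=
  ∑ j, pull hUD (V.toFun j) (V.smooth j) * hU.mb j

/-- The divergence. -/
noncomputable def div (V : SphereVector D) (p : Coord) : ℝ := ∑ j, pd j.succ (V.toFun j) p

end SphereVector

namespace SphereTensor

/-- Product with a function. -/
def smul (T : SphereTensor D) (F : Coord → ℝ) (hF : ContDiffOn ℝ ∞ F D) : SphereTensor D where
  toFun i j p := F p * T.toFun i j p
  smooth i j := hF.mul (T.smooth i j)
  symm p hp i j := by rw [T.symm p hp]
  trace p hp := by simp only [← Finset.mul_sum, T.trace p hp, mul_zero]
  tang p hp i := by simp only [mul_assoc, ← Finset.mul_sum, T.tang p hp, mul_zero]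

theorem pd_symm (T : SphereTensor D) (hD : IsOpen D) {p : Coord} (hp : p ∈ D) (a : Fin 4)
    (i j : Fin 3) : pd a (T.toFun i j) p = pd a (T.toFun j i) p :=
  pd_congr hD (fun q hq => T.symm q hq i j) a hp

theorem pd_trace (T : SphereTensor D) (hD : IsOpen D) {p : Coord} (hp : p ∈ D) (a : Fin 4) :
    ∑ i, pd a (T.toFun i i) p = 0 := by
  have h1 : pd a (fun q => ∑ i, T.toFun i i q) p = 0 := by
    rw [pd_congr hD (g := fun _ => (0 : ℝ)) T.trace a hp]
    simp [pd]
  have hd := fun j => ContDiffOn.differentiableAt_of_isOpen hD (T.smooth j j) hp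
  simp only [Fin.sum_univ_three] at h1 ⊢
  rwa [pd_add a ((hd 0).fun_add (hd 1)) (hd 2), pd_add a (hd 0) (hd 1)] at h1

theorem pd_zero_tang (T : SphereTensor D) (hD : IsOpen D) {p : Coord} (hp : p ∈ D) (i : Fin 3) :
    ∑ j, pd 0 (T.toFun i j) p * p j.succ = 0 := by
  have := pd_sum_mul_position hD (T.smooth i) (fun q hq => T.tang q hq i) hp 0
  simpa [Fin.succ_ne_zero, eq_comm] using this

theorem pd_tang (T : SphereTensor D) (hD : IsOpen D) {p : Coord} (hp : p ∈ D) (a i : Fin 3) :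
    ∑ j, pd a.succ (T.toFun i j) p * p j.succ = -T.toFun i a p := by
  have := pd_sum_mul_position hD (T.smooth i) (fun q hq => T.tang q hq i) hp a.succ
  simp at this
  linear_combination this

/-- The derivative `w⁻¹ L`. -/
noncomputable def wL (T : SphereTensor D) (hD : CartesianDomain M k D) : SphereTensor D where
  toFun i j p := spaceNorm p ^ 2 * ((lapse M k (spaceNorm p))⁻¹ * pd 0 (T.toFun i j) p
    + (spaceNorm p)⁻¹ * ∑ a : Fin 3, p a.succ * pd a.succ (T.toFun i j) p)
  smooth i j := (hD.contDiffOn_spaceNorm.pow 2).mul ((hD.contDiffOn_inv_lapse.mul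
    (ContDiffOn.pd hD.isOpen (T.smooth i j) 0)).add (hD.contDiffOn_inv_spaceNorm.mul
      (ContDiffOn.sum fun a _ => (contDiff_coord a.succ).contDiffOn.mul
        (ContDiffOn.pd hD.isOpen (T.smooth i j) a.succ))))
  symm p hp i j := by simp only [T.pd_symm hD.isOpen hp _ i j]
  trace p hp := by
    have h0 := T.pd_trace hD.isOpen hp 0
    have h1 := fun a : Fin 3 => T.pd_trace hD.isOpen hp a.succ
    simp only [Fin.sum_univ_three] at h0 h1 ⊢
    linear_combination spaceNorm p ^ 2 * (lapse M k (spaceNorm p))⁻¹ * h0 + spaceNorm p ^ 2 *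
      (spaceNorm p)⁻¹ * (p (Fin.succ 0) * h1 0 + p (Fin.succ 1) * h1 1 + p (Fin.succ 2) * h1 2)
  tang p hp i := by
    have h0 := T.pd_zero_tang hD.isOpen hp i
    have h1 := fun a => T.pd_tang hD.isOpen hp a i
    have h2 := T.tang p hp i
    simp only [Fin.sum_univ_three] at h0 h1 h2 ⊢
    linear_combination spaceNorm p ^ 2 * (lapse M k (spaceNorm p))⁻¹ * h0 + spaceNorm p ^ 2 *
      (spaceNorm p)⁻¹ * (p (Fin.succ 0) * h1 0 + p (Fin.succ 1) * h1 1 + p (Fin.succ 2) * h1 2 - h2)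

/-- The divergence. -/
noncomputable def div (T : SphereTensor D) (hD : IsOpen D) : SphereVector D where
  toFun j p := ∑ i : Fin 3, pd i.succ (T.toFun i j) p
  smooth j := ContDiffOn.sum fun i _ => ContDiffOn.pd hD (T.smooth i j) i.succ
  tang p hp := by
    have h1 := fun i => T.pd_tang hD hp i i
    have h2 := T.trace p hp
    simp only [Fin.sum_univ_three] at h1 h2 ⊢
    linear_combination h1 0 + h1 1 + h1 2 - h2

/-- The component of weight `-2`. -/
noncomputable def spin (T : SphereTensor D) (hU : ExteriorChart M k U) (hUD : ∀ x ∈ U, sph x ∈ D) :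
    smoothAlg U :=
  ∑ i, ∑ j, pull hUD (T.toFun i j) (T.smooth i j) * (hU.mb i * hU.mb j)

end SphereTensor

end SAdS

/-! ### Spin components: 𝓛₂ and 𝓛₁ as divergences -/

namespace SAdS

open TopologicalSpace

variable {M k : ℝ} {U : Opens Coord} {D : Set Coord}

namespace ExteriorChart

theorem evalAt_om (hU : ExteriorChart M k U) (x : U) (i : Fin 3) :
    evalAt x (hU.om i) = ((sphJac x 1 i.succ : ℝ) : ℂ) := by
  have e1 : evalAt x hU.calculus.s = ((Real.sin (x.1 2) : ℝ) : ℂ) := rfl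
  have e2 : evalAt x hU.calculus.c = ((Real.cos (x.1 2) : ℝ) : ℂ) := rfl
  have e3 : evalAt x cosφ = ((Real.cos (x.1 3) : ℝ) : ℂ) := rfl
  have e4 : evalAt x sinφ = ((Real.sin (x.1 3) : ℝ) : ℂ) := rfl
  fin_cases i <;> simp [om, sphJac, e1, e2, e3, e4]

theorem evalAt_th (hU : ExteriorChart M k U) (x : U) (i : Fin 3) :
    (x.1 1 : ℂ) * evalAt x (hU.th i) = ((sphJac x 2 i.succ : ℝ) : ℂ) := by
  have e1 : evalAt x hU.calculus.s = ((Real.sin (x.1 2) : ℝ) : ℂ) := rfl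
  have e2 : evalAt x hU.calculus.c = ((Real.cos (x.1 2) : ℝ) : ℂ) := rfl
  have e3 : evalAt x cosφ = ((Real.cos (x.1 3) : ℝ) : ℂ) := rfl
  have e4 : evalAt x sinφ = ((Real.sin (x.1 3) : ℝ) : ℂ) := rfl
  fin_cases i <;> simp [th, sphJac, e1, e2, e3, e4]

theorem evalAt_ph (x : U) (i : Fin 3) :
    (x.1 1 : ℂ) * (Real.sin (x.1 2) : ℂ) * evalAt x (ph i) = ((sphJac x 3 i.succ : ℝ) : ℂ) := by
  have e3 : evalAt x cosφ = ((Real.cos (x.1 3) : ℝ) : ℂ) := rfl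
  have e4 : evalAt x sinφ = ((Real.sin (x.1 3) : ℝ) : ℂ) := rfl
  fin_cases i <;> simp [ph, sphJac, e3, e4]

theorem sph_succ (x : Coord) (i : Fin 3) : sph x i.succ = x 1 * sphJac x 1 i.succ := by
  fin_cases i <;> simp [sph, sphJac] <;> ring

variable (hU : ExteriorChart M k U)

section Pull

variable (hD : IsOpen D) (hUD : ∀ x ∈ U, sph x ∈ D) {F : Coord → ℝ} (hF : ContDiffOn ℝ ∞ F D)

theorem evalAt_smoothPd_pull (hD : IsOpen D) (x : U) (a : Fin 4) :
    evalAt x (smoothPd a (pull hUD F hF)) =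
    ∑ i, (sphJac x a i : ℂ) * ((pd i F (sph x) : ℝ) : ℂ) :=
  ((isRep_smoothPd_pull hD hUD hF a).apply x).symm

theorem d_zero_pull : hU.calculus.d 0 (pull hUD F hF) =
    pull hUD (pd 0 F) (ContDiffOn.pd hD hF 0) :=
  Subtype.ext (funext fun x => by
    refine (evalAt_smoothPd_pull hUD hF hD x 0).trans ?_
    rw [← (isRep_pull hUD (ContDiffOn.pd hD hF 0)).apply x, Fin.sum_univ_four]
    simp [sphJac])

theorem d_one_pull : hU.calculus.d 1 (pull hUD F hF) =
    ∑ i : Fin 3, hU.om i * pull hUD (pd i.succ F) (ContDiffOn.pd hD hF i.succ) :=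
  Subtype.ext (funext fun x => by
    refine (evalAt_smoothPd_pull hUD hF hD x 1).trans ?_
    rw [← evalAt_apply, map_sum]
    simp only [map_mul, evalAt_om]
    rw [Fin.sum_univ_succ]
    simp [sphJac, -Fin.succ_zero_eq_one, -Fin.succ_one_eq_two]
    rfl)

theorem null_δ_pull : hU.calculus.null.δ (pull hUD F hF) =
    hU.calculus.r * ∑ i : Fin 3, hU.mm i * pull hUD (pd i.succ F) (ContDiffOn.pd hD hF i.succ) :=
  Subtype.ext (funext fun x => by
    change evalAt x (smoothPd 2 (pull hUD F hF) + hU.calculus.I * hU.calculus.σ *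
      smoothPd 3 (pull hUD F hF)) = _
    have hs : (Real.sin (x.1 2) : ℂ) ≠ 0 := by exact_mod_cast (hU.sin_pos x x.2).ne'
    have e1 : evalAt x hU.calculus.σ = (((Real.sin (x.1 2))⁻¹ : ℝ) : ℂ) := rfl
    have e2 : evalAt x hU.calculus.r = (x.1 1 : ℂ) := rfl
    have e3 : ∀ i : Fin 3, evalAt x (pull hUD (pd i.succ F) (ContDiffOn.pd hD hF i.succ)) =
      ((pd i.succ F (sph x) : ℝ) : ℂ) := fun i => rfl
    have e4 : sphJac x.1 2 0 = 0 := rfl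
    have e5 : sphJac x.1 3 0 = 0 := rfl
    rw [← evalAt_apply]
    simp only [map_add, map_mul, map_sum, evalAt_smoothPd_pull hUD hF hD, e1, e2, e3, mm]
    have e6 : ∀ a, ∑ i, (sphJac x.1 a i : ℂ) * ((pd i F (sph x) : ℝ) : ℂ) =
        (sphJac x.1 a 0 : ℂ) * ((pd 0 F (sph x) : ℝ) : ℂ) +
        ∑ i : Fin 3, (sphJac x.1 a i.succ : ℂ) * ((pd i.succ F (sph x) : ℝ) : ℂ) :=
      fun a => Fin.sum_univ_succ _
    rw [e6, e6]
    simp only [← evalAt_th hU, ← evalAt_ph, e4, e5]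
    simp only [Fin.sum_univ_three, Complex.ofReal_inv, Complex.ofReal_zero]
    field_simp
    ring)

end Pull

/-- Each factor 𝔪* contributes -κ, which cancels the cot ϑ term in 𝓛_n for a quantity with n
factors. The radial remainder dies against tangential tensors. -/
theorem null_δ_mb (i : Fin 3) : hU.calculus.null.δ (hU.mb i) =
    -(2 * hU.om i) - hU.calculus.null.κ * hU.mb i := by
  change hU.calculus.d 2 (hU.mb i) + hU.calculus.I * hU.calculus.σ * hU.calculus.d 3 (hU.mb i) =
    -(2 * hU.om i) - hU.calculus.c * hU.calculus.σ * hU.mb i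
  rw [d_two_mb, d_three_mb]
  linear_combination (hU.calculus.σ * (hU.calculus.c * hU.mb i + hU.calculus.s * hU.om i)) *
    hU.calculus.I_sq - hU.om i * hU.calculus.s_σ

theorem null_D_mb (i : Fin 3) : hU.calculus.null.D (hU.mb i) = 0 := by
  change hU.calculus.d 1 (hU.mb i) + hU.calculus.ν * hU.calculus.d 0 (hU.mb i) = 0
  rw [d_zero_mb, d_one_mb, mul_zero, add_zero]

theorem mb_mm (i j : Fin 3) : hU.mb i * hU.mm j + hU.mm i * hU.mb j + 2 * (hU.om i * hU.om j) =
    if i = j then 2 else 0 := by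
  have h1 := hU.completeness i j
  have h2 : (if i = j then (2 : smoothAlg U) else 0) = 2 * if i = j then 1 else 0 := by
    split_ifs <;> ring
  rw [h2, ← h1, mb, mb, mm, mm]
  linear_combination (-2 * ph i * ph j) * hU.calculus.I_sq

/-- Contraction of a tangential vector with the radial direction. -/
theorem sum_om (hUD : ∀ x ∈ U, sph x ∈ D) {F : Fin 3 → Coord → ℝ}
    (hF : ∀ j, ContDiffOn ℝ ∞ (F j) D) (h : ∀ p ∈ D, ∑ j, F j p * p j.succ = 0) :
    ∑ j, pull hUD (F j) (hF j) * hU.om j = 0 :=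
  Subtype.ext (funext fun x => by
    have hr : (x.1 1 : ℂ) ≠ 0 := by exact_mod_cast (hU.r_pos x x.2).ne'
    have h1 := h (sph x) (hUD x x.2)
    simp only [sph_succ] at h1
    rw [← evalAt_apply, map_sum]
    simp only [map_mul, evalAt_om]
    have e3 : ∀ i : Fin 3, evalAt x (pull hUD (F i) (hF i)) = ((F i (sph x) : ℝ) : ℂ) :=
      fun i => rfl
    simp only [e3]
    have h2 : (x.1 1 : ℂ) * ∑ j : Fin 3, (F j (sph x) : ℂ) * (sphJac x.1 1 j.succ : ℂ) = 0 := by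
      rw [Finset.mul_sum]
      have := congrArg (fun y : ℝ => (y : ℂ)) h1
      push_cast at this
      rw [← this]
      exact Finset.sum_congr rfl fun j _ => by ring
    exact (mul_eq_zero.mp h2).resolve_left hr)

theorem sum_om_om (hUD : ∀ x ∈ U, sph x ∈ D) {F : Fin 3 → Fin 3 → Coord → ℝ}
    (hF : ∀ i j, ContDiffOn ℝ ∞ (F i j) D)
    (h : ∀ p ∈ D, ∑ i, ∑ j, F i j p * (p i.succ * p j.succ) = 0) :
    ∑ i, ∑ j, pull hUD (F i j) (hF i j) * (hU.om i * hU.om j) = 0 :=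
  Subtype.ext (funext fun x => by
    have hr : (x.1 1 : ℂ) ^ 2 ≠ 0 := pow_ne_zero _ (by exact_mod_cast (hU.r_pos x x.2).ne')
    have h1 := h (sph x) (hUD x x.2)
    simp only [sph_succ] at h1
    rw [← evalAt_apply]
    simp only [map_sum, map_mul, evalAt_om]
    have e3 : ∀ i j : Fin 3, evalAt x (pull hUD (F i j) (hF i j)) = ((F i j (sph x) : ℝ) : ℂ) :=
      fun i j => rfl
    simp only [e3]
    refine mul_left_cancel₀ hr (Eq.trans ?_ (mul_zero _).symm)
    have := congrArg (fun y : ℝ => (y : ℂ)) h1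
    push_cast at this
    rw [← this]
    simp only [Finset.mul_sum]
    exact Finset.sum_congr rfl fun i _ => Finset.sum_congr rfl fun j _ => by ring)

end ExteriorChart

namespace SphereTensor

variable (T : SphereTensor D) (hU : ExteriorChart M k U) (hUD : ∀ x ∈ U, sph x ∈ D)

/-- Differentiating T_ij p_j = 0 gives zero or -T_ia; a second contraction with the position vector
kills this as well, so derivatives of T have no doubly radial part. -/
theorem sum_om_om (hD : IsOpen D) (a : Fin 4) : ∑ i, ∑ j,
    pull hUD (pd a (T.toFun i j)) (ContDiffOn.pd hD (T.smooth i j) a) *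
      (hU.om i * hU.om j) = 0 := by
  refine hU.sum_om_om hUD (fun i j => ContDiffOn.pd hD (T.smooth i j) a) fun p hp => ?_
  refine Fin.cases ?_ (fun a => ?_) a
  · have h1 := T.pd_zero_tang hD hp
    simp only [Fin.sum_univ_three] at h1 ⊢
    linear_combination p (Fin.succ 0) * h1 0 + p (Fin.succ 1) * h1 1 + p (Fin.succ 2) * h1 2
  · have h1 := T.pd_tang hD hp a
    have h2 := T.tang p hp a
    simp only [T.symm p hp a] at h2
    simp only [Fin.sum_univ_three] at h1 h2 ⊢
    linear_combination p (Fin.succ 0) * h1 0 + p (Fin.succ 1) * h1 1 + p (Fin.succ 2) * h1 2 - h2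

/-- After the cot ϑ terms cancel, 𝓛₂ differentiates the Cartesian components of T along r𝔪, and
tracelessness turns this into the divergence. This description is regular at the axis. -/
theorem up_two_spin (hD : IsOpen D) : hU.calculus.null.up 2 (T.spin hU hUD) =
    2 * hU.calculus.r * (T.div hD).spin hU hUD := by
  have h1 : ∀ i, ∑ j, pull hUD (T.toFun i j) (T.smooth i j) * hU.om j = 0 := fun i =>
    hU.sum_om hUD (T.smooth i) fun p hp => T.tang p hp i
  have h2 : ∀ j, ∑ i, pull hUD (T.toFun i j) (T.smooth i j) * hU.om i = 0 := fun j =>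
    hU.sum_om hUD (fun i => T.smooth i j) fun p hp => by
      simpa only [T.symm p hp _ j] using T.tang p hp j
  have key := sum_mm_mb_mb (a := fun a i j => pull hUD (pd a.succ (T.toFun i j))
    (ContDiffOn.pd hD (T.smooth i j) a.succ)) hU.mb_mm
    (fun a i j => Subtype.ext (funext fun x => by
      exact congrArg Complex.ofReal (T.pd_symm hD (hUD x x.2) a.succ i j)))
    (fun a => Subtype.ext (funext fun x => by
      rw [← evalAt_apply, map_sum]
      change ∑ i, ((pd a.succ (T.toFun i i) (sph x) : ℝ) : ℂ) = 0
      exact_mod_cast T.pd_trace hD (hUD x x.2) a.succ))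
    (fun a => T.sum_om_om hU hUD hD a.succ) (fun j => by
      refine hU.sum_om_om hUD (F := fun a i => pd a.succ (T.toFun i j))
        (fun a i => ContDiffOn.pd hD (T.smooth i j) a.succ) fun p hp => ?_
      have h1 := fun a => T.pd_tang hD hp a j
      have h2 := T.tang p hp j
      simp only [T.pd_symm hD hp _ _ j]
      simp only [Fin.sum_univ_three] at h1 h2 ⊢
      linear_combination p (Fin.succ 0) * h1 0 + p (Fin.succ 1) * h1 1 + p (Fin.succ 2) * h1 2 - h2)
  have h3 : ∀ j, pull hUD ((T.div hD).toFun j) ((T.div hD).smooth j) =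
      ∑ i : Fin 3, pull hUD (pd i.succ (T.toFun i j)) (ContDiffOn.pd hD (T.smooth i j) i.succ) :=
    fun j => Subtype.ext (funext fun x => by
      rw [← evalAt_apply, ← evalAt_apply, map_sum]
      change ((∑ i : Fin 3, pd i.succ (T.toFun i j) (sph x) : ℝ) : ℂ) =
        ∑ i : Fin 3, ((pd i.succ (T.toFun i j) (sph x) : ℝ) : ℂ)
      push_cast
      rfl)
  have h4 : ∀ i j, hU.calculus.null.δ (pull hUD (T.toFun i j) (T.smooth i j) * (hU.mb i * hU.mb j))
      + 2 * hU.calculus.null.κ * (pull hUD (T.toFun i j) (T.smooth i j) * (hU.mb i * hU.mb j)) =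
      hU.calculus.r * ((∑ a, hU.mm a * pull hUD (pd a.succ (T.toFun i j))
        (ContDiffOn.pd hD (T.smooth i j) a.succ)) * (hU.mb i * hU.mb j))
      - 2 * hU.mb i * (pull hUD (T.toFun i j) (T.smooth i j) * hU.om j)
      - 2 * hU.mb j * (pull hUD (T.toFun i j) (T.smooth i j) * hU.om i) := by
    intro i j
    rw [Derivation.leibniz, Derivation.leibniz, hU.null_δ_pull hD, hU.null_δ_mb, hU.null_δ_mb]
    simp only [smul_eq_mul]
    ring
  have h5 : ∑ i, ∑ j, 2 * hU.mb j * (pull hUD (T.toFun i j) (T.smooth i j) * hU.om i) = 0 := by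
    rw [Finset.sum_comm]
    simp only [← Finset.mul_sum, h2, mul_zero, Finset.sum_const_zero]
  have h6 : ∑ i, ∑ j, 2 * hU.mb i * (pull hUD (T.toFun i j) (T.smooth i j) * hU.om j) = 0 := by
    simp only [← Finset.mul_sum, h1, mul_zero, Finset.sum_const_zero]
  have h7 : hU.calculus.null.up 2 (T.spin hU hUD) = ∑ i, ∑ j,
      (hU.calculus.null.δ (pull hUD (T.toFun i j) (T.smooth i j) * (hU.mb i * hU.mb j))
      + 2 * hU.calculus.null.κ *
        (pull hUD (T.toFun i j) (T.smooth i j) * (hU.mb i * hU.mb j))) := by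
    simp only [NullCalculus.up, spin, map_sum, Finset.sum_add_distrib, Finset.mul_sum,
      Int.cast_ofNat]
  rw [h7]
  simp only [h4, Finset.sum_sub_distrib, h5, h6, sub_zero]
  simp only [← Finset.mul_sum, key]
  simp only [SphereVector.spin, h3]
  ring

theorem spin_smul {F : Coord → ℝ} (hF : ContDiffOn ℝ ∞ F D) {v : smoothAlg U}
    (h : IsRep (fun x => (F (sph x) : ℂ)) v) : (T.smul F hF).spin hU hUD = v * T.spin hU hUD := by
  simp only [spin, Finset.mul_sum]
  refine Finset.sum_congr rfl fun i _ => Finset.sum_congr rfl fun j _ => ?_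
  rw [← mul_assoc v]
  congr 1
  refine Subtype.ext (funext fun x => ?_)
  change (((F (sph x) * T.toFun i j (sph x)) : ℝ) : ℂ) = v.1 x * ((T.toFun i j (sph x) : ℝ) : ℂ)
  rw [← h.apply x, Complex.ofReal_mul]

/-- The Cartesian components of 𝔪* depend on the angles only, so w⁻¹L passes through them and acts
on the components of T. -/
theorem spin_wL (hD : CartesianDomain M k D) : (T.wL hD).spin hU hUD =
    hU.calculus.r ^ 2 * hU.calculus.null.D (T.spin hU hUD) := by
  simp only [spin, map_sum, Finset.mul_sum]
  refine Finset.sum_congr rfl fun i _ => Finset.sum_congr rfl fun j _ => ?_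
  rw [Derivation.leibniz, Derivation.leibniz, hU.null_D_mb, hU.null_D_mb]
  have h1 : hU.calculus.null.D (pull hUD (T.toFun i j) (T.smooth i j)) =
      hU.calculus.d 1 (pull hUD (T.toFun i j) (T.smooth i j)) +
        hU.calculus.ν * hU.calculus.d 0 (pull hUD (T.toFun i j) (T.smooth i j)) := rfl
  rw [h1, hU.d_one_pull hD.isOpen, hU.d_zero_pull hD.isOpen]
  have h2 : pull hUD ((T.wL hD).toFun i j) ((T.wL hD).smooth i j) = hU.calculus.r ^ 2 *
      (∑ a : Fin 3, hU.om a * pull hUD (pd a.succ (T.toFun i j))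
        (ContDiffOn.pd hD.isOpen (T.smooth i j) a.succ)
      + hU.calculus.ν * pull hUD (pd 0 (T.toFun i j))
        (ContDiffOn.pd hD.isOpen (T.smooth i j) 0)) := by
    refine Subtype.ext (funext fun x => ?_)
    have hr : (x.1 1 : ℂ) ≠ 0 := by exact_mod_cast (hU.r_pos x x.2).ne'
    have e1 : evalAt x hU.calculus.r = (x.1 1 : ℂ) := rfl
    have e2 : evalAt x hU.calculus.ν = (((lapse M k (x.1 1))⁻¹ : ℝ) : ℂ) := rfl
    have e3 : ∀ a : Fin 4, evalAt x (pull hUD (pd a (T.toFun i j))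
      (ContDiffOn.pd hD.isOpen (T.smooth i j) a)) = ((pd a (T.toFun i j) (sph x) : ℝ) : ℂ) :=
      fun i => rfl
    rw [← evalAt_apply, ← evalAt_apply]
    simp only [map_mul, map_add, map_sum, map_pow, hU.evalAt_om, e1, e2, e3]
    change ((spaceNorm (sph x) ^ 2 * ((lapse M k (spaceNorm (sph x)))⁻¹ *
      pd 0 (T.toFun i j) (sph x) + (spaceNorm (sph x))⁻¹ *
        ∑ a : Fin 3, sph x a.succ * pd a.succ (T.toFun i j) (sph x)) : ℝ) : ℂ) = _
    simp only [spaceNorm_sph (hU.r_pos x x.2), ExteriorChart.sph_succ]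
    push_cast
    simp only [Fin.sum_univ_three]
    field_simp
    ring
  rw [h2]
  simp only [smul_eq_mul]
  ring

end SphereTensor

/-- The real part of the `ð`-derivative of a tangential vector is its divergence. -/
theorem SphereVector.re_up_one_spin (V : SphereVector D) (hU : ExteriorChart M k U)
    (hUD : ∀ x ∈ U, sph x ∈ D) (hD : IsOpen D) (x : U) :
    (evalAt x (hU.calculus.null.up 1 (V.spin hU hUD))).re = x.1 1 * V.div (sph x) := by
  have h0 : ∑ j, pull hUD (V.toFun j) (V.smooth j) * hU.om j = 0 := hU.sum_om hUD V.smooth V.tang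
  have h1 : hU.calculus.null.up 1 (V.spin hU hUD) = hU.calculus.r * ∑ j, ∑ a : Fin 3,
      pull hUD (pd a.succ (V.toFun j)) (ContDiffOn.pd hD (V.smooth j) a.succ) *
        (hU.mm a * hU.mb j) := by
    have h2 : ∀ j, hU.calculus.null.δ (pull hUD (V.toFun j) (V.smooth j) * hU.mb j)
        + hU.calculus.null.κ * (pull hUD (V.toFun j) (V.smooth j) * hU.mb j) =
        hU.calculus.r * (∑ a : Fin 3, pull hUD (pd a.succ (V.toFun j))
          (ContDiffOn.pd hD (V.smooth j) a.succ) * (hU.mm a * hU.mb j))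
        - 2 * (pull hUD (V.toFun j) (V.smooth j) * hU.om j) := by
      intro j
      rw [Derivation.leibniz, hU.null_δ_pull hD, hU.null_δ_mb]
      simp only [smul_eq_mul, Fin.sum_univ_three]
      ring
    have h3 : hU.calculus.null.up 1 (V.spin hU hUD) = ∑ j,
        (hU.calculus.null.δ (pull hUD (V.toFun j) (V.smooth j) * hU.mb j)
        + hU.calculus.null.κ * (pull hUD (V.toFun j) (V.smooth j) * hU.mb j)) := by
      simp only [NullCalculus.up, spin, map_sum, Finset.sum_add_distrib, Finset.mul_sum,
        Int.cast_one, one_mul]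
    rw [h3]
    simp only [h2, Finset.sum_sub_distrib, ← Finset.mul_sum, h0, mul_zero, sub_zero]
  have h4 := hU.sum_om_om hUD (F := fun a j => pd a.succ (V.toFun j))
    (fun a j => ContDiffOn.pd hD (V.smooth j) a.succ) (fun p hp => by
      have h1 := V.pd_tang hD hp
      have h2 := V.tang p hp
      simp only [Fin.sum_univ_three] at h1 h2 ⊢
      linear_combination p (Fin.succ 0) * h1 0 + p (Fin.succ 1) * h1 1 + p (Fin.succ 2) * h1 2 - h2)
  -- The product of 𝔪 and 𝔪* is the projection to the tangent plane plus i times a real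
  -- antisymmetric part. The first gives the divergence, the second a curl, which is purely
  -- imaginary.
  have h5 : ∀ a j, hU.mm a * hU.mb j = (if a = j then 1 else 0) - hU.om a * hU.om j
      + hU.calculus.I * (ExteriorChart.ph a * hU.th j - hU.th a * ExteriorChart.ph j) := by
    intro a j
    rw [← hU.completeness a j, ExteriorChart.mm, ExteriorChart.mb]
    linear_combination (-ExteriorChart.ph a * ExteriorChart.ph j) * hU.calculus.I_sq
  have h6 : hU.calculus.null.up 1 (V.spin hU hUD) = hU.calculus.r * (∑ j : Fin 3,
      pull hUD (pd j.succ (V.toFun j)) (ContDiffOn.pd hD (V.smooth j) j.succ)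
      + hU.calculus.I * ∑ j, ∑ a : Fin 3, pull hUD (pd a.succ (V.toFun j))
        (ContDiffOn.pd hD (V.smooth j) a.succ) *
          (ExteriorChart.ph a * hU.th j - hU.th a * ExteriorChart.ph j)) := by
    rw [Finset.sum_comm] at h4
    rw [h1]
    simp only [h5, mul_add, mul_sub, Finset.sum_add_distrib, Finset.sum_sub_distrib, h4]
    simp only [mul_ite, mul_one, mul_zero, Finset.sum_ite_eq', Finset.mem_univ, if_true, sub_zero]
    simp only [Fin.sum_univ_three]
    ring
  have hr : (x.1 1 : ℂ) ≠ 0 := by exact_mod_cast (hU.r_pos x x.2).ne'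
  have hs : (Real.sin (x.1 2) : ℂ) ≠ 0 := by exact_mod_cast (hU.sin_pos x x.2).ne'
  have e1 : ∀ i, evalAt x (hU.th i) = (((x.1 1)⁻¹ * sphJac x 2 i.succ : ℝ) : ℂ) := fun i => by
    rw [Complex.ofReal_mul, ← hU.evalAt_th, Complex.ofReal_inv]
    field_simp
  have e2 : ∀ i, evalAt x (ExteriorChart.ph i) =
      (((x.1 1)⁻¹ * (Real.sin (x.1 2))⁻¹ * sphJac x 3 i.succ : ℝ) : ℂ) := fun i => by
    rw [Complex.ofReal_mul, ← ExteriorChart.evalAt_ph, Complex.ofReal_mul, Complex.ofReal_inv,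
      Complex.ofReal_inv]
    field_simp
  have e3 : ∀ a j : Fin 3, evalAt x (pull hUD (pd a.succ (V.toFun j))
      (ContDiffOn.pd hD (V.smooth j) a.succ)) = ((pd a.succ (V.toFun j) (sph x) : ℝ) : ℂ) :=
    fun i j => rfl
  have e4 : evalAt x hU.calculus.r = (x.1 1 : ℂ) := rfl
  have e5 : evalAt x hU.calculus.I = Complex.I := rfl
  rw [h6]
  simp only [map_mul, map_add, map_sum, map_sub, e1, e2, e3, e4, e5]
  simp only [← Complex.ofReal_mul, ← Complex.ofReal_sub, ← Complex.ofReal_sum]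
  rw [Complex.re_ofReal_mul, Complex.add_re, Complex.ofReal_re, Complex.I_mul_re,
    Complex.ofReal_im, neg_zero, add_zero]
  rfl

end SAdS

/-! ### The horizon radius, and real parts of contractions with σ -/

namespace SAdS

open TopologicalSpace

variable {M k : ℝ} {D : Set Coord}

section Horizon

theorem bddAbove_roots (hM : 0 < M) : BddAbove {r : ℝ | Del M k r = 0} := by
  -- For r > 2M both r(r - 2M) and k²r⁴ are non-negative, and the first is positive.
  refine ⟨2 * M, fun r hr => ?_⟩
  by_contra! h
  have hr0 : 0 < r := by linarith
  have h1 : Del M k r = r * (r - 2 * M) + k ^ 2 * r ^ 4 := by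
    rw [Del]
    ring
  have h2 : 0 < r * (r - 2 * M) := mul_pos hr0 (by linarith)
  have h3 : 0 ≤ k ^ 2 * r ^ 4 := by positivity
  have h4 : Del M k r = 0 := hr
  linarith

theorem horizonRadius_nonneg (hM : 0 < M) : 0 ≤ horizonRadius M k :=
  le_csSup (bddAbove_roots hM) (by simp [Del])

theorem Del_pos (hM : 0 < M) {r : ℝ} (hr : horizonRadius M k < r) : 0 < Del M k r := by
  have hr0 : 0 < r := (horizonRadius_nonneg hM).trans_lt hr
  by_contra! h
  -- At r + 2M the function equals (r + 2M)r + k²(r + 2M)⁴. If Δ(r) ≤ 0, the intermediate value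
  -- theorem would give a zero beyond r₊.
  have h1 : 0 ≤ Del M k (r + 2 * M) := by
    rw [Del]
    have : (r + 2 * M) ^ 2 + k ^ 2 * (r + 2 * M) ^ 4 - 2 * M * (r + 2 * M) =
        (r + 2 * M) * r + k ^ 2 * (r + 2 * M) ^ 4 := by ring
    rw [this]
    positivity
  have hc : ContinuousOn (Del M k) (Set.Icc r (r + 2 * M)) := by
    unfold Del
    fun_prop
  obtain ⟨y, hy, hy0⟩ := intermediate_value_Icc (by linarith) hc ⟨h, h1⟩
  have h2 : y ≤ horizonRadius M k := le_csSup (bddAbove_roots hM) hy0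
  linarith [hy.1]

theorem lapse_pos_of_horizonRadius_lt (hM : 0 < M) {r : ℝ} (hr : horizonRadius M k < r) :
    0 < lapse M k r := by
  have hr0 : 0 < r := (horizonRadius_nonneg hM).trans_lt hr
  have h1 := Del_pos hM hr
  rw [Del_eq M k hr0.ne'] at h1
  exact pos_of_mul_pos_right h1 (by positivity)

theorem cartesianDomain (hM : 0 < M) (hD : IsOpen D) (hDext : D ⊆ exterior M k) :
    CartesianDomain M k D where
  isOpen := hD
  norm_pos _ hp := (horizonRadius_nonneg hM).trans_lt (hDext hp)
  lapse_pos _ hp := lapse_pos_of_horizonRadius_lt hM (hDext hp)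

theorem isOpen_sphDomain (M k : ℝ) (hD : IsOpen D) : IsOpen (sphDomain M k D) :=
  (isOpen_lt continuous_const (continuous_apply 1)).and
    ((isOpen_lt continuous_const (continuous_apply 2)).and
    ((isOpen_lt (continuous_apply 2) continuous_const).and (hD.preimage contDiff_sph.continuous)))

/-- The spherical coordinates of `D`, as an open set. -/
def sphOpens (M k : ℝ) (hD : IsOpen D) : Opens Coord := ⟨sphDomain M k D, isOpen_sphDomain M k hD⟩

theorem sph_mem (hD : IsOpen D) : ∀ x ∈ sphOpens M k hD, sph x ∈ D := fun _ hx => hx.2.2.2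

theorem exteriorChart (hM : 0 < M) (hD : IsOpen D) : ExteriorChart M k (sphOpens M k hD) where
  r_pos _ hx := (horizonRadius_nonneg hM).trans_lt hx.1
  lapse_pos _ hx := lapse_pos_of_horizonRadius_lt hM hx.1
  sin_pos _ hx := Real.sin_pos_of_pos_of_lt_pi hx.2.1 hx.2.2.1

end Horizon

/-- The unit vector along `∂_ϑ`. -/
noncomputable def thetaVec (x : Coord) : Fin 3 → ℝ :=
  ![Real.cos (x 2) * Real.cos (x 3), Real.cos (x 2) * Real.sin (x 3), -Real.sin (x 2)]

/-- The unit vector along `∂_φ`. -/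
noncomputable def phiVec (x : Coord) : Fin 3 → ℝ := ![-Real.sin (x 3), Real.cos (x 3), 0]

theorem mBarSpace_eq (x : Coord) (i : Fin 3) :
    mBarSpace x i = (thetaVec x i : ℂ) - Complex.I * (phiVec x i : ℂ) := by
  fin_cases i <;> simp [mBarSpace, thetaVec, phiVec]

theorem sphJac_two (x : Coord) (i : Fin 3) : sphJac x 2 i.succ = x 1 * thetaVec x i := by
  fin_cases i <;> rfl

theorem sphJac_three (x : Coord) (i : Fin 3) :
    sphJac x 3 i.succ = x 1 * Real.sin (x 2) * phiVec x i := by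
  fin_cases i <;> simp [sphJac, phiVec]

theorem thetaVec_completeness (x : Coord) (i j : Fin 3) :
    thetaVec x i * thetaVec x j + phiVec x i * phiVec x j + sphJac x 1 i.succ * sphJac x 1 j.succ =
      if i = j then 1 else 0 := by
  have h := sphericalFrame_completeness (Real.sin_sq_add_cos_sq (x 2))
    (Real.sin_sq_add_cos_sq (x 3)) i j
  rw [← h]
  fin_cases i <;> fin_cases j <;> rfl

/-- The real part of a contraction with `dϑ + i sin ϑ dφ`. -/
theorem re_spin_mul_sig {x : Coord} {V : Fin 3 → ℝ}
    (hV : ∑ j, V j * sphJac x 1 j.succ = 0) (a : Fin 4) :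
    ((x 1 : ℂ) * (∑ j, (V j : ℂ) * mBarSpace x j) * sig x a).re =
      ∑ j, sphJac x a j.succ * V j := by
  have h1 : ∑ j, (V j : ℂ) * mBarSpace x j =
      ((∑ j, V j * thetaVec x j : ℝ) : ℂ) - Complex.I * ((∑ j, V j * phiVec x j : ℝ) : ℂ) := by
    simp only [mBarSpace_eq, Fin.sum_univ_three]
    push_cast
    ring
  rw [h1]
  fin_cases a
  · simp [sig, sphJac, Fin.sum_univ_three]
  · change _ = ∑ j : Fin 3, sphJac x 1 j.succ * V j
    simp only [mul_comm (sphJac x 1 _), hV]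
    simp [sig]
  · change _ = ∑ j : Fin 3, sphJac x 2 j.succ * V j
    simp only [sphJac_two, Fin.sum_univ_three]
    simp [sig, -Complex.ofReal_add, -Complex.ofReal_mul]
    ring
  · change _ = ∑ j : Fin 3, sphJac x 3 j.succ * V j
    simp only [sphJac_three, Fin.sum_univ_three]
    simp [sig, -Complex.ofReal_add, -Complex.ofReal_mul, -Complex.ofReal_sin]
    ring

/-- A traceless symmetric tensor on the tangent plane has two independent components, and the
contraction with 𝔪*𝔪* is 2(C_ϑϑ - iC_ϑφ). Multiplying by σσ and taking the real part recovers twice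
the tensor. -/
theorem re_spin_mul_sig_mul_sig {x : Coord} {C : Fin 3 → Fin 3 → ℝ}
    (hsym : ∀ i j, C i j = C j i) (htr : ∑ i, C i i = 0)
    (htan : ∀ i, ∑ j, C i j * sphJac x 1 j.succ = 0) (a b : Fin 4) :
    ((x 1 : ℂ) ^ 2 * (∑ i, ∑ j, (C i j : ℂ) * (mBarSpace x i * mBarSpace x j)) *
      (sig x a * sig x b)).re =
      2 * ∑ i, ∑ j, sphJac x a i.succ * sphJac x b j.succ * C i j := by
  -- Completeness splits the trace over ϑ, φ and the radial direction; since the radial part and the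
  -- trace vanish, C_ϑϑ = -C_φφ.
  have h0 : ∑ i, ∑ j, C i j * (thetaVec x i * thetaVec x j) =
      -∑ i, ∑ j, C i j * (phiVec x i * phiVec x j) := by
    have e1 : ∑ i, ∑ j, C i j * (thetaVec x i * thetaVec x j + phiVec x i * phiVec x j
        + sphJac x 1 i.succ * sphJac x 1 j.succ) = ∑ i, ∑ j, C i j * (if i = j then 1 else 0) := by
      simp only [thetaVec_completeness]
    have e2 : ∑ i, ∑ j, C i j * (sphJac x 1 (Fin.succ i) * sphJac x 1 j.succ) = 0 := by
      have : ∀ i j, C i j * (sphJac x 1 (Fin.succ i) * sphJac x 1 j.succ) =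
        sphJac x 1 (Fin.succ i) * (C i j * sphJac x 1 j.succ) := fun i j => by ring
      simp only [this, ← Finset.mul_sum, htan, mul_zero, Finset.sum_const_zero]
    simp only [mul_add, Finset.sum_add_distrib, e2] at e1
    simp only [mul_ite, mul_one, mul_zero, Finset.sum_ite_eq, Finset.mem_univ, if_true, htr] at e1
    linarith
  have h1 : ∑ i, ∑ j, (C i j : ℂ) * (mBarSpace x i * mBarSpace x j) =
      ((2 * ∑ i, ∑ j, C i j * (thetaVec x i * thetaVec x j) : ℝ) : ℂ)
        - Complex.I * ((2 * ∑ i, ∑ j, C i j * (thetaVec x i * phiVec x j) : ℝ) : ℂ) := by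
    have e1 : 2 * ∑ i, ∑ j, C i j * (thetaVec x i * thetaVec x j) =
        ∑ i, ∑ j, C i j * (thetaVec x i * thetaVec x j)
          - ∑ i, ∑ j, C i j * (phiVec x i * phiVec x j) := by
      rw [h0]
      ring
    rw [e1]
    simp only [mBarSpace_eq, Fin.sum_univ_three, hsym 1 0, hsym 2 0, hsym 2 1]
    push_cast
    linear_combination (C 0 0 * phiVec x 0 ^ 2 + C 1 1 * phiVec x 1 ^ 2 + C 2 2 * phiVec x 2 ^ 2
      + 2 * C 0 1 * phiVec x 0 * phiVec x 1 + 2 * C 0 2 * phiVec x 0 * phiVec x 2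
      + 2 * C 1 2 * phiVec x 1 * phiVec x 2 : ℂ) * Complex.I_sq
  have htan' : ∀ v : Fin 3 → ℝ, ∑ i, ∑ j, v i * sphJac x 1 j.succ * C i j = 0 := fun v => by
    have : ∀ i j, v i * sphJac x 1 (Fin.succ j) * C i j = v i * (C i j * sphJac x 1 j.succ) :=
      fun i j => by ring
    simp only [this, ← Finset.mul_sum, htan, mul_zero, Finset.sum_const_zero]
  have hswap : ∀ u v : Fin 3 → ℝ, ∑ i, ∑ j, u i * v j * C i j = ∑ i, ∑ j, v i * u j * C i j := by
    intro u v
    rw [Finset.sum_comm]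
    refine Finset.sum_congr rfl fun i _ => Finset.sum_congr rfl fun j _ => ?_
    rw [hsym]
    ring
  have hz : ∀ b, (∑ i, ∑ j, sphJac x 0 (Fin.succ i) * sphJac x b (Fin.succ j) * C i j) = 0 := by
    intro b
    simp [sphJac, Fin.sum_univ_three]
  rw [h1]
  generalize hT : ∑ i, ∑ j, C i j * (thetaVec x i * thetaVec x j) = T at *
  generalize hE : ∑ i, ∑ j, C i j * (thetaVec x i * phiVec x j) = E at *
  have j22 : ∑ i, ∑ j, sphJac x 2 (Fin.succ i) * sphJac x 2 (Fin.succ j) * C i j = x 1 ^ 2 * T := by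
    rw [← hT]
    simp only [sphJac_two, Fin.sum_univ_three]
    ring
  have j23 : ∑ i, ∑ j, sphJac x 2 (Fin.succ i) * sphJac x 3 (Fin.succ j) * C i j =
      x 1 ^ 2 * Real.sin (x 2) * E := by
    rw [← hE]
    simp only [sphJac_two, sphJac_three, Fin.sum_univ_three]
    ring
  have j33 : ∑ i, ∑ j, sphJac x 3 (Fin.succ i) * sphJac x 3 (Fin.succ j) * C i j =
      -(x 1 ^ 2 * Real.sin (x 2) ^ 2 * T) := by
    rw [h0]
    simp only [sphJac_three, Fin.sum_univ_three]
    ring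
  have j0 : ∀ a, ∑ i, ∑ j, sphJac x a (Fin.succ i) * sphJac x 0 (Fin.succ j) * C i j = 0 :=
    fun a => by
    rw [hswap, hz]
  have j1 : ∀ a, ∑ i, ∑ j, sphJac x a (Fin.succ i) * sphJac x 1 (Fin.succ j) * C i j = 0 := fun a =>
    htan' _
  have j1' : ∀ a, ∑ i, ∑ j, sphJac x 1 (Fin.succ i) * sphJac x a (Fin.succ j) * C i j = 0 :=
    fun a => by
    rw [hswap, htan']
  have j32 : ∑ i, ∑ j, sphJac x 3 (Fin.succ i) * sphJac x 2 (Fin.succ j) * C i j =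
      x 1 ^ 2 * Real.sin (x 2) * E := by rw [hswap, j23]
  rw [show (x 1 : ℂ) ^ 2 = ((x 1 ^ 2 : ℝ) : ℂ) by push_cast; rfl]
  fin_cases a <;> fin_cases b <;>
    simp only [Fin.zero_eta, Fin.mk_one, Fin.reduceFinMk, hz, j0, j1, j1', j22, j23, j32, j33]
  all_goals simp [sig, -Complex.ofReal_mul, -Complex.ofReal_sin, -Complex.ofReal_pow]
  all_goals try ring

end SAdS

/-! ### The perturbation as a smooth Cartesian tensor -/

namespace SAdS

open TopologicalSpace

variable {M k : ℝ} {U : Opens Coord} {D : Set Coord}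

theorem SphereVector.spin_smul (V : SphereVector D) (hU : ExteriorChart M k U)
    (hUD : ∀ x ∈ U, sph x ∈ D) {F : Coord → ℝ} (hF : ContDiffOn ℝ ∞ F D) {v : smoothAlg U}
    (h : IsRep (fun x => (F (sph x) : ℂ)) v) :
    (V.smul F hF).spin hU hUD = v * V.spin hU hUD := by
  simp only [spin, Finset.mul_sum]
  refine Finset.sum_congr rfl fun j _ => ?_
  rw [← mul_assoc v]
  congr 1
  refine Subtype.ext (funext fun x => ?_)
  change (((F (sph x) * V.toFun j (sph x)) : ℝ) : ℂ) = v.1 x * ((V.toFun j (sph x) : ℝ) : ℂ)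
  rw [← h.apply x, Complex.ofReal_mul]

theorem SphereVector.evalAt_spin (V : SphereVector D) (hU : ExteriorChart M k U)
    (hUD : ∀ x ∈ U, sph x ∈ D) (x : U) :
    evalAt x (V.spin hU hUD) = ∑ j, (V.toFun j (sph x) : ℂ) * mBarSpace x j := by
  simp only [spin, map_sum, map_mul]
  refine Finset.sum_congr rfl fun j _ => ?_
  rw [(hU.isRep_mb j).apply x]
  rfl

theorem SphereTensor.evalAt_spin (T : SphereTensor D) (hU : ExteriorChart M k U)
    (hUD : ∀ x ∈ U, sph x ∈ D) (x : U) : evalAt x (T.spin hU hUD) =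
      ∑ i, ∑ j, (T.toFun i j (sph x) : ℂ) * (mBarSpace x i * mBarSpace x j) := by
  simp only [spin, map_sum, map_mul]
  refine Finset.sum_congr rfl fun i _ => Finset.sum_congr rfl fun j _ => ?_
  rw [(hU.isRep_mb i).apply x, (hU.isRep_mb j).apply x]
  rfl

/-- A weight `-2` function comes from a tensor field on `D`. -/
theorem SmoothSpinMinusTwo.exists_sphereTensor {f : Coord → ℂ} (hf : SmoothSpinMinusTwo M k D f)
    (hD : IsOpen D) (hU : ExteriorChart M k (sphOpens M k hD)) :
    ∃ T : SphereTensor D, IsRep f (T.spin hU (sph_mem hD)) := by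
  obtain ⟨A, hA, hA', hf⟩ := hf
  refine ⟨⟨fun i j p => A p i j, hA, fun p hp i j => (hA' p hp).1.apply j i,
    fun p hp => (hA' p hp).2.1, fun p hp i => ?_⟩, fun x => ?_⟩
  · have := congrFun (hA' p hp).2.2 i
    simp only [Matrix.mulVec, dotProduct, Fin.sum_univ_three] at this ⊢
    exact this
  · refine (hf x x.2).trans (Eq.trans ?_ (SphereTensor.evalAt_spin _ hU (sph_mem hD) x).symm)
    simp only [mul_assoc]

/-- The components of `du` in Cartesian coordinates. -/
noncomputable def duSpace (M k : ℝ) (p : Coord) : Fin 4 → ℝ :=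
  Fin.cases (1 / 2) fun i =>
    -(1 / 2) * (lapse M k (spaceNorm p))⁻¹ * ((spaceNorm p)⁻¹ * p i.succ)

theorem CartesianDomain.contDiffOn_duSpace (hD : CartesianDomain M k D) (i : Fin 4) :
    ContDiffOn ℝ ∞ (fun p => duSpace M k p i) D := by
  refine Fin.cases contDiffOn_const (fun i => ?_) i
  exact (contDiffOn_const.mul hD.contDiffOn_inv_lapse).mul
    (hD.contDiffOn_inv_spaceNorm.mul (contDiff_coord i.succ).contDiffOn)

/-- The form dr is |x|⁻¹ ∑ xⁱ dxⁱ, so `duSpace` pulls back to du by the orthogonality of the radial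
direction to the other rows of the Jacobian. -/
theorem ExteriorChart.du_eq (hU : ExteriorChart M k U) (x : U) (a : Fin 4) :
    du M k x a = ((∑ i, sphJac x a i * duSpace M k (sph x) i : ℝ) : ℂ) := by
  have hr := hU.r_pos x x.2
  have h1 : ∀ i : Fin 3, duSpace M k (sph x) i.succ =
      -(1 / 2) * (lapse M k (x.1 1))⁻¹ * sphJac x 1 i.succ := fun i => by
    change -(1 / 2) * (lapse M k (spaceNorm (sph x)))⁻¹ *
      ((spaceNorm (sph x))⁻¹ * sph x i.succ) = _
    rw [spaceNorm_sph hr, ExteriorChart.sph_succ]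
    field_simp
  have h2 : x.1 1 ^ 2 / Del M k (x.1 1) = (lapse M k (x.1 1))⁻¹ := by
    rw [← hU.Del_div x.2, inv_div]
  have h3 : duSpace M k (sph x) 0 = 1 / 2 := rfl
  have s2 := Real.sin_sq_add_cos_sq (x.1 2)
  have s3 := Real.sin_sq_add_cos_sq (x.1 3)
  rw [Fin.sum_univ_succ, h3]
  simp only [h1]
  generalize (lapse M k (x.1 1))⁻¹ = ν at *
  simp only [du, h2, Fin.sum_univ_three]
  fin_cases a
  · simp [sphJac]
  · have : (sphJac x 1 0 * (1 / 2) +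
        (sphJac x 1 (Fin.succ 0) * (-(1 / 2) * ν * sphJac x 1 (Fin.succ 0))
        + sphJac x 1 (Fin.succ 1) * (-(1 / 2) * ν * sphJac x 1 (Fin.succ 1))
        + sphJac x 1 (Fin.succ 2) * (-(1 / 2) * ν * sphJac x 1 (Fin.succ 2)))) = -(1 / 2 * ν) := by
      simp only [sphJac, Matrix.cons_val, Matrix.cons_val_succ]
      linear_combination (-(1 / 2) * ν) * (Real.sin (x.1 2) ^ 2 * s3 + s2)
    simp only [Fin.mk_one, this]
    simp
  · have : (sphJac x 2 0 * (1 / 2) +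
        (sphJac x 2 (Fin.succ 0) * (-(1 / 2) * ν * sphJac x 1 (Fin.succ 0))
        + sphJac x 2 (Fin.succ 1) * (-(1 / 2) * ν * sphJac x 1 (Fin.succ 1))
        + sphJac x 2 (Fin.succ 2) * (-(1 / 2) * ν * sphJac x 1 (Fin.succ 2)))) = 0 := by
      simp only [sphJac, Matrix.cons_val, Matrix.cons_val_succ]
      linear_combination (-(1 / 2) * ν * x.1 1 * Real.sin (x.1 2) * Real.cos (x.1 2)) * s3
    simp only [Fin.reduceFinMk, this]
    simp
  · have : (sphJac x 3 0 * (1 / 2) +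
        (sphJac x 3 (Fin.succ 0) * (-(1 / 2) * ν * sphJac x 1 (Fin.succ 0))
        + sphJac x 3 (Fin.succ 1) * (-(1 / 2) * ν * sphJac x 1 (Fin.succ 1))
        + sphJac x 3 (Fin.succ 2) * (-(1 / 2) * ν * sphJac x 1 (Fin.succ 2)))) = 0 := by
      simp only [sphJac, Matrix.cons_val, Matrix.cons_val_succ]
      ring
    simp only [Fin.reduceFinMk, this]
    simp

/-- The tensor `-4 (2 (du W + W du) + 4 y du du + C)` on `ℝ × ℝ³`, for a 1-form `W` and a
2-tensor `C` on `ℝ³`. -/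
noncomputable def spaceHertz (M k : ℝ) (W : Fin 3 → Coord → ℝ) (y : Coord → ℝ)
    (C : Fin 3 → Fin 3 → Coord → ℝ) : Tensor2 := fun p => Matrix.of fun i j =>
  -4 * (2 * (duSpace M k p i * Fin.cases (motive := fun _ => ℝ) 0 (fun b => W b p) j
      + Fin.cases (motive := fun _ => ℝ) 0 (fun a => W a p) i * duSpace M k p j)
    + 4 * y p * (duSpace M k p i * duSpace M k p j)
    + Fin.cases (motive := fun _ => ℝ) 0 (fun a => Fin.cases (motive := fun _ => ℝ) 0
        (fun b => C a b p) j) i)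

theorem contDiffOn_spaceHertz (hD : CartesianDomain M k D) {W : Fin 3 → Coord → ℝ} {y : Coord → ℝ}
    {C : Fin 3 → Fin 3 → Coord → ℝ} (hW : ∀ i, ContDiffOn ℝ ∞ (W i) D) (hy : ContDiffOn ℝ ∞ y D)
    (hC : ∀ i j, ContDiffOn ℝ ∞ (C i j) D) (i j : Fin 4) :
    ContDiffOn ℝ ∞ (fun p => spaceHertz M k W y C p i j) D := by
  have hd := hD.contDiffOn_duSpace
  have h1 : ∀ i : Fin 4, ContDiffOn ℝ ∞
      (fun p => Fin.cases (motive := fun _ => ℝ) 0 (fun b => W b p) i) D := fun i =>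
    Fin.cases contDiffOn_const hW i
  have h2 : ∀ i j : Fin 4, ContDiffOn ℝ ∞ (fun p => Fin.cases (motive := fun _ => ℝ) 0
      (fun a => Fin.cases (motive := fun _ => ℝ) 0 (fun b => C a b p) j) i) D := fun i j =>
    Fin.cases contDiffOn_const (fun a => Fin.cases contDiffOn_const (hC a) j) i
  exact contDiffOn_const.mul (((contDiffOn_const.mul (((hd i).mul (h1 j)).add
    ((h1 i).mul (hd j)))).add
    ((contDiffOn_const.mul hy).mul ((hd i).mul (hd j)))).add (h2 i j))

theorem spaceHertz_isSymm {W : Fin 3 → Coord → ℝ} {y : Coord → ℝ} {C : Fin 3 → Fin 3 → Coord → ℝ}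
    {p : Coord} (hC : ∀ i j, C i j p = C j i p) : (spaceHertz M k W y C p).IsSymm := by
  refine Matrix.IsSymm.ext fun i j => ?_
  have h2 : (Fin.cases (motive := fun _ => ℝ) 0
      (fun a => Fin.cases (motive := fun _ => ℝ) 0 (fun b => C a b p) i) j : ℝ) =
      Fin.cases (motive := fun _ => ℝ) 0
      (fun a => Fin.cases (motive := fun _ => ℝ) 0 (fun b => C a b p) j) i := by
    refine Fin.cases ?_ (fun a => ?_) i <;> refine Fin.cases ?_ (fun b => ?_) j
    · rfl
    · rfl
    · rfl
    · exact hC b a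
  simp only [spaceHertz, Matrix.of_apply, h2]
  ring

theorem sum_mul_spaceHertz {W : Fin 3 → Coord → ℝ} {y : Coord → ℝ} {C : Fin 3 → Fin 3 → Coord → ℝ}
    (p : Coord) (u v : Fin 4 → ℝ) : ∑ i, ∑ j, u i * v j * spaceHertz M k W y C p i j =
      -4 * (2 * ((∑ i, u i * duSpace M k p i) * (∑ j : Fin 3, v j.succ * W j p)
        + (∑ i : Fin 3, u i.succ * W i p) * (∑ j, v j * duSpace M k p j))
      + 4 * y p * ((∑ i, u i * duSpace M k p i) * (∑ j, v j * duSpace M k p j))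
      + ∑ i : Fin 3, ∑ j : Fin 3, u i.succ * v j.succ * C i j p) := by
  generalize hd : duSpace M k p = d
  simp only [spaceHertz, hd, Matrix.of_apply, Fin.sum_univ_succ (n := 3), Fin.cases_zero,
    Fin.cases_succ]
  simp only [Fin.sum_univ_three]
  ring

/-- As du is real, the real part falls on the products with σ and on the scalar Y separately; each
then has its own Cartesian counterpart. -/
theorem re_hertz_sum (X Y Z s t : ℂ) (a b : ℝ) :
    (2 * X * ((a : ℂ) * t + s * (b : ℂ)) + 4 * Y * ((a : ℂ) * (b : ℂ)) + Z * (s * t)).re =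
      2 * (a * (X * t).re + (X * s).re * b) + 4 * Y.re * (a * b) + (Z * (s * t)).re := by
  have h1 : 2 * X * ((a : ℂ) * t + s * (b : ℂ)) + 4 * Y * ((a : ℂ) * (b : ℂ)) + Z * (s * t) =
      ((2 * a : ℝ) : ℂ) * (X * t) + ((2 * b : ℝ) : ℂ) * (X * s) + ((4 * (a * b) : ℝ) : ℂ) * Y
        + Z * (s * t) := by
    push_cast
    ring
  rw [h1]
  simp only [Complex.add_re, Complex.re_ofReal_mul]
  ring

namespace SphereTensor

variable (T : SphereTensor D) (hD : CartesianDomain M k D)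

/-- Multiplication by `r`. -/
noncomputable def rSmul : SphereTensor D := T.smul spaceNorm hD.contDiffOn_spaceNorm

/-- The tensor of spin component `r⁻¹ (w⁻¹ L) (r² (w⁻¹ L) f)`. -/
noncomputable def hertzTensor : SphereTensor D :=
  (((T.wL hD).smul _ (hD.contDiffOn_spaceNorm.pow 2)).wL hD).smul _ hD.contDiffOn_inv_spaceNorm

/-- The vector of spin component `𝓛₂ (r f)`. -/
noncomputable def hertzVector : SphereVector D :=
  ((T.rSmul hD).div hD.isOpen).smul (fun p => 2 * spaceNorm p)
    (contDiffOn_const.mul hD.contDiffOn_spaceNorm)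

/-- The tensor field on `ℝ × ℝ³` that is represented by `hertz` in spherical coordinates. -/
noncomputable def hertz : Tensor2 :=
  spaceHertz M k (fun j p => 2 * ((((T.rSmul hD).wL hD).div hD.isOpen).toFun j p))
    (fun p => spaceNorm p * (T.hertzVector hD).div p)
    (fun i j p => 2 * (spaceNorm p)⁻¹ ^ 2 * (T.hertzTensor hD).toFun i j p)

theorem contDiffOn_hertz (i j : Fin 4) : ContDiffOn ℝ ∞ (fun p => T.hertz hD p i j) D :=
  contDiffOn_spaceHertz hD (fun i => contDiffOn_const.mul (SphereVector.smooth _ i))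
    (hD.contDiffOn_spaceNorm.mul (ContDiffOn.sum fun j _ =>
      ContDiffOn.pd hD.isOpen (SphereVector.smooth _ j) j.succ))
    (fun i j => (contDiffOn_const.mul (hD.contDiffOn_inv_spaceNorm.pow 2)).mul
      (SphereTensor.smooth _ i j)) i j

theorem hertz_isSymm {p : Coord} (hp : p ∈ D) : (T.hertz hD p).IsSymm :=
  spaceHertz_isSymm fun i j => by rw [SphereTensor.symm _ p hp i j]

variable (hU : ExteriorChart M k U) (hUD : ∀ x ∈ U, sph x ∈ D)

theorem spin_rSmul : (T.rSmul hD).spin hU hUD = hU.calculus.r * T.spin hU hUD :=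
  T.spin_smul hU hUD _ fun x => by
    beta_reduce
    rw [spaceNorm_sph (hU.r_pos x x.2)]
    rfl

theorem spin_hertzVector : (T.hertzVector hD).spin hU hUD =
    hU.calculus.null.up 2 (hU.calculus.r * T.spin hU hUD) := by
  rw [← T.spin_rSmul hD hU hUD, up_two_spin _ hU hUD hD.isOpen]
  refine SphereVector.spin_smul _ hU hUD _ fun x => ?_
  beta_reduce
  rw [spaceNorm_sph (hU.r_pos x x.2)]
  change _ = evalAt x (2 * hU.calculus.r)
  rw [map_mul, map_ofNat, Complex.ofReal_mul]
  rfl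

theorem spin_hertzTensor : (T.hertzTensor hD).spin hU hUD = hU.calculus.ρ * (hU.calculus.r ^ 2 *
    hU.calculus.null.D (hU.calculus.r ^ 2 * (hU.calculus.r ^ 2 *
      hU.calculus.null.D (T.spin hU hUD)))) := by
  rw [← T.spin_wL hU hUD hD]
  have h1 : ((T.wL hD).smul _ (hD.contDiffOn_spaceNorm.pow 2)).spin hU hUD =
      hU.calculus.r ^ 2 * (T.wL hD).spin hU hUD :=
    spin_smul _ hU hUD _ fun x => by
      beta_reduce
      rw [spaceNorm_sph (hU.r_pos x x.2), Complex.ofReal_pow]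
      rfl
  rw [← h1, ← spin_wL]
  exact spin_smul _ hU hUD _ fun x => by
    beta_reduce
    rw [spaceNorm_sph (hU.r_pos x x.2)]
    rfl

/-- The du σ part comes from a divergence, the du du part from a double divergence, and the σσ part
from a tensor obtained by radial differentiation. None of these refers to the polar axis. -/
theorem pullbackSph_hertz {f : Coord → ℂ} (hf : IsRep f (T.spin hU hUD)) (x : U) :
    pullbackSph (T.hertz hD) x = SAdS.hertz M k f x := by
  have hr := hU.r_pos x x.2
  have hrc : (x.1 1 : ℂ) ≠ 0 := by exact_mod_cast hr.ne'
  have hX := (hU.isRep_angL 2 (hU.isRep_wL (hU.isRep_rMul 1 hf))).apply x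
  have hY := (hU.isRep_angL 1 (hU.isRep_angL 2 (hU.isRep_rMul 1 hf))).apply x
  have hZ := ((hU.isRep_ρ).mul (hU.isRep_wL (hU.isRep_rMul 2 (hU.isRep_wL hf)))).apply x
  rw [pow_one, ← T.spin_rSmul hD hU hUD, ← spin_wL _ hU hUD hD,
    up_two_spin _ hU hUD hD.isOpen, ← evalAt_apply, map_mul, map_mul, map_ofNat,
    SphereVector.evalAt_spin] at hX
  rw [pow_one, ← T.spin_hertzVector hD hU hUD] at hY
  rw [← T.spin_hertzTensor hD hU hUD, ← evalAt_apply, evalAt_spin] at hZ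
  have hsph : ∀ i : Fin 3, sph x i.succ = x.1 1 * sphJac x 1 i.succ := ExteriorChart.sph_succ x
  have htan : ∀ V : Fin 3 → ℝ, ∑ j, V j * sph x j.succ = 0 → ∑ j, V j * sphJac x 1 j.succ = 0 := by
    intro V hV
    simp only [hsph, mul_left_comm _ (x.1 1), ← Finset.mul_sum] at hV
    exact (mul_eq_zero.mp hV).resolve_left hr.ne'
  have hp := hUD x x.2
  have hXs : ∀ a, (angL 2 (SAdS.wL M k (rMul 1 f)) x * sig x a).re =
      ∑ j : Fin 3, sphJac x a j.succ *
        (2 * (((T.rSmul hD).wL hD).div hD.isOpen).toFun j (sph x)) := by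
    intro a
    have h1 := re_spin_mul_sig (htan _
      (SphereVector.tang (((T.rSmul hD).wL hD).div hD.isOpen) _ hp)) a
    have h2 : angL 2 (SAdS.wL M k (rMul 1 f)) x * sig x a = ((2 : ℝ) : ℂ) * (x.1 1 *
      (∑ j, ((((T.rSmul hD).wL hD).div hD.isOpen).toFun j (sph x) : ℂ) * mBarSpace x j) *
        sig x a) := by
      rw [hX, show evalAt x hU.calculus.r = (x.1 1 : ℂ) from rfl]
      push_cast
      ring
    rw [h2, Complex.re_ofReal_mul, h1, Finset.mul_sum]
    exact Finset.sum_congr rfl fun j _ => by ring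
  have hYs : (angL 1 (angL 2 (rMul 1 f)) x).re = x.1 1 * (T.hertzVector hD).div (sph x) := by
    rw [hY, ← evalAt_apply, SphereVector.re_up_one_spin _ hU hUD hD.isOpen]
  have hZs : ∀ a b, ((x.1 1 : ℂ)⁻¹ * SAdS.wL M k (rMul 2 (SAdS.wL M k f)) x *
      (sig x a * sig x b)).re = ∑ i : Fin 3, ∑ j : Fin 3, sphJac x a i.succ * sphJac x b j.succ *
        (2 * (x.1 1)⁻¹ ^ 2 * (T.hertzTensor hD).toFun i j (sph x)) := by
    intro a b
    have h1 := re_spin_mul_sig_mul_sig (x := x.1)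
      (C := fun i j => (T.hertzTensor hD).toFun i j (sph x))
      (SphereTensor.symm _ _ hp) (SphereTensor.trace _ _ hp)
      (fun i => htan _ (SphereTensor.tang (T.hertzTensor hD) _ hp i)) a b
    have h2 : (x.1 1 : ℂ)⁻¹ * SAdS.wL M k (rMul 2 (SAdS.wL M k f)) x * (sig x a * sig x b) =
        (((x.1 1)⁻¹ ^ 2 : ℝ) : ℂ) * ((x.1 1 : ℂ) ^ 2 * (∑ i, ∑ j,
          ((T.hertzTensor hD).toFun i j (sph x) : ℂ) * (mBarSpace x i * mBarSpace x j)) *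
            (sig x a * sig x b)) := by
      rw [← hZ]
      push_cast
      field_simp
    rw [h2, Complex.re_ofReal_mul, h1]
    simp only [Finset.mul_sum]
    exact Finset.sum_congr rfl fun i _ => Finset.sum_congr rfl fun j _ => by ring
  ext a b
  change ∑ i, ∑ j, pd a (fun y => sph y i) x.1 * pd b (fun y => sph y j) x.1 *
    T.hertz hD (sph x) i j = -4 * Complex.re _
  simp only [pd_sph]
  rw [hU.du_eq, hU.du_eq, re_hertz_sum, hXs, hXs, hYs, hZs, hertz, sum_mul_spaceHertz,
    spaceNorm_sph hr]

end SphereTensor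

/-- Every term carries du or σ in its first slot, and du(L) = σ(L) = 0. -/
theorem ExteriorChart.hertz_gauge (hU : ExteriorChart M k U) (f : Coord → ℂ) {x : Coord}
    (hx : x ∈ U) (b : Fin 4) :
    hertz M k f x 0 b + Del M k (x 1) / x 1 ^ 2 * hertz M k f x 1 b = 0 := by
  have hr := (hU.r_pos x hx).ne'
  have hN := (hU.lapse_pos x hx).ne'
  have h1 : x 1 ^ 2 / Del M k (x 1) = (lapse M k (x 1))⁻¹ := by
    rw [← hU.Del_div hx, inv_div]
  have d0 : du M k x 0 = ((1 / 2 : ℝ) : ℂ) := by simp [du]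
  have d1 : du M k x 1 = ((-(1 / 2 * (lapse M k (x 1))⁻¹) : ℝ) : ℂ) := by simp [du, h1]
  have s0 : sig x 0 = 0 := rfl
  have s1 : sig x 1 = 0 := rfl
  have key : ∀ X Y Z : ℂ, ∀ c : ℝ, (2 * X * ((c : ℂ) * sig x b + 0 * du M k x b)
      + 4 * Y * ((c : ℂ) * du M k x b) + Z * (0 * sig x b)).re =
      c * (2 * X * sig x b + 4 * Y * du M k x b).re := by
    intro X Y Z c
    rw [← Complex.re_ofReal_mul]
    congr 1
    ring
  simp only [hertz, Matrix.of_apply, hU.Del_div hx, d0, d1, s0, s1, key]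
  field_simp
  ring

end SAdS

/-! ### Assembly of the theorem -/

theorem theoremA1 (M k : ℝ) (hM : 0 < M) (hk : 0 < k)
    (D : Set Coord) (hD : IsOpen D) (hDext : D ⊆ exterior M k)
    (f : Coord → ℂ) (hf : SmoothSpinMinusTwo M k D f)
    (hteu : ∀ x ∈ sphDomain M k D, teukolskyMinusTwo M k f x = 0) :
    -- the expression defines a smooth real symmetric 2-tensor on `D`, also across the axis
    (∃ H : Tensor2, (∀ i j, ContDiffOn ℝ ∞ (fun p => H p i j) D) ∧
      (∀ p ∈ D, (H p).IsSymm) ∧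
      ∀ x ∈ sphDomain M k D, pullbackSph H x = hertz M k f x) ∧
    -- it is in the radiation gauge `h(L, ·) = 0`
    (∀ x ∈ sphDomain M k D, ∀ b,
      hertz M k f x 0 b + Del M k (x 1) / x 1 ^ 2 * hertz M k f x 1 b = 0) ∧
    -- it solves the linearised Einstein equations with `Λ = -3 k²`
    (∀ x ∈ sphDomain M k D, LinEinsteinAt (-3 * k ^ 2) (metric M k) (hertz M k f) x) ∧
    -- its Teukolsky quantities
    (∀ x ∈ sphDomain M k D,
      HasTeukolskyPlus M k (hertz M k f) x
        (4 * ((w M k (x 1) ^ 2 : ℝ) *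
          wL M k (wL M k (wL M k (wL M k (fun y => starRingEnd ℂ (f y))))) x)) ∧
      HasTeukolskyMinus M k (hertz M k f) x
        (4 * (angLdag (-1) (angLdag 0 (angLdag 1 (angLdag 2 (fun y => starRingEnd ℂ (f y))))) x
          - 12 * M * pd 0 f x))) := by
  have hC := cartesianDomain (k := k) hM hD hDext
  have hU := exteriorChart (k := k) hM hD
  obtain ⟨T, hT⟩ := hf.exists_sphereTensor hD hU
  refine ⟨⟨T.hertz hC, T.contDiffOn_hertz hC, fun p hp => T.hertz_isSymm hC hp,
    fun x hx => T.pullbackSph_hertz hC hU (sph_mem hD) hT ⟨x, hx⟩⟩,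
    fun x hx => hU.hertz_gauge f hx, fun x hx => ?_, fun x hx =>
    ⟨hU.hasTeukolskyPlus hT ⟨x, hx⟩, hU.hasTeukolskyMinus hT hteu ⟨x, hx⟩⟩⟩
  refine hU.linEinsteinAt (hU.isRe_hertz hT) (hU.hertzCoord_symm _) (fun i j => ?_) ⟨x, hx⟩
  rw [hU.toFrame_hertzCoord]
  exact hU.calculus.null.linRic_hertzFr (hU.teuk_eq_zero hT hteu) i j
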